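/- Let $\mathbb{K}$ be the function field of a smooth projective geometrically connected curve over a finite field $\mathbb{F}_q$ of characteristic $p$, let $\infty$ be a place of $\mathbb{K}$ of degree $d_\infty$ with normalized valuation $v_\infty$, let $\mathbf{A}\subset\mathbb{K}$ be the ring of functions regular outside $\infty$, let $\mathbb{K}_\infty$ be the completion of $\mathbb{K}$ at $\infty$ for $|x|_\infty=q^{-d_\infty v_\infty(x)}$, and let $\mathbf{C}_\infty$ be the completion of an algebraic closure of $\mathbb{K}_\infty$. *Exponentiation.* Fix a uniformizer $u_\infty$ of $\mathbb{K}_\infty$ and write $\mathbb{K}_\infty^*=\mathbb{F}_{q^{d_\infty}}^*\times u_\infty^{\mathbb{Z}}\times U_1$, where $U_1$ is the group of 1-units; the component of $x$ in $\mathbb{F}_{q^{d_\infty}}^*$ is $\mathrm{sign}(x)$, its component in $U_1$ is $\langle x\rangle$, and $x$ is positive if $\mathrm{sign}(x)=1$. Let $I\mapsto\langle I\rangle$ be the unique homomorphism from the group of fractional ideals of $\mathbf{A}$ to the 1-units of $\mathbf{C}_\infty$ with $\langle (a)\rangle=\langle a\rangle$ for every positive $a\in\mathbb{K}^*$. For $y\in\mathbb{Z}_p$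 put $\langle I\rangle^y=\sum_{j\ge 0}\binom{y}{j}(\langle I\rangle-1)^j$. For $s=(x,y)$ in the topological group $S_\infty=\mathbf{C}_\infty^*\times\mathbb{Z}_p$ put $I^s=x^{\deg I}\langle I\rangle^y$, where $\deg I=\log_q[\mathbf{A}:I]$ for $I\subset\mathbf{A}$, extended multiplicatively to fractional ideals. *Lattices.* A one-dimensional $\mathbb{K}$-rational lattice is a pair $L=(\Lambda,\phi)$ of a nonzero finitely generated $\mathbf{A}$-submodule $\Lambda\subset\mathbb{K}$ and an $\mathbf{A}$-module homomorphism $\phi:\mathbb{K}/\mathbf{A}\to\mathbb{K}/\Lambda$; the ideal of $L$ is the fractional ideal $\Lambda$. For fixed $\Lambda$ the homomorphisms $\phi$ carry the topology of pointwise convergence ($\mathbb{K}/\Lambda$ being discrete), and $\Lambda$ varies discretely. Two such lattices are commensurable, $(\Lambda,\phi)\sim(\Lambda',\phi')$, if $\phi=\phi'$ modulo $\Lambda+\Lambda'$. Let $\mathcal{G}$ be the topological quotient of the space of pairs $(L,L')$ of commensurable lattices by the relation $(L,L')\equiv(kL,kL')$, $k\in\mathbb{K}^*$. For $(L,L')$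 in $\mathcal G$ with ideals $I$ and $J$ the ratio $I^s/J^s$ depends only on the class of $(L,L')$. *The algebra.* Let $\mathcal{A}(\mathcal{L}_{\mathbb{K},1})$ be the space of continuous compactly supported functions $f:\mathcal{G}\to\mathbf{C}_\infty$ with the convolution product $$(f_1*f_2)(L,L')=\sum_{L\sim L''\sim L'}f_1(L,L'')f_2(L'',L').$$ For each $L$ let $c(L)=\{L' : L'\sim L\}$, let $\mathcal{V}_L$ be the completion in the sup norm of the space of finitely supported $\mathbf{C}_\infty$-valued functions on $c(L)$, and let $$(\pi_L(f)\xi)(L')=\sum_{L''\in c(L)}f(L',L'')\xi(L''),\qquad \|f\|_{\pi_L}=\sup_{\xi\ne 0}\frac{\|\pi_L(f)\xi\|}{\|\xi\|}.$$ Let $\overline{\mathcal{A}}_L$ be the Banach algebra completion of $\mathcal{A}(\mathcal{L}_{\mathbb{K},1})$ for $\|\cdot\|_{\pi_L}$, represented on $\mathcal{V}_L$ by the extension of $\pi_L$. **Proposition.** The convolution product makes $\mathcal{A}(\mathcal{L}_{\mathbb{K},1})$ an algebra, and each $\pi_L$ is a representation of it by bounded operators on $\mathcal{V}_L$. The expression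 $$(\sigma_y f)(L,L')=\frac{\langle I\rangle^y}{\langle J\rangle^y}\,f(L,L'),\qquad y\in\mathbb{Z}_p,$$ where $I$ and $J$ are the ideals of $L$ and $L'$, defines a group homomorphism from $\mathbb{Z}_p$ to the group of algebra automorphisms of $\mathcal{A}(\mathcal{L}_{\mathbb{K},1})$. For every $L$ it extends to a continuous time evolution on $\overline{\mathcal{A}}_L$, that is, to a group homomorphism $\sigma$ from $\mathbb{Z}_p$ to the group of continuous $\mathbf{C}_\infty$-algebra automorphisms of $\overline{\mathcal{A}}_L$ such that $y\mapsto\pi_L(\sigma_y(a))\xi$ is continuous for all $a\in\overline{\mathcal{A}}_L$ and $\xi\in\mathcal{V}_L$. Moreover $$(\sigma_s f)(L,L')=\frac{I^s}{J^s}\,f(L,L'),\qquad s=(x,y)\in S_\infty,$$ defines a group homomorphism from $S_\infty$ to the group of algebra automorphisms of $\mathcal{A}(\mathcal{L}_{\mathbb{K},1})$ with $\sigma_{(1,y)}=\sigma_y$, and it is an analytic extension: for all $L$ and all $f\in\mathcal{A}(\mathcal{L}_{\mathbb{K},1})$ one has $\sigma_{(x,y)}f=\sum_{n\in\mathbb{Z}}a_n(y)x^n$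 in $\overline{\mathcal{A}}_L$, with continuous coefficients $a_n:\mathbb{Z}_p\to\overline{\mathcal{A}}_L$ such that $\sup_{y}\|a_n(y)\|\,r^n\to 0$ as $|n|\to\infty$ for every real $r>0$. -/

import Mathlib

open scoped NNReal WithZero Topology CompactlySupported ZeroAtInfty
open Filter

noncomputable section

namespace FFQSM

/-! ### The function field, the place `∞`, the ring `A` and the fields `K_∞`, `C_∞` -/

/-- `K` is the function field of a smooth projective geometrically connected curve over the finite
field `Fq`: a field of finite type and transcendence degree one over `Fq` in which `Fq` is
algebraically closed. -/
def IsCurveFunctionField (Fq K : Type*) [Field Fq] [Field K] [Algebra Fq K] : Prop :=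
  algebraicClosure Fq K = ⊥ ∧
    ∃ t : K, Transcendental Fq t ∧ FiniteDimensional (IntermediateField.adjoin Fq {t}) K

/-- A place of `K`, given by its normalized discrete valuation (written multiplicatively: for
`x ≠ 0`, the usual integer `v_∞(x)` is `-log (v x)`). -/
structure Place (K : Type*) [Field K] where
  v : Valuation K ℤᵐ⁰
  surjective : Function.Surjective v

variable {K : Type*} [Field K]

namespace Place

variable (P : Place K)

/-- The number `q ^ d_∞` of elements of the residue field at `∞`. (The residue field is finite, so
the maximum with `2` changes nothing; it makes the next definitions available without proof.) -/
def residueCard : ℝ≥0 :=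
  max 2 (Nat.card (IsLocalRing.ResidueField P.v.valuationSubring) : ℝ≥0)

theorem one_lt_residueCard : 1 < P.residueCard :=
  lt_of_lt_of_le one_lt_two (le_max_left _ _)

/-- The normalized absolute value `|x|_∞ = q ^ (- d_∞ v_∞(x))` on `K`. -/
def abv : AbsoluteValue K ℝ where
  toFun x := WithZeroMulInt.toNNReal (zero_lt_one.trans P.one_lt_residueCard).ne' (P.v x)
  map_mul' x y := by simp
  nonneg' x := NNReal.coe_nonneg _
  eq_zero' x := by simp
  add_le' x y := by
    have hm := (WithZeroMulInt.toNNReal_strictMono P.one_lt_residueCard).monotone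
    have h := hm (P.v.map_add x y)
    rw [hm.map_max] at h
    exact_mod_cast h.trans (max_le_add_of_nonneg zero_le zero_le)

theorem abv_add_le_max (x y : K) : P.abv (x + y) ≤ max (P.abv x) (P.abv y) := by
  have hm := (WithZeroMulInt.toNNReal_strictMono P.one_lt_residueCard).monotone
  have h := hm (P.v.map_add x y)
  rw [hm.map_max] at h
  change ((_ : ℝ≥0) : ℝ) ≤ max ((_ : ℝ≥0) : ℝ) ((_ : ℝ≥0) : ℝ)
  exact_mod_cast h

theorem exists_one_lt_abv : ∃ x : K, 1 < P.abv x := by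
  obtain ⟨x, hx⟩ := P.surjective (WithZero.exp 1)
  refine ⟨x, ?_⟩
  have h := (WithZeroMulInt.toNNReal_strictMono P.one_lt_residueCard)
    (show (1 : ℤᵐ⁰) < P.v x by rw [hx, ← WithZero.exp_zero]; exact WithZero.exp_lt_exp.2 one_pos)
  rw [map_one] at h
  change (1 : ℝ) < ((_ : ℝ≥0) : ℝ)
  exact_mod_cast h

/-- `K_∞`, the completion of `K` at the place `∞`. -/
abbrev Kinf := P.abv.Completion

/-- The embedding of `K` in `K_∞`. -/
def toKinf (x : K) : P.Kinf := ((WithAbs.toAbs P.abv x : WithAbs P.abv) : P.Kinf)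

theorem norm_toKinf (x : K) : ‖P.toKinf x‖ = P.abv x :=
  UniformSpace.Completion.norm_coe _

instance : IsUltrametricDist P.Kinf := by
  refine IsUltrametricDist.isUltrametricDist_of_forall_norm_add_le_max_norm fun x y => ?_
  induction x, y using UniformSpace.Completion.induction_on₂ with
  | hp => exact isClosed_le (by fun_prop) (by fun_prop)
  | ih a b =>
    rw [← UniformSpace.Completion.coe_add]
    simp only [UniformSpace.Completion.norm_coe]
    exact P.abv_add_le_max a.ofAbs b.ofAbs

instance : NontriviallyNormedField P.Kinf where
  non_trivial := by
    obtain ⟨x, hx⟩ := P.exists_one_lt_abv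
    exact ⟨P.toKinf x, by rwa [norm_toKinf]⟩

/-- An algebraic closure of `K_∞`, with the unique extension of the absolute value. -/
abbrev KinfAlgCl := AlgebraicClosure P.Kinf

instance : NormedField P.KinfAlgCl := spectralNorm.normedField P.Kinf P.KinfAlgCl

instance : NormedAlgebra P.Kinf P.KinfAlgCl := spectralNorm.normedAlgebra P.Kinf P.KinfAlgCl

/-- `C_∞`, the completion of the algebraic closure of `K_∞`. -/
def Cinf := UniformSpace.Completion P.KinfAlgCl

instance : NormedField P.Cinf := inferInstanceAs (NormedField (UniformSpace.Completion P.KinfAlgCl))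

instance : CompleteSpace P.Cinf :=
  inferInstanceAs (CompleteSpace (UniformSpace.Completion P.KinfAlgCl))

/-- The embedding of `K_∞` in `C_∞`. -/
def toCinf (x : P.Kinf) : P.Cinf :=
  ((algebraMap P.Kinf P.KinfAlgCl x : P.KinfAlgCl) : UniformSpace.Completion P.KinfAlgCl)

theorem norm_toCinf (x : P.Kinf) : ‖P.toCinf x‖ = ‖x‖ :=
  (UniformSpace.Completion.norm_coe _).trans (norm_algebraMap' _ _)

instance : NontriviallyNormedField P.Cinf where
  non_trivial := by
    obtain ⟨x, hx⟩ := P.exists_one_lt_abv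
    exact ⟨P.toCinf (P.toKinf x), by rwa [norm_toCinf, norm_toKinf]⟩

/-- The ring `A ⊂ K` of functions regular outside `∞`: the intersection of the valuation rings of
all the places of `K` other than `∞`. -/
def ringA : Subring K :=
  ⨅ (O : ValuationSubring K) (_ : O ≠ P.v.valuationSubring), O.toSubring

/-! ### Exponentiation of ideals -/

/-- `u` is a uniformizer of `K_∞`: a generator of the maximal ideal of the valuation ring. -/
def IsUniformizer (u : P.Kinf) : Prop :=
  ‖u‖ < 1 ∧ ∀ x : P.Kinf, ‖x‖ < 1 → ‖x‖ ≤ ‖u‖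

/-- With respect to the decomposition `K_∞^* = μ × u ^ ℤ × U₁` determined by the uniformizer `u`
(`μ` the roots of unity of order prime to `p`, `U₁` the 1-units), `x` is positive, that is, its
component `sign(x)` in `μ` is `1`, and its component `⟨x⟩` in `U₁` is `γ`. -/
def IsPositiveWith (u x γ : P.Kinf) : Prop :=
  ‖γ - 1‖ < 1 ∧ ∃ m : ℤ, x = u ^ m * γ

/-- `w` is the 1-unit `⟨I⟩` of `C_∞` attached to the fractional ideal `I`. The extension of
`⟨a⟩` from principal ideals with a positive generator `a` to all fractional ideals, with values in
the 1-units of `C_∞`, is unique because some power `I ^ h` is principal with a positive generator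
`a`, and because `⟨a⟩` has exactly one `h`-th root which is the value at `I`. -/
def IsIdealUnit (u : P.Kinf) (I : Submodule P.ringA K) (w : P.Cinf) : Prop :=
  ‖w - 1‖ < 1 ∧ ∃ (h : ℕ) (a : K) (γ : P.Kinf), 0 < h ∧ P.IsPositiveWith u (P.toKinf a) γ ∧
    I ^ h = Submodule.span P.ringA {a} ∧ w ^ h = P.toCinf γ

open Classical in
/-- The 1-unit `⟨I⟩ ∈ C_∞` of a fractional ideal `I`. -/
def idealUnit (u : P.Kinf) (I : Submodule P.ringA K) : P.Cinf :=
  if h : ∃ w, P.IsIdealUnit u I w then h.choose else 1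

/-- `w ^ y = ∑ⱼ (y choose j) (w - 1) ^ j` for a 1-unit `w` of `C_∞` and `y ∈ ℤ_p`; the binomial
coefficient in `ℤ_p` acts on the field `C_∞` of characteristic `p` through `ℤ_p / p = 𝔽_p`. -/
def unitPow {p : ℕ} [Fact p.Prime] (w : P.Cinf) (y : ℤ_[p]) : P.Cinf :=
  ∑' j : ℕ, ((PadicInt.toZMod (Ring.choose y j)).val : P.Cinf) * (w - 1) ^ j

/-- The degree of a fractional ideal `I` over the field of constants with `q` elements, normalized
by `deg I = log_q [A : I]` for `I ⊆ A`; in general it is `log_q [A : A ∩ I] - log_q [I : A ∩ I]`. -/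
def idealDeg (q : ℕ) (I : Submodule P.ringA K) : ℤ :=
  (Nat.log q (I.toAddSubgroup.relIndex (1 : Submodule P.ringA K).toAddSubgroup) : ℤ) -
    (Nat.log q ((1 : Submodule P.ringA K).toAddSubgroup.relIndex I.toAddSubgroup) : ℤ)

/-- The topological group `S_∞ = C_∞^* × ℤ_p`, with `(x₁, y₁) + (x₂, y₂) = (x₁ x₂, y₁ + y₂)`;
it is written multiplicatively. -/
abbrev S (p : ℕ) [Fact p.Prime] := P.Cinfˣ × Multiplicative ℤ_[p]

/-- `I ^ s = x ^ (deg I) ⟨I⟩ ^ y` for a fractional ideal `I` and `s = (x, y) ∈ S_∞`. -/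
def idealPow (q : ℕ) (u : P.Kinf) {p : ℕ} [Fact p.Prime] (I : Submodule P.ringA K) (s : P.S p) :
    P.Cinf :=
  (s.1 : P.Cinf) ^ P.idealDeg q I * P.unitPow (P.idealUnit u I) s.2.toAdd

/-- Analytic functions on `S_∞` with values in a normed space: `F (x, y) = ∑ₙ aₙ(y) x ^ n`, a
family of Laurent series in `x` which depends continuously on `y ∈ ℤ_p` and converges on all of
`C_∞^*`, uniformly for `y ∈ ℤ_p` and for `x` in closed annuli. -/
def IsAnalyticOnS {p : ℕ} [Fact p.Prime] {E : Type*} [NormedAddCommGroup E] [NormedSpace P.Cinf E]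
    (F : P.S p → E) : Prop :=
  ∃ a : ℤ → ℤ_[p] → E, (∀ n, Continuous (a n)) ∧
    (∀ r : ℝ, 0 < r → ∀ ε : ℝ, 0 < ε → ∀ᶠ n in cofinite, ∀ y, ‖a n y‖ * r ^ n ≤ ε) ∧
    ∀ (x : P.Cinfˣ) (y : ℤ_[p]),
      HasSum (fun n : ℤ => (x : P.Cinf) ^ n • a n y) (F (x, Multiplicative.ofAdd y))

/-! ### One-dimensional `K`-rational lattices and commensurability -/

/-- A one-dimensional `K`-rational lattice `(Λ, φ)`: a lattice `Λ` of rank one, i.e. a nonzero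
finitely generated `A`-submodule of `K` (a fractional ideal), together with a homomorphism of
`A`-modules `φ : K / A → K / Λ`. Here `1` is the `A`-submodule `A` of `K`. -/
structure KLattice where
  Λ : Submodule P.ringA K
  fg : Λ.FG
  ne_bot : Λ ≠ ⊥
  φ : (K ⧸ (1 : Submodule P.ringA K)) →ₗ[P.ringA] (K ⧸ Λ)

variable {P}

/-- The topology on `K`-rational lattices: `Λ` varies discretely, and for a fixed `Λ` the
homomorphisms `φ` from `K / A` to the discrete module `K / Λ` carry the topology of pointwise
convergence (for which they form a profinite group, the closure of `Λ` in the finite adeles). -/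
instance : TopologicalSpace P.KLattice :=
  TopologicalSpace.generateFrom
    {U | ∃ (Λ₀ : Submodule P.ringA K) (x y : K), U = {L : P.KLattice | L.Λ = Λ₀ ∧
      L.φ (Submodule.Quotient.mk x) = Submodule.Quotient.mk y}}

/-- `(Λ, φ)` and `(Λ', φ')` are commensurable: `φ` and `φ'` agree modulo `Λ + Λ'`. -/
def KLattice.Commens (L L' : P.KLattice) : Prop :=
  Submodule.factor (le_sup_left : L.Λ ≤ L.Λ ⊔ L'.Λ) ∘ₗ L.φ =
    Submodule.factor (le_sup_right : L'.Λ ≤ L.Λ ⊔ L'.Λ) ∘ₗ L'.φ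

/-- `M = k L`: the isomorphism of `K`-rational lattices given by multiplication by `k ∈ K^*`. -/
def KLattice.IsScaling (k : Kˣ) (L M : P.KLattice) : Prop :=
  (∀ x : K, x ∈ L.Λ ↔ (k : K) * x ∈ M.Λ) ∧
    ∀ x y : K, L.φ (Submodule.Quotient.mk x) = Submodule.Quotient.mk y →
      M.φ (Submodule.Quotient.mk x) = Submodule.Quotient.mk ((k : K) * y)

variable (P)

/-- Pairs `(L, L')` of commensurable `K`-rational lattices. -/
abbrev CommensPair := {c : P.KLattice × P.KLattice // c.1.Commens c.2}

/-- The groupoid of the commensurability relation on one-dimensional `K`-rational lattices up to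
isomorphism: pairs of commensurable lattices, modulo `(L, L') ∼ (k L, k L')` for `k ∈ K^*`. -/
def Groupoid :=
  Quot fun c d : P.CommensPair => ∃ k : Kˣ, KLattice.IsScaling k c.1.1 d.1.1 ∧ KLattice.IsScaling k c.1.2 d.1.2

instance : TopologicalSpace P.Groupoid := inferInstanceAs (TopologicalSpace (Quot _))

/-! ### The convolution algebra and its representations -/

/-- The algebra `𝒜(ℒ_{K,1})` of continuous, compactly supported, `C_∞`-valued functions
`f(L, L')` of pairs of commensurable lattices; its product is convolution, see below. -/
def ConvAlg := C_c(P.Groupoid, P.Cinf)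

instance : AddCommGroup P.ConvAlg := inferInstanceAs (AddCommGroup C_c(P.Groupoid, P.Cinf))

instance : Module P.Cinf P.ConvAlg := inferInstanceAs (Module P.Cinf C_c(P.Groupoid, P.Cinf))

variable {P}

open Classical in
/-- The value `f(L, L')`, which is by convention `0` unless `L` and `L'` are commensurable. -/
def ConvAlg.val (f : P.ConvAlg) (L L' : P.KLattice) : P.Cinf :=
  if h : L.Commens L' then
    CompactlySupportedContinuousMap.toContinuousMap f (Quot.mk _ ⟨(L, L'), h⟩)
  else 0

/-- `h = f * g`, that is `h(L, L') = ∑ f(L, M) g(M, L')`, sum over `M` with `L ∼ M ∼ L'`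
(the other terms are `0`; only finitely many terms are nonzero). -/
def ConvAlg.IsConvolution (f g h : P.ConvAlg) : Prop :=
  ∀ L L' : P.KLattice, L.Commens L' →
    (Function.support fun M : P.KLattice => f.val L M * g.val M L').Finite ∧
    h.val L L' = ∑ᶠ M : P.KLattice, f.val L M * g.val M L'

open Classical in
/-- The convolution product. -/
instance : Mul P.ConvAlg :=
  ⟨fun f g => if H : ∃ h, f.IsConvolution g h then H.choose else 0⟩

/-- The commensurability class `c(L)` of `L`, with the discrete topology. -/
def KLattice.CommensClass (L : P.KLattice) := {L' : P.KLattice // L.Commens L'}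

instance (L : P.KLattice) : TopologicalSpace L.CommensClass := ⊥

instance (L : P.KLattice) : DiscreteTopology L.CommensClass := ⟨rfl⟩

/-- The Banach space `𝒱_L`: the completion, in the sup norm, of the space of finitely supported
`C_∞`-valued functions on `c(L)`, that is, the functions on `c(L)` which tend to `0`. -/
def KLattice.VL (L : P.KLattice) := C₀(L.CommensClass, P.Cinf)

instance (L : P.KLattice) : NormedAddCommGroup L.VL :=
  inferInstanceAs (NormedAddCommGroup C₀(L.CommensClass, P.Cinf))

instance (L : P.KLattice) : NormedSpace P.Cinf L.VL :=
  inferInstanceAs (NormedSpace P.Cinf C₀(L.CommensClass, P.Cinf))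

instance (L : P.KLattice) : FunLike L.VL L.CommensClass P.Cinf :=
  inferInstanceAs (FunLike C₀(L.CommensClass, P.Cinf) L.CommensClass P.Cinf)

/-- `T` is the operator `π_L(f)`, `(T ξ)(L') = ∑ f(L', L'') ξ(L'')`, sum over `L'' ∈ c(L)`
(only finitely many terms are nonzero). -/
def KLattice.IsPi (L : P.KLattice) (f : P.ConvAlg) (T : L.VL →L[P.Cinf] L.VL) : Prop :=
  ∀ (ξ : L.VL) (L' : L.CommensClass),
    (Function.support fun L'' : L.CommensClass => f.val L'.1 L''.1 * ξ L'').Finite ∧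
    T ξ L' = ∑ᶠ L'' : L.CommensClass, f.val L'.1 L''.1 * ξ L''

open Classical in
/-- The representation `π_L` of the convolution algebra by bounded operators on `𝒱_L`. -/
def KLattice.piL (L : P.KLattice) (f : P.ConvAlg) : L.VL →L[P.Cinf] L.VL :=
  if H : ∃ T, L.IsPi f T then H.choose else 0

/-- The Banach algebra completion of the convolution algebra in the norm
`‖f‖ = sup_ξ ‖π_L(f) ξ‖ / ‖ξ‖`, realized as the closure of the image of `π_L` in the Banach algebra
of bounded operators on `𝒱_L` with the operator norm. (The image of `π_L` is a subalgebra, so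
`adjoin` adds nothing to it.) -/
def KLattice.BanachAlg (L : P.KLattice) : NonUnitalSubalgebra P.Cinf (L.VL →L[P.Cinf] L.VL) :=
  (NonUnitalAlgebra.adjoin P.Cinf (Set.range L.piL)).topologicalClosure

instance (L : P.KLattice) : NormedSpace P.Cinf L.BanachAlg where
  norm_smul_le c a := norm_smul_le c (a : L.VL →L[P.Cinf] L.VL)

/-- The image of an element of the convolution algebra in the completion. -/
def KLattice.toBanachAlg (L : P.KLattice) (f : P.ConvAlg) : L.BanachAlg :=
  ⟨L.piL f, NonUnitalSubalgebra.le_topologicalClosure _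
    (NonUnitalAlgebra.subset_adjoin P.Cinf (Set.mem_range_self f))⟩

end Place

/-- `σ : ℤ_p → Aut(𝒜)` is a continuous time evolution on the Banach algebra `𝒜`, represented by
`π` on the Banach space `V`: every `σ_y` is a continuous `𝕜`-linear automorphism (with continuous
inverse `σ_{-y}`), and all the maps `y ↦ π(σ_y(a)) ξ` are continuous. -/
def IsContinuousTimeEvolution {𝕜 𝒜 V : Type*} [NontriviallyNormedField 𝕜] [NonUnitalNonAssocSemiring 𝒜]
    [Module 𝕜 𝒜] [TopologicalSpace 𝒜] [NormedAddCommGroup V] [NormedSpace 𝕜 V] {p : ℕ}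
    [Fact p.Prime] (π : 𝒜 → V →L[𝕜] V) (σ : Multiplicative ℤ_[p] →* RingAut 𝒜) : Prop :=
  (∀ (y : ℤ_[p]) (c : 𝕜) (a : 𝒜),
    σ (Multiplicative.ofAdd y) (c • a) = c • σ (Multiplicative.ofAdd y) a) ∧
  (∀ y : ℤ_[p], Continuous (σ (Multiplicative.ofAdd y))) ∧
  ∀ (a : 𝒜) (ξ : V), Continuous fun y : ℤ_[p] => π (σ (Multiplicative.ofAdd y) a) ξ

end FFQSM

end

/-! A lattice commensurable with L is determined by its ideal, so c(L) embeds in the set of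
fractional ideals. Modulo K^* a commensurable pair has an orbit of pairs of ideals; the resulting
map from the groupoid to the discrete set `Orbits` is continuous, and its fibres are compact because
the homomorphisms K/A → K/Λ form a profinite group. Hence an element f of the convolution algebra
lives over finitely many orbits. The stabilizer in K^* of a lattice Λ is A^*, which fixes every
ideal, so the matrix of f on c(L) has finite rows and finite columns. This yields the convolution
product, the operators π_L(f) (bounded by sup |f| since C_∞ is ultrametric) and their
multiplicativity.

Both evolutions multiply f(L, L') by a ratio ρ_g(Λ)/ρ_g(Λ') of weights of the two ideals. Such a
ratio is a cocycle, so the twist respects convolution (`Weight.aut`). If all |ρ_g(Λ)| = 1, as for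
⟨I⟩^y, the diagonal operator with entries ρ_g(Λ) is an isometry of 𝒱_L, and conjugation by it
implements the twist (`Weight.conj_piL`); this extends the automorphism to the completion. Strong
continuity holds because vectors of 𝒱_L tend to 0 (`Weight.continuous_diag_apply`). Since f lives
over finitely many orbits, σ_(x,y) f is a Laurent polynomial in x with coefficients continuous in y
(`Weight.exists_twist_eq_sum`), whence analyticity.

The arithmetic input is that A is a Dedekind domain with fraction field K, finite class group and
finite quotients (`ringA_isDedekindDomain`). It is the integral closure of Fq[t] for a nonconstant t
in A, and such a t is found by a pigeonhole argument over the finite field in place of Riemann-Roch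
(`exists_mem_ringA_one_lt`). Finiteness of the class group, with existence and uniqueness of roots
of 1-units in C_∞, makes ⟨I⟩ well defined and multiplicative (`IsIdealUnit.unique`,
`idealUnit_mul`). Invariance of degree differences under K^* comes from relative indices of lattices
(`idealDeg_sub`). -/

noncomputable section
namespace FFQSM

/-! ### Finite and separable extensions of k(t), and integral closures of k[τ]. -/

section FieldTheory

open IntermediateField Polynomial

variable {k F : Type*} [Field k] [Field F] [Algebra k F]

/-- The transcendence degree is at most one, so `{s}` is a transcendence basis and F is algebraic
over k(s); being essentially of finite type over k, it is then finite over k(s). -/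
theorem finiteDimensional_adjoin_of_transcendental {t s : F} (hs : Transcendental k s)
    (hfin : FiniteDimensional k⟮t⟯ F) : FiniteDimensional k⟮s⟯ F := by
  have hess : Algebra.EssFiniteType k F := by
    have h1 : Algebra.EssFiniteType k k⟮t⟯ := by
      rw [IntermediateField.essFiniteType_iff]
      exact ⟨{t}, by simp⟩
    exact Algebra.EssFiniteType.comp k k⟮t⟯ F
  have htr : Algebra.trdeg k F ≤ 1 := by
    have halg : Algebra.IsAlgebraic (Algebra.adjoin k {t}) F :=
      isAlgebraic_adjoin_iff_top.1 inferInstance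
    simpa using Algebra.IsAlgebraic.trdeg_le_cardinalMk k ({t} : Set F)
  have hb : IsTranscendenceBasis k ((↑) : ({s} : Set F) → F) :=
    (algebraicIndependent_unique_type_iff.2 hs).isTranscendenceBasis_of_trdeg_le_of_finite
      (by simpa using htr)
  have halg : Algebra.IsAlgebraic k⟮s⟯ F := by
    have := hb.isAlgebraic_field
    rwa [Subtype.range_coe] at this
  have : Algebra.EssFiniteType k⟮s⟯ F := Algebra.EssFiniteType.of_comp k k⟮s⟯ F
  exact Algebra.finite_of_essFiniteType_of_isAlgebraic

/-- Let E be the separable closure of k(t) in F and suppose E ≠ F. Separability and perfectness of k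
give E = E^p(t), of degree at most p over E^p. Some x outside E has y = x^p in E, and y generates an
extension of E^p of degree exactly p inside E. So t lies in E^p(y), which is contained in F^p, and t
is a p-th power. -/
theorem isSeparable_adjoin_of_forall_pow_ne (p : ℕ) [hp : Fact p.Prime] [CharP k p]
    [PerfectField k] {t : F} [FiniteDimensional k⟮t⟯ F] (ht : ∀ x : F, x ^ p ≠ t) :
    Algebra.IsSeparable k⟮t⟯ F := by
  have : CharP F p := charP_of_injective_algebraMap (algebraMap k F).injective p
  have : CharP k⟮t⟯ p := charP_of_injective_algebraMap (algebraMap k k⟮t⟯).injective p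
  have : ExpChar k⟮t⟯ p := .prime hp.out
  have : ExpChar k p := .prime hp.out
  have : ExpChar F p := .prime hp.out
  have : PerfectRing k p := PerfectField.toPerfectRing p
  rw [← separableClosure.eq_top_iff]
  by_contra hE
  set E := separableClosure k⟮t⟯ F with hEdef
  have hpi : IsPurelyInseparable E F := inferInstance
  obtain ⟨x, hxE, hxp⟩ : ∃ x : F, x ∉ E ∧ x ^ p ∈ E := by
    obtain ⟨z, hz⟩ : ∃ z : F, z ∉ E := by
      by_contra! h
      exact hE (eq_top_iff.2 fun x _ => h x)
    have : CharP E p := charP_of_injective_algebraMap (algebraMap k⟮t⟯ E).injective p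
    have : ExpChar E p := .prime hp.out
    have hex : ∃ n : ℕ, z ^ p ^ n ∈ E := by
      obtain ⟨n, y, hy⟩ := (isPurelyInseparable_iff_pow_mem E p).1 hpi z
      exact ⟨n, by rw [← hy]; exact y.2⟩
    classical
    have h0 : Nat.find hex ≠ 0 := fun h => hz (by simpa [h] using Nat.find_spec hex)
    obtain ⟨m, hm⟩ := Nat.exists_eq_succ_of_ne_zero h0
    refine ⟨z ^ p ^ m, Nat.find_min hex (by omega), ?_⟩
    rw [← pow_mul, ← pow_succ]
    have := Nat.find_spec hex
    rwa [hm] at this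
  -- This is E^p, viewed inside F.
  let E₀ : Subfield F := E.toSubfield.map (frobenius F p)
  have hE₀ : ∀ z : F, z ∈ E₀ ↔ ∃ w ∈ E, w ^ p = z := fun z => Iff.rfl
  have htE : t ∈ E := E.algebraMap_mem ⟨t, mem_adjoin_simple_self k t⟩
  have hE₀E : ∀ z ∈ E, z ∈ E₀⟮t⟯ := by
    have h1 : adjoin k⟮t⟯ (E : Set F) = E := adjoin_self _ _
    have hsep : Algebra.IsSeparable k⟮t⟯ (adjoin k⟮t⟯ (E : Set F)) := by
      rw [h1]; infer_instance
    have h2 := adjoin_eq_adjoin_pow_expChar_of_isSeparable k⟮t⟯ F (E : Set F) p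
    rw [h1] at h2
    intro z hz
    rw [h2] at hz
    refine adjoin_le_subfield (F := k⟮t⟯) (S := (· ^ p) '' (E : Set F))
      (K := (E₀⟮t⟯).toSubfield) ?_ ?_ hz
    · rintro _ ⟨⟨w, hw⟩, rfl⟩
      refine adjoin_le_subfield (F := k) (S := {t}) (K := (E₀⟮t⟯).toSubfield) ?_ ?_ hw
      · rintro _ ⟨c, rfl⟩
        obtain ⟨d, hd⟩ := surjective_frobenius k p c
        have : algebraMap k F c ∈ E₀ := by
          refine (hE₀ _).2 ⟨algebraMap k F d, ?_, ?_⟩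
          · exact E.algebraMap_mem (algebraMap k k⟮t⟯ d)
          · rw [← map_pow, ← hd]; rfl
        exact (E₀⟮t⟯).algebraMap_mem ⟨_, this⟩
      · rintro _ rfl
        exact mem_adjoin_simple_self E₀ _
    · rintro _ ⟨w, hw, rfl⟩
      exact (E₀⟮t⟯).algebraMap_mem ⟨_, (hE₀ _).2 ⟨w, hw, rfl⟩⟩
  let t' : E₀ := ⟨t ^ p, (hE₀ _).2 ⟨t, htE, rfl⟩⟩
  have hroot : aeval t (X ^ p - C t' : E₀[X]) = 0 := by
    simp only [map_sub, map_pow, aeval_X, aeval_C, sub_eq_zero]; rfl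
  have hmon : (X ^ p - C t' : E₀[X]).Monic := monic_X_pow_sub_C _ hp.out.ne_zero
  have hint : IsIntegral E₀ t := ⟨_, hmon, hroot⟩
  have hle : Module.finrank E₀ E₀⟮t⟯ ≤ p := by
    rw [adjoin.finrank hint]
    have := natDegree_le_of_dvd (minpoly.dvd E₀ t hroot) hmon.ne_zero
    rwa [natDegree_X_pow_sub_C] at this
  have : FiniteDimensional E₀ E₀⟮t⟯ := adjoin.finiteDimensional hint
  set y := x ^ p with hy
  have hyE₀ : y ∉ E₀ := by
    rintro h
    obtain ⟨w, hw, hwy⟩ := (hE₀ _).1 h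
    have : w = x := frobenius_inj F p hwy
    exact hxE (this ▸ hw)
  let y' : E₀ := ⟨y ^ p, (hE₀ _).2 ⟨y, hxp, rfl⟩⟩
  have hrooty : aeval y (X ^ p - C y' : E₀[X]) = 0 := by
    simp only [map_sub, map_pow, aeval_X, aeval_C, sub_eq_zero]; rfl
  have hirr : Irreducible (X ^ p - C y' : E₀[X]) := by
    refine X_pow_sub_C_irreducible_of_prime hp.out fun b hb => hyE₀ ?_
    have : (b : F) ^ p = y ^ p := congrArg Subtype.val hb
    have : (b : F) = y := frobenius_inj F p this
    exact this ▸ b.2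
  have hmony : (X ^ p - C y' : E₀[X]).Monic := monic_X_pow_sub_C _ hp.out.ne_zero
  have hdegy : Module.finrank E₀ E₀⟮y⟯ = p := by
    rw [adjoin.finrank ⟨_, hmony, hrooty⟩, ← minpoly.eq_of_irreducible_of_monic hirr hrooty hmony,
      natDegree_X_pow_sub_C]
  have hyt : E₀⟮y⟯ ≤ E₀⟮t⟯ := by
    rw [adjoin_simple_le_iff]; exact hE₀E y hxp
  have heq := eq_of_le_of_finrank_le hyt (by rw [hdegy]; exact hle)
  have htmem : t ∈ E₀⟮y⟯ := by rw [heq]; exact mem_adjoin_simple_self _ _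
  have := adjoin_le_subfield (F := E₀) (S := {y}) (K := (frobenius F p).fieldRange) ?_ ?_ htmem
  · obtain ⟨z, hz⟩ := this
    exact ht z hz
  · rintro _ ⟨⟨w, hw⟩, rfl⟩
    obtain ⟨v, -, hv⟩ := (hE₀ _).1 hw
    exact ⟨v, hv⟩
  · rintro _ rfl
    exact ⟨x, rfl⟩

theorem algebraMap_mem_valuationSubring [Finite k] (O : ValuationSubring F) (c : k) :
    algebraMap k F c ∈ O := by
  rcases eq_or_ne c 0 with rfl | hc
  · simp
  have := Fintype.ofFinite k
  rcases O.mem_or_inv_mem (algebraMap k F c) with h | h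
  · exact h
  · have h1 := FiniteField.pow_card_sub_one_eq_one c hc
    have h2 : Fintype.card k - 1 ≠ 0 := Nat.sub_ne_zero_of_lt Fintype.one_lt_card
    have h3 : c = c⁻¹ ^ (Fintype.card k - 1 - 1) := by
      rw [inv_pow]
      refine eq_inv_of_mul_eq_one_right ?_
      rw [← pow_succ, Nat.sub_add_cancel (Nat.one_le_iff_ne_zero.2 h2), h1]
    rw [h3, map_pow, map_inv₀]
    exact pow_mem h _

/-- The intersection of all valuation rings containing `τ` is a Dedekind domain with finite class
group and finite residue rings, if `F` is finite separable over `k(τ)`. -/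
theorem isDedekindDomain_of_forall_mem_iff [Finite k] {τ : F} (hτ : Transcendental k τ)
    [FiniteDimensional k⟮τ⟯ F] [Algebra.IsSeparable k⟮τ⟯ F] (B : Subring F)
    (hB : ∀ x, x ∈ B ↔ ∀ O : ValuationSubring F, τ ∈ O → x ∈ O) :
    IsDedekindDomain B ∧ IsFractionRing B F ∧ Finite (ClassGroup B) ∧
      Ring.HasFiniteQuotients B := by
  have := Fintype.ofFinite k
  let i₀ : k[X] →ₐ[k] k⟮τ⟯ := aeval (AdjoinSimple.gen k τ)
  let : Algebra k[X] k⟮τ⟯ := i₀.toRingHom.toAlgebra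
  let : Algebra k[X] F := (aeval τ : k[X] →ₐ[k] F).toRingHom.toAlgebra
  have haeval : ∀ f : k[X], algebraMap k[X] F f = aeval τ f := fun f => rfl
  have : IsScalarTower k[X] k⟮τ⟯ F := .of_algebraMap_eq fun f => by
    change aeval τ f = algebraMap k⟮τ⟯ F (aeval (AdjoinSimple.gen k τ) f)
    rw [← aeval_algebraMap_apply]; rfl
  have hinj : Function.Injective (algebraMap k[X] k⟮τ⟯) := by
    have := transcendental_iff_injective.1 hτ
    refine Function.Injective.of_comp (f := algebraMap k⟮τ⟯ F) ?_
    convert this using 1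
    ext f : 1
    exact (IsScalarTower.algebraMap_apply k[X] k⟮τ⟯ F f).symm
  have : FaithfulSMul k[X] k⟮τ⟯ := (faithfulSMul_iff_algebraMap_injective _ _).2 hinj
  have : IsFractionRing k[X] k⟮τ⟯ := by
    refine .of_field _ _ fun ⟨x, hx⟩ => ?_
    obtain ⟨r, s, h⟩ := (mem_adjoin_simple_iff k x).1 hx
    refine ⟨r, s, Subtype.ext ?_⟩
    change x = (algebraMap k⟮τ⟯ F (algebraMap k[X] k⟮τ⟯ r)) / (algebraMap k⟮τ⟯ F (algebraMap k[X] k⟮τ⟯ s))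
    rw [← IsScalarTower.algebraMap_apply, ← IsScalarTower.algebraMap_apply]
    exact h
  -- An integrally closed subring is the intersection of the valuation rings above it, and a
  -- valuation ring contains k[τ] as soon as it contains τ, since k is finite.
  have hBeq : B = (integralClosure k[X] F).toSubring := by
    ext x
    rw [hB]
    constructor
    · intro h
      by_contra hx
      have : IsIntegrallyClosedIn (integralClosure k[X] F).toSubring F :=
        inferInstanceAs (IsIntegrallyClosedIn (integralClosure k[X] F) F)
      obtain ⟨V, hV, hxV⟩ := Subring.exists_le_valuationSubring_of_isIntegrallyClosedIn hx
      refine hxV (h V (hV ?_))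
      have : IsIntegral k[X] (algebraMap k[X] F X) := isIntegral_algebraMap
      rwa [haeval, aeval_X] at this
    · intro h O hO
      have hO' : ∀ f : k[X], algebraMap k[X] F f ∈ O := fun f => by
        rw [haeval, aeval_eq_sum_range]
        refine sum_mem fun i _ => ?_
        rw [Algebra.smul_def]
        exact mul_mem (algebraMap_mem_valuationSubring O _) (pow_mem hO _)
      obtain ⟨f, hf, hfx⟩ := h
      let : Algebra k[X] O := ((algebraMap k[X] F).codRestrict O.toSubring hO').toAlgebra
      have : IsScalarTower k[X] O F := .of_algebraMap_eq fun _ => rfl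
      have hx : IsIntegral O x := IsIntegral.tower_top (R := k[X]) ⟨f, hf, hfx⟩
      obtain ⟨y, rfl⟩ := IsIntegrallyClosed.isIntegral_iff.1 hx
      exact y.2
  subst hBeq
  have h1 : IsDedekindDomain (integralClosure k[X] F) :=
    IsIntegralClosure.isDedekindDomain k[X] k⟮τ⟯ F _
  have h2 : IsFractionRing (integralClosure k[X] F) F :=
    IsIntegralClosure.isFractionRing_of_finite_extension k[X] k⟮τ⟯ F _
  have h3 : Fintype (ClassGroup (integralClosure k[X] F)) := by
    classical
    exact ClassGroup.fintypeOfAdmissibleOfFinite k⟮τ⟯ F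
      (Polynomial.cardPowDegreeIsAdmissible :
        AbsoluteValue.IsAdmissible (Polynomial.cardPowDegree : AbsoluteValue k[X] ℤ))
  have h4 : Ring.HasFiniteQuotients k[X] := ⟨fun {I} hI => by
    obtain ⟨g, rfl⟩ := IsPrincipalIdealRing.principal I
    have hg : g ≠ 0 := fun h => hI (by simp [h])
    have : Module.Finite k (AdjoinRoot g) := (AdjoinRoot.powerBasis hg).finite
    exact Module.finite_of_finite k (M := AdjoinRoot g)⟩
  have h5 : Module.Finite k[X] (integralClosure k[X] F) :=
    IsIntegralClosure.finite k[X] k⟮τ⟯ F _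
  have h6 : Ring.HasFiniteQuotients (integralClosure k[X] F) := .of_module_finite k[X] _
  exact ⟨h1, h2, (inferInstance : Finite (ClassGroup (integralClosure k[X] F))), h6⟩

end FieldTheory
end FFQSM
end

/-! ### Values of polynomials at valuations, and approximation modulo integral elements. -/

noncomputable section
namespace FFQSM

section RationalFunctions

open IntermediateField Polynomial

variable {k F : Type*} [Field k] [Field F] [Algebra k F]

theorem exists_pow_eq_one_of_isAlgebraic [Finite k] {x : F} (hx : IsAlgebraic k x) (h0 : x ≠ 0) :
    ∃ n, 0 < n ∧ x ^ n = 1 := by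
  have : FiniteDimensional k k⟮x⟯ := adjoin.finiteDimensional hx.isIntegral
  have : Finite k⟮x⟯ := Module.finite_of_finite k
  let y : k⟮x⟯ˣ := Units.mk0 (AdjoinSimple.gen k x) fun h => h0 (by
    simpa using congrArg (algebraMap k⟮x⟯ F) h)
  refine ⟨orderOf y, orderOf_pos y, ?_⟩
  have : ((y ^ orderOf y : k⟮x⟯ˣ) : k⟮x⟯) = 1 := by rw [pow_orderOf_eq_one, Units.val_one]
  exact congrArg (algebraMap k⟮x⟯ F) this

theorem mem_valuationSubring_of_pow_mem (O : ValuationSubring F) {x : F} {n : ℕ} (hn : n ≠ 0)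
    (h : x ^ n ∈ O) : x ∈ O := by
  rw [← O.valuation_le_one_iff] at h ⊢
  rw [map_pow] at h
  exact (pow_le_one_iff hn).1 h

theorem aeval_mem_valuationSubring [Finite k] (O : ValuationSubring F) {x : F} (hx : x ∈ O)
    (f : k[X]) : aeval x f ∈ O := by
  rw [aeval_eq_sum_range]
  refine sum_mem fun i _ => ?_
  rw [Algebra.smul_def]
  exact mul_mem (algebraMap_mem_valuationSubring O _) (pow_mem hx _)

theorem valuation_algebraMap_eq_one [Finite k] (O : ValuationSubring F) {c : k} (hc : c ≠ 0) :
    O.valuation (algebraMap k F c) = 1 := by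
  refine le_antisymm ((O.valuation_le_one_iff _).2 (algebraMap_mem_valuationSubring O c)) ?_
  have := (O.valuation_le_one_iff _).2 (algebraMap_mem_valuationSubring O c⁻¹)
  rw [map_inv₀, map_inv₀] at this
  exact (inv_le_one₀ (by simpa [zero_lt_iff] using hc)).1 this

theorem valuation_aeval_le [Finite k] (O : ValuationSubring F) {x : F} (hx : x ∉ O) (f : k[X])
    {n : ℕ} (hn : f.natDegree ≤ n) : O.valuation (aeval x f) ≤ O.valuation x ^ n := by
  rw [← O.valuation_le_one_iff, not_le] at hx
  rw [aeval_eq_sum_range]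
  refine O.valuation.map_sum_le fun i hi => ?_
  rw [Algebra.smul_def, map_mul, map_pow]
  refine (mul_le_mul' (b := 1) ?_ ?_).trans_eq (one_mul _)
  · exact (O.valuation_le_one_iff _).2 (algebraMap_mem_valuationSubring O _)
  · exact pow_le_pow_right₀ hx.le ((Nat.lt_succ_iff.1 (Finset.mem_range.1 hi)).trans hn)

theorem valuation_aeval_eq [Finite k] (O : ValuationSubring F) {x : F} (hx : x ∉ O) {f : k[X]}
    (hf : f ≠ 0) : O.valuation (aeval x f) = O.valuation x ^ f.natDegree := by
  have hx' := hx
  rw [← O.valuation_le_one_iff, not_le] at hx'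
  have hlead : O.valuation (aeval x (C f.leadingCoeff * X ^ f.natDegree)) =
      O.valuation x ^ f.natDegree := by
    rw [map_mul, aeval_C, map_pow, aeval_X, map_mul,
      valuation_algebraMap_eq_one O (leadingCoeff_ne_zero.2 hf), one_mul, map_pow]
  rcases Nat.eq_zero_or_pos f.natDegree with h0 | h0
  · rw [eq_C_of_natDegree_eq_zero h0] at hf ⊢
    simp only [aeval_C, natDegree_C, pow_zero]
    exact valuation_algebraMap_eq_one O (by simpa using hf)
  · have hlt : O.valuation (aeval x f.eraseLead) <
        O.valuation (aeval x (C f.leadingCoeff * X ^ f.natDegree)) := by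
      rw [hlead]
      refine (valuation_aeval_le O hx _ f.eraseLead_natDegree_le).trans_lt ?_
      exact pow_lt_pow_right₀ hx' (by omega)
    rw [← hlead, ← O.valuation.map_add_eq_of_lt_right hlt, ← map_add, eraseLead_add_C_mul_X_pow]

/-- If w(e) exceeded M ≥ 1, the leading power of e would strictly dominate every other term of the
equation, whose sum could not vanish. -/
theorem valuation_le_of_monic {Γ : Type*} [LinearOrderedCommGroupWithZero Γ] (w : Valuation F Γ)
    {R : Subring F} {e : F} {f : R[X]} (hf : f.Monic) (hfe : aeval e f = 0) {M : Γ} (hM : 1 ≤ M)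
    (hc : ∀ j, w (f.coeff j : F) ≤ M) : w e ≤ M := by
  by_contra! h
  have h1 : 1 < w e := hM.trans_lt h
  rw [aeval_eq_sum_range, Finset.sum_range_succ, hf.coeff_natDegree, one_smul] at hfe
  have h2 : w (∑ i ∈ Finset.range f.natDegree, f.coeff i • e ^ i) < w (e ^ f.natDegree) := by
    refine w.map_sum_lt ?_ fun i hi => ?_
    · exact (w.ne_zero_iff.2 (pow_ne_zero _ (w.ne_zero_iff.1 (zero_lt_one.trans h1).ne')))
    · rw [Subring.smul_def, smul_eq_mul, map_mul, map_pow, map_pow]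
      calc w (f.coeff i : F) * w e ^ i ≤ M * w e ^ i := mul_le_mul_left (hc i) _
        _ < w e * w e ^ i := by
          exact (mul_lt_mul_iff_left₀ (pow_pos (zero_lt_one.trans h1) i)).2 h
        _ = w e ^ (i + 1) := (pow_succ' _ _).symm
        _ ≤ w e ^ f.natDegree := pow_le_pow_right₀ h1.le (Finset.mem_range.1 hi)
  have h3 := w.map_add_eq_of_lt_right h2
  rw [hfe, map_zero, map_pow] at h3
  exact (pow_pos (zero_lt_one.trans h1) _).ne h3

theorem exists_isIntegral_aeval_mul {s : F} [FiniteDimensional k⟮s⟯ F] (e : F) :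
    ∃ g : k[X], aeval s g ≠ 0 ∧
      IsIntegral (Algebra.adjoin k {s}).toSubring (aeval s g * e) := by
  have halg : Algebra.IsAlgebraic (Algebra.adjoin k {s}) F := isAlgebraic_adjoin_iff_top.1 inferInstance
  obtain ⟨y, hy0, hy⟩ := (halg.isAlgebraic e).exists_integral_multiple
  obtain ⟨g, hg⟩ := (Algebra.adjoin_singleton_eq_range_aeval k s ▸ y.2 :
    (y : F) ∈ (aeval s : k[X] →ₐ[k] F).range)
  refine ⟨g, ?_, ?_⟩
  · change (aeval s) g = y at hg
    rw [hg]; exact fun h => hy0 (Subtype.ext h)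
  · change (aeval s) g = y at hg
    rw [hg]; exact hy

/-- Up to finitely many elements, every `k(s)`-multiple of `e` is the sum of an element which is
integral where `s` is, and of one which is integral where `s` is not. -/
theorem exists_finite_approx [Finite k] {s : F} [FiniteDimensional k⟮s⟯ F] (e : F) :
    ∃ T : Set F, T.Finite ∧ ∀ α ∈ k⟮s⟯, ∃ τ ∈ T, ∃ b : F, (∀ O : ValuationSubring F, s ∈ O → b ∈ O) ∧
      ∀ O : ValuationSubring F, s ∉ O → α * e - τ - b ∈ O := by
  obtain ⟨g, hg0, f, hfm, hf⟩ := exists_isIntegral_aeval_mul (k := k) (s := s) e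
  rw [← aeval_def] at hf
  have hcoeff : ∀ j, ∃ q : k[X], aeval s q = (f.coeff j : F) := fun j => by
    have : ∀ z ∈ Algebra.adjoin k {s}, ∃ q : k[X], aeval s q = z := fun z hz => by
      rwa [Algebra.adjoin_singleton_eq_range_aeval] at hz
    exact this _ (f.coeff j).2
  choose q hq using hcoeff
  have hg : g ≠ 0 := fun h => hg0 (by simp [h])
  -- With g(s)e integral over k[s], the degrees of the coefficients of its equation bound the poles
  -- of e above those of s: e is at most s^c there.
  set c := (Finset.range (f.natDegree + 1)).sup fun j => (q j).natDegree with hc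
  have hB : ∀ O : ValuationSubring F, s ∈ O → aeval s g * e ∈ O := fun O hO => by
    rw [← O.valuation_le_one_iff]
    refine valuation_le_of_monic O.valuation hfm hf le_rfl fun j => ?_
    rw [← hq, O.valuation_le_one_iff]
    exact aeval_mem_valuationSubring O hO _
  have hO' : ∀ O : ValuationSubring F, s ∉ O → O.valuation e ≤ O.valuation s ^ c := fun O hO => by
    have hs := hO
    rw [← O.valuation_le_one_iff, not_le] at hs
    have h1 : O.valuation (aeval s g * e) ≤ O.valuation s ^ c := by
      refine valuation_le_of_monic O.valuation hfm hf (one_le_pow₀ hs.le) fun j => ?_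
      by_cases hj : j ≤ f.natDegree
      · rw [← hq]
        exact valuation_aeval_le O hO _
          (Finset.le_sup (f := fun j => (q j).natDegree) (Finset.mem_range.2 (by omega)))
      · rw [coeff_eq_zero_of_natDegree_lt (by omega)]
        simp
    rw [map_mul, valuation_aeval_eq O hO hg] at h1
    exact (le_mul_of_one_le_left' (one_le_pow₀ hs.le)).trans h1
  set m := (g * X ^ c).natDegree with hm
  have hgX : g * X ^ c ≠ 0 := mul_ne_zero hg (pow_ne_zero _ X_ne_zero)
  -- The exceptional elements are s^(-c) U'(s) e with deg U' < deg (g X^c); over a finite field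
  -- there are finitely many such U'.
  refine ⟨(fun U : k[X] => (s ^ c)⁻¹ * aeval s U * e) '' (degreeLT k m : Set k[X]), ?_, ?_⟩
  · have : Finite (degreeLT k m) := Finite.of_equiv _ (degreeLTEquiv k m).toEquiv.symm
    exact (Set.toFinite _).image _
  · intro α hα
    rcases eq_or_ne s 0 with rfl | hs0
    · refine ⟨_, ⟨0, by simp, rfl⟩, 0, fun O _ => O.zero_mem, fun O h => absurd O.zero_mem h⟩
    obtain ⟨A, D, hAD⟩ := (mem_adjoin_simple_iff k α).1 hα
    -- Here α = 0 by the convention for division by zero.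
    by_cases hD : aeval s D = 0
    · refine ⟨_, ⟨0, by simp, rfl⟩, 0, fun O _ => O.zero_mem, fun O h => ?_⟩
      rw [hAD, hD]; simp
    have hD0 : D ≠ 0 := fun h => hD (by simp [h])
    -- Two divisions with remainder, X^c A = D U + r and U = g X^c Q + U', give αe = s^(-c) U' e +
    -- Q·(g e) + (r/D)·s^(-c) e. The second term is integral where s is. In the last one, both
    -- factors are integral at the poles of s.
    set U := (X ^ c * A) / D with hU
    set r := (X ^ c * A) % D with hr
    set Q := U / (g * X ^ c) with hQ
    set U' := U % (g * X ^ c) with hU'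
    have e1 : s ^ c * aeval s A = aeval s D * aeval s U + aeval s r := by
      have := congrArg (aeval s) (EuclideanDomain.div_add_mod (X ^ c * A) D)
      simp only [map_add, map_mul, map_pow, aeval_X] at this
      rw [← this, hU, hr]
    have e2 : aeval s U = aeval s g * s ^ c * aeval s Q + aeval s U' := by
      have := congrArg (aeval s) (EuclideanDomain.div_add_mod U (g * X ^ c))
      simp only [map_add, map_mul, map_pow, aeval_X] at this
      rw [← this, hQ, hU']
    refine ⟨_, ⟨U', ?_, rfl⟩, aeval s Q * (aeval s g * e), fun O hO => ?_, fun O hO => ?_⟩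
    · rw [SetLike.mem_coe, mem_degreeLT, hm, ← degree_eq_natDegree hgX]
      exact EuclideanDomain.mod_lt _ hgX
    · exact mul_mem (aeval_mem_valuationSubring O hO _) (hB O hO)
    · have hs := hO
      rw [← O.valuation_le_one_iff, not_le] at hs
      have key : α * e - (s ^ c)⁻¹ * aeval s U' * e - aeval s Q * (aeval s g * e) =
          (aeval s r / aeval s D) * ((s ^ c)⁻¹ * e) := by
        rw [hAD]
        have hsc : s ^ c ≠ 0 := pow_ne_zero _ hs0
        field_simp
        linear_combination e * e1 + e * aeval s D * e2
      rw [key, ← O.valuation_le_one_iff, map_mul, map_mul, map_div₀, map_inv₀, map_pow]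
      refine mul_le_one' ?_ ?_
      · rw [valuation_aeval_eq O hO hD0]
        refine div_le_one_of_le₀ ?_ zero_le
        refine valuation_aeval_le O hO _ ?_
        rcases eq_or_ne r 0 with h | h
        · simp [h]
        · exact natDegree_le_natDegree (EuclideanDomain.mod_lt _ hD0).le
      · rw [inv_mul_le_iff₀ (pow_pos (zero_lt_one.trans hs) c), mul_one]
        exact hO' O hO

end RationalFunctions
end FFQSM
end

/-! ### The place ∞ and the Dedekind property of A. -/

noncomputable section
namespace FFQSM
variable {K : Type*} [Field K]
-- Both rings contain the localization of B at the common center q, a discrete valuation ring. Any z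
-- of K is therefore in B_q or the inverse of an element of B_q; in the latter case z can lie in O'
-- only if that inverse is a unit of B_q.
theorem valuationSubring_le_of_same_center {B : Subring K} [IsDedekindDomain B] [IsFractionRing B K]
    {O O' : ValuationSubring K} (hO : B ≤ O.toSubring) (hO' : B ≤ O'.toSubring)
    (hne : ∃ x : B, x ≠ 0 ∧ O'.valuation x < 1)
    (h : ∀ x : B, O.valuation x < 1 ↔ O'.valuation x < 1) : O' ≤ O := by
  let q : Ideal B := (IsLocalRing.maximalIdeal O').comap (Subring.inclusion hO' : B →+* O'.toSubring)
  have hq : ∀ x : B, x ∈ q ↔ O'.valuation x < 1 := fun x => O'.valuation_lt_one_iff _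
  have : q.IsPrime := Ideal.comap_isPrime _ _
  have : IsDomain (Localization.AtPrime q) := inferInstance
  have hqbot : q ≠ ⊥ := by
    obtain ⟨x, hx0, hx⟩ := hne
    exact fun hbot => hx0 (by simpa [hbot] using (hq x).2 hx)
  have : IsDiscreteValuationRing (Localization.AtPrime q) :=
    IsLocalization.AtPrime.isDiscreteValuationRing_of_dedekind_domain B hqbot _
  have hunit : ∀ x : B, x ∉ q → O.valuation x = 1 ∧ O'.valuation x = 1 := fun x hx => by
    rw [hq] at hx
    have hx' := (h x).not.2 hx
    exact ⟨le_antisymm ((O.valuation_le_one_iff _).2 (hO x.2)) (not_lt.1 hx'),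
      le_antisymm ((O'.valuation_le_one_iff _).2 (hO' x.2)) (not_lt.1 hx)⟩
  have hdvd : ∀ a b : B, algebraMap B (Localization.AtPrime q) a ∣ algebraMap B _ b →
      ∃ (e : B) (w : B), w ∉ q ∧ b * w = a * e := fun a b hab => by
    obtain ⟨y, hy⟩ := hab
    obtain ⟨⟨e, w⟩, hew⟩ := IsLocalization.surj q.primeCompl y
    refine ⟨e, w, w.2, IsLocalization.injective (Localization.AtPrime q)
      q.primeCompl_le_nonZeroDivisors ?_⟩
    rw [map_mul, map_mul, hy, ← hew, mul_assoc]
  intro z hz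
  rw [← ValuationSubring.valuation_le_one_iff] at hz ⊢
  obtain ⟨c, d, hd, rfl⟩ := IsFractionRing.div_surjective (A := B) z
  have hd0 : (d : K) ≠ 0 := by simpa using nonZeroDivisors.ne_zero hd
  change O.valuation ((c : K) / (d : K)) ≤ 1
  change O'.valuation ((c : K) / (d : K)) ≤ 1 at hz
  rcases ValuationRing.dvd_total (algebraMap B (Localization.AtPrime q) c) (algebraMap B _ d) with h1 | h1
  · obtain ⟨e, w, hw, hew⟩ := hdvd c d h1
    have hew' : (d : K) * w = c * e := congrArg Subtype.val hew
    have hw0 : (w : K) ≠ 0 := fun h0 => hw (by rw [Subtype.ext h0 (a2 := (0 : B))]; exact q.zero_mem)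
    have hc0 : (c : K) * e ≠ 0 := hew' ▸ mul_ne_zero hd0 hw0
    have hcd : (c : K) / d = w / e := by
      rw [div_eq_div_iff hd0 (right_ne_zero_of_mul hc0), ← hew', mul_comm]
    rw [hcd, map_div₀] at hz ⊢
    rw [(hunit w hw).2] at hz
    rw [(hunit w hw).1]
    have : e ∉ q := fun he => by
      rw [hq] at he
      have hpos : 0 < O'.valuation (e : K) :=
        zero_lt_iff.2 ((Valuation.ne_zero_iff _).2 (right_ne_zero_of_mul hc0))
      exact absurd hz (not_le.2 (one_div (O'.valuation (e : K)) ▸ (one_lt_inv₀ hpos).2 he))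
    rw [(hunit e this).1, div_one]
  · obtain ⟨e, w, hw, hew⟩ := hdvd d c h1
    have hew' : (c : K) * w = d * e := congrArg Subtype.val hew
    have hw0 : (w : K) ≠ 0 := fun h0 => hw (by rw [Subtype.ext h0 (a2 := (0 : B))]; exact q.zero_mem)
    have hcd : (c : K) / d = e / w := by
      rw [div_eq_div_iff hd0 hw0, hew', mul_comm]
    rw [hcd, map_div₀, (hunit w hw).1, div_one]
    exact (O.valuation_le_one_iff _).2 (hO e.2)

namespace Place
variable (P : Place K)

theorem mem_ringA_iff {x : K} :
    x ∈ P.ringA ↔ ∀ O : ValuationSubring K, O ≠ P.v.valuationSubring → x ∈ O := by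
  simp only [ringA, Subring.mem_iInf]
  rfl

theorem abv_lt_one_iff {x : K} : P.abv x < 1 ↔ P.v x < 1 := by
  have h := (WithZeroMulInt.toNNReal_strictMono P.one_lt_residueCard).lt_iff_lt
    (a := P.v x) (b := 1)
  rw [map_one] at h
  rw [← h, ← NNReal.coe_lt_coe]
  rfl

theorem abv_le_one_iff {x : K} : P.abv x ≤ 1 ↔ P.v x ≤ 1 := by
  have h := (WithZeroMulInt.toNNReal_strictMono P.one_lt_residueCard).le_iff_le
    (a := P.v x) (b := 1)
  rw [map_one] at h
  rw [← h, ← NNReal.coe_le_coe]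
  rfl

theorem abv_eq_one_iff {x : K} : P.abv x = 1 ↔ P.v x = 1 := by
  rw [le_antisymm_iff, le_antisymm_iff, abv_le_one_iff, ← not_lt, ← not_lt, abv_lt_one_iff]
  simp

section FunctionField

open Polynomial IntermediateField

variable {Fq : Type*} [Field Fq] [Algebra Fq K]



theorem v_eq_one_of_isAlgebraic [Finite Fq] {x : K} (hx : IsAlgebraic Fq x) (h0 : x ≠ 0) : P.v x = 1 := by
  obtain ⟨n, hn, h⟩ := exists_pow_eq_one_of_isAlgebraic hx h0
  have : P.v x ^ n = 1 := by rw [← map_pow, h, map_one]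
  rcases lt_trichotomy (P.v x) 1 with h1 | h1 | h1
  · exact absurd this (pow_lt_one₀ zero_le h1 hn.ne').ne
  · exact h1
  · exact absurd this (one_lt_pow₀ h1 hn.ne').ne'

/-- A function regular at every place, ∞ included, is a constant: the integral closure of Fq is the
intersection of all valuation rings. -/
theorem isAlgebraic_of_mem_ringA {x : K} (hx : x ∈ P.ringA) (h : P.v x ≤ 1) :
    IsAlgebraic Fq x := by
  by_contra hx'
  have hx0 : x ∉ (integralClosure Fq K).toSubring := fun h => hx' (IsIntegral.isAlgebraic h)
  have : IsIntegrallyClosedIn (integralClosure Fq K).toSubring K :=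
    inferInstanceAs (IsIntegrallyClosedIn (integralClosure Fq K) K)
  obtain ⟨V, -, hxV⟩ := Subring.exists_le_valuationSubring_of_isIntegrallyClosedIn hx0
  refine hxV ((P.mem_ringA_iff.1 hx) V ?_)
  rintro rfl
  exact hxV h

variable (Fq) in
theorem isAlgebraic_of_mem_ringA_of_inv_mem {x : K} (hx : x ∈ P.ringA) (hx' : x⁻¹ ∈ P.ringA) :
    IsAlgebraic Fq x := by
  rcases le_total (P.v x) 1 with h1 | h1
  · exact P.isAlgebraic_of_mem_ringA hx h1
  · have : P.v x⁻¹ ≤ 1 := by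
      rw [map_inv₀]; exact inv_le_one_of_one_le₀ h1
    exact inv_inv x ▸ (P.isAlgebraic_of_mem_ringA (Fq := Fq) hx' this).inv

variable (Fq) in
theorem v_eq_one_of_mem_ringA_of_inv_mem [Finite Fq] {x : K} (hx : x ∈ P.ringA)
    (hx' : x⁻¹ ∈ P.ringA) (h0 : x ≠ 0) : P.v x = 1 :=
  P.v_eq_one_of_isAlgebraic (P.isAlgebraic_of_mem_ringA_of_inv_mem Fq hx hx') h0

variable (Fq) in
-- A unit of A is a constant, and so is x - 1, but a nonzero constant has valuation 1 at ∞. This is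
-- what makes positive generators of principal ideals unique.
theorem eq_one_of_mem_ringA_of_inv_mem [Finite Fq] {x : K} (hx : x ∈ P.ringA)
    (hx' : x⁻¹ ∈ P.ringA) (h : P.v (x - 1) < 1) : x = 1 := by
  have halg := P.isAlgebraic_of_mem_ringA_of_inv_mem Fq hx hx'
  by_contra hne
  have := P.v_eq_one_of_isAlgebraic (Fq := Fq) (halg.sub isAlgebraic_one) (sub_ne_zero.2 hne)
  exact h.ne this

variable [Finite Fq] (hK : IsCurveFunctionField Fq K)
include hK

theorem finiteDimensional_of_v_ne_one {s : K} (h0 : s ≠ 0) (h : P.v s ≠ 1) :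
    FiniteDimensional Fq⟮s⟯ K := by
  obtain ⟨-, t, -, ht⟩ := hK
  exact finiteDimensional_adjoin_of_transcendental
    (fun halg => h (P.v_eq_one_of_isAlgebraic halg h0)) ht

omit hK in
theorem exists_v_eq_exp (n : ℤ) : ∃ s : K, P.v s = WithZero.exp n := P.surjective _

/-- The residue field at `∞` is algebraic over `Fq`, so its nonzero elements are roots of unity. -/
theorem exists_v_pow_sub_one_lt {x : K} (hx : P.v x = 1) :
    ∃ n, 0 < n ∧ P.v (x ^ n - 1) < 1 := by
  -- Otherwise v would be trivial on Fq(x) with x transcendental, and hence bounded by 1 on K, which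
  -- is finite over Fq(x).
  obtain ⟨g, hg0, hg⟩ : ∃ g : Fq[X], g ≠ 0 ∧ P.v (aeval x g) < 1 := by
    by_contra! H
    have hle : ∀ g : Fq[X], P.v (aeval x g) ≤ 1 := fun g =>
      aeval_mem_valuationSubring P.v.valuationSubring (x := x) hx.le g
    have htr : Transcendental Fq x := by
      rintro ⟨g, hg, hg'⟩
      have := H g hg
      rw [hg', map_zero] at this
      exact absurd this (by simp)
    obtain ⟨-, t, -, ht⟩ := hK
    have := finiteDimensional_adjoin_of_transcendental htr ht
    obtain ⟨s, hs⟩ := P.exists_v_eq_exp 1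
    have hs1 : 1 < P.v s := by rw [hs, ← WithZero.exp_zero]; exact WithZero.exp_lt_exp.2 one_pos
    obtain ⟨f, hf, hfs⟩ := Algebra.IsIntegral.isIntegral (R := Fq⟮x⟯) s
    have hO : ∀ z ∈ Fq⟮x⟯, P.v z ≤ 1 := fun z hz => by
      obtain ⟨r, d, rfl⟩ := (mem_adjoin_simple_iff Fq z).1 hz
      rcases eq_or_ne d 0 with rfl | hd
      · simp
      rw [map_div₀, le_antisymm (hle d) (H d hd), div_one]
      exact hle r
    refine hs1.not_ge ?_
    have := valuation_le_of_monic P.v (R := Fq⟮x⟯.toSubalgebra.toSubring) (f := f) hf hfs le_rfl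
      fun j => hO _ (f.coeff j).2
    exact this
  -- In the finite ring Fq[X]/g two powers of the root coincide, so g divides some X^j - X^i;
  -- evaluating at x gives the claim.
  have : Finite (AdjoinRoot g) := by
    have : Module.Finite Fq (AdjoinRoot g) := (AdjoinRoot.powerBasis hg0).finite
    exact Module.finite_of_finite Fq
  obtain ⟨i, j, hij, h⟩ : ∃ i j : ℕ, i < j ∧ AdjoinRoot.root g ^ i = AdjoinRoot.root g ^ j := by
    obtain ⟨i, j, hne, h⟩ := Finite.exists_ne_map_eq_of_infinite fun n : ℕ => AdjoinRoot.root g ^ n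
    rcases hne.lt_or_gt with h' | h'
    exacts [⟨i, j, h', h⟩, ⟨j, i, h', h.symm⟩]
  have hdvd : g ∣ X ^ j - X ^ i := by
    rw [← AdjoinRoot.mk_eq_zero, map_sub, map_pow, map_pow, AdjoinRoot.mk_X, h, sub_self]
  obtain ⟨e, he⟩ := hdvd
  refine ⟨j - i, Nat.sub_pos_of_lt hij, ?_⟩
  have h1 : x ^ i * (x ^ (j - i) - 1) = aeval x g * aeval x e := by
    rw [← map_mul, ← he, mul_sub, ← pow_add, Nat.add_sub_cancel' hij.le]
    simp
  have h2 := congrArg P.v h1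
  rw [map_mul, map_pow, hx, one_pow, one_mul, map_mul] at h2
  rw [h2]
  exact (mul_le_mul_right (aeval_mem_valuationSubring P.v.valuationSubring (x := x) hx.le e) _).trans_lt
    (by rwa [mul_one])

omit hK in
-- The order of s at ∞ is prime to p. By the separability criterion, K is then separable over Fq(s).
theorem pow_ne_of_v_eq_exp_neg_one {p : ℕ} [Fact p.Prime] {s : K} (hs : P.v s = WithZero.exp (-1)) (x : K) :
    x ^ p ≠ s := by
  rintro rfl
  have h := congrArg WithZero.log hs
  rw [map_pow, WithZero.log_pow, WithZero.log_exp, nsmul_eq_mul] at h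
  have h1 := (Nat.Prime.one_lt Fact.out : 1 < p)
  have h2 : (p : ℤ) ∣ 1 := (Int.dvd_neg).1 (Dvd.intro _ h)
  have := Int.le_of_dvd one_pos h2
  omega

/-- There is an element of `K` whose only pole, among the places which are finite at `s`, is
`∞`. -/
theorem exists_pole_of_v_eq_exp_neg_one {s : K} (hs : P.v s = WithZero.exp (-1)) :
    ∃ x : K, 1 < P.v x ∧ ∀ O : ValuationSubring K, s ∈ O → O ≠ P.v.valuationSubring → x ∈ O := by
  obtain ⟨p, _⟩ := CharP.exists Fq
  have : Fact p.Prime := ⟨CharP.char_is_prime Fq p⟩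
  have hs0 : s ≠ 0 := by rintro rfl; rw [map_zero] at hs; exact WithZero.exp_ne_zero hs.symm
  have hs1 : P.v s < 1 := by
    rw [hs, ← WithZero.exp_zero]; exact WithZero.exp_lt_exp.2 (by norm_num)
  have := P.finiteDimensional_of_v_ne_one hK hs0 hs1.ne
  have := isSeparable_adjoin_of_forall_pow_ne (k := Fq) p (P.pow_ne_of_v_eq_exp_neg_one hs)
  have htr : Transcendental Fq s := fun h => hs1.ne (P.v_eq_one_of_isAlgebraic h hs0)
  let B : Subring K := ⨅ (O : ValuationSubring K) (_ : s ∈ O), O.toSubring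
  have hB : ∀ x, x ∈ B ↔ ∀ O : ValuationSubring K, s ∈ O → x ∈ O := fun x => by
    simp only [B, Subring.mem_iInf]; rfl
  obtain ⟨_, _, _, -⟩ := isDedekindDomain_of_forall_mem_iff htr B hB
  have hsB : s ∈ B := (hB s).2 fun O h => h
  have hsP : s ∈ P.v.valuationSubring := hs1.le
  have hBO : ∀ O : ValuationSubring K, s ∈ O → B ≤ O.toSubring := fun O hO x hx => (hB x).1 hx O hO
  let m : Ideal B := (IsLocalRing.maximalIdeal P.v.valuationSubring).comap
    (Subring.inclusion (hBO _ hsP) : B →+* P.v.valuationSubring.toSubring)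
  have hm : ∀ x : B, x ∈ m ↔ P.v x < 1 := fun x => by
    refine (P.v.valuationSubring.valuation_lt_one_iff _).trans ?_
    exact (P.v.isEquiv_valuation_valuationSubring.lt_one_iff_lt_one).symm
  have : m.IsPrime := Ideal.comap_isPrime _ _
  have hmbot : m ≠ ⊥ := fun h => hs0 (by
    have : (⟨s, hsB⟩ : B) ∈ m := (hm _).2 hs1
    rw [h] at this
    exact congrArg Subtype.val ((Submodule.mem_bot _).1 this))
  have hmax : m.IsMaximal := ‹m.IsPrime›.isMaximal hmbot
  -- The center m of ∞ on B has a principal power (b) because the class group is finite; the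
  -- function sought is 1/b, whose poles lie over m.
  obtain ⟨h, hh0, b, hb⟩ : ∃ h : ℕ, h ≠ 0 ∧ ∃ b : B, m ^ h = Ideal.span {b} := by
    have hm0 : m ∈ nonZeroDivisors (Ideal B) := mem_nonZeroDivisors_of_ne_zero hmbot
    let g := ClassGroup.mk0 ⟨m, hm0⟩
    have hg : g ^ Nat.card (ClassGroup B) = 1 := pow_card_eq_one'
    refine ⟨Nat.card (ClassGroup B), Nat.card_pos.ne', ?_⟩
    rw [← map_pow, ClassGroup.mk0_eq_one_iff] at hg
    obtain ⟨b, hb⟩ := hg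
    exact ⟨b, by simpa using hb⟩
  have hbm : b ∈ m := by
    have : b ∈ m ^ h := hb ▸ Ideal.mem_span_singleton_self b
    exact Ideal.pow_le_self hh0 this
  have hb0 : (b : K) ≠ 0 := fun h0 => by
    have : b = 0 := Subtype.ext h0
    rw [this] at hb
    exact hmbot (pow_eq_zero_iff hh0 |>.1 (by simpa using hb))
  refine ⟨(b : K)⁻¹, ?_, fun O hO hne => ?_⟩
  · rw [map_inv₀]
    exact (one_lt_inv₀ (zero_lt_iff.2 ((Valuation.ne_zero_iff _).2 hb0))).2 ((hm b).1 hbm)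
  · by_contra hbO
    have hbO' : O.valuation (b : K) < 1 := by
      rw [← ValuationSubring.valuation_le_one_iff, not_le, map_inv₀] at hbO
      exact (one_lt_inv₀ (zero_lt_iff.2 ((Valuation.ne_zero_iff _).2 hb0))).1 hbO
    let q : Ideal B := (IsLocalRing.maximalIdeal O).comap
      (Subring.inclusion (hBO O hO) : B →+* O.toSubring)
    have hq : ∀ x : B, x ∈ q ↔ O.valuation x < 1 := fun x => O.valuation_lt_one_iff _
    have : q.IsPrime := Ideal.comap_isPrime _ _
    -- The center q of O contains b, hence m^h, hence the maximal ideal m.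
    have hmq : m = q := by
      refine hmax.eq_of_le (Ideal.IsPrime.ne_top ‹_›) (Ideal.IsPrime.le_of_pow_le (n := h) ?_)
      rw [hb, Ideal.span_singleton_le_iff_mem]
      exact (hq b).2 hbO'
    have hval : ∀ x : B, P.v.valuationSubring.valuation x < 1 ↔ O.valuation x < 1 := fun x => by
      rw [← hq, ← hmq, hm]
      exact (P.v.isEquiv_valuation_valuationSubring.lt_one_iff_lt_one).symm
    have hb0' : b ≠ 0 := fun h => hb0 (by simp [h])
    refine hne (le_antisymm ?_ ?_)
    · exact valuationSubring_le_of_same_center (hBO _ hsP) (hBO _ hO) ⟨b, hb0', hbO'⟩ hval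
    · exact valuationSubring_le_of_same_center (hBO _ hO) (hBO _ hsP)
        ⟨b, hb0', (hval b).2 hbO'⟩ fun x => (hval x).symm

/-- There is a nonconstant function with no pole outside `∞`. -/
theorem exists_mem_ringA_one_lt : ∃ t ∈ P.ringA, 1 < P.v t := by
  obtain ⟨s, hs⟩ := P.exists_v_eq_exp (-1)
  have hs0 : s ≠ 0 := by rintro rfl; rw [map_zero] at hs; exact WithZero.exp_ne_zero hs.symm
  have hs1 : P.v s < 1 := by
    rw [hs, ← WithZero.exp_zero]; exact WithZero.exp_lt_exp.2 (by norm_num)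
  obtain ⟨x, hx1, hx⟩ := P.exists_pole_of_v_eq_exp_neg_one hK hs
  have hfd := P.finiteDimensional_of_v_ne_one hK hs0 hs1.ne
  let e := Module.finBasis Fq⟮s⟯ K
  choose T hTfin hT using fun i => exists_finite_approx (k := Fq) (s := s) (e i)
  have hsum : ∀ z : K, ∃ τ ∈ Set.univ.pi T, ∃ b : K, (∀ O : ValuationSubring K, s ∈ O → b ∈ O) ∧
      ∀ O : ValuationSubring K, s ∉ O → z - ∑ i, τ i - b ∈ O := fun z => by
    choose τ hτ b hb hb' using fun i => hT i (e.repr z i) (e.repr z i).2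
    refine ⟨τ, fun i _ => hτ i, ∑ i, b i, fun O hO => sum_mem fun i _ => hb i O hO, fun O hO => ?_⟩
    have : z - ∑ i, τ i - ∑ i, b i = ∑ i, ((e.repr z i : K) * e i - τ i - b i) := by
      rw [Finset.sum_sub_distrib, Finset.sum_sub_distrib]
      congr 2
      exact (e.sum_repr z).symm
    rw [this]
    exact sum_mem fun i _ => hb' i O hO
  -- The powers of x may have poles where s has poles. Modulo elements integral where s is, this
  -- polar part takes only finitely many values, so it agrees for two exponents i < j.
  choose τ hτ b hb hb' using fun n : ℕ => hsum (x ^ n)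
  have : Finite (Set.univ.pi T) := (Set.Finite.pi' hTfin).subset fun f hf i => hf i trivial
  obtain ⟨i, j, hij, h⟩ : ∃ i j : ℕ, i < j ∧ τ i = τ j := by
    obtain ⟨i, j, hne, h⟩ := Finite.exists_ne_map_eq_of_infinite
      fun n : ℕ => (⟨τ n, hτ n⟩ : Set.univ.pi T)
    have h := congrArg Subtype.val h
    rcases hne.lt_or_gt with h' | h'
    exacts [⟨i, j, h', h⟩, ⟨j, i, h', h.symm⟩]
  -- The common τ cancels at the poles of s; where s is finite only ∞ can be a pole, and there x^j
  -- dominates.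
  refine ⟨x ^ j - (x ^ i + (b j - b i)), P.mem_ringA_iff.2 fun O hO => ?_, ?_⟩
  · by_cases hsO : s ∈ O
    · exact sub_mem (pow_mem (hx O hsO hO) _) (add_mem (pow_mem (hx O hsO hO) _)
        (sub_mem (hb _ O hsO) (hb _ O hsO)))
    · have := sub_mem (hb' j O hsO) (hb' i O hsO)
      rw [h] at this
      convert this using 1
      ring
  · have hlt : P.v (x ^ i + (b j - b i)) < P.v (x ^ j) := by
      refine (P.v.map_add _ _).trans_lt (max_lt ?_ ?_)
      · rw [map_pow, map_pow]; exact pow_lt_pow_right₀ hx1 hij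
      · have : P.v (b j - b i) ≤ 1 :=
          sub_mem (S := ValuationSubring K) (hb j P.v.valuationSubring hs1.le) (hb i _ hs1.le)
        refine this.trans_lt ?_
        rw [map_pow]
        exact one_lt_pow₀ hx1 (by omega)
    rw [P.v.map_sub_eq_of_lt_left hlt, map_pow]
    exact one_lt_pow₀ hx1 (by omega)

/-- Choose t in A with the least positive pole order at ∞. A p-th root of t would again be in A with
a smaller pole order, so K is separable over Fq(t). The valuation rings containing t are exactly
those other than that of ∞, so A is the integral closure of Fq[t]. -/
theorem ringA_isDedekindDomain : IsDedekindDomain P.ringA ∧ IsFractionRing P.ringA K ∧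
    Finite (ClassGroup P.ringA) ∧ Ring.HasFiniteQuotients P.ringA := by
  obtain ⟨p, _⟩ := CharP.exists Fq
  have : Fact p.Prime := ⟨CharP.char_is_prime Fq p⟩
  have hex : ∃ n : ℕ, 0 < n ∧ ∃ t ∈ P.ringA, P.v t = WithZero.exp (n : ℤ) := by
    obtain ⟨t, ht, h1⟩ := P.exists_mem_ringA_one_lt hK
    have h0 : P.v t ≠ 0 := (zero_lt_one.trans h1).ne'
    have hl : 0 < WithZero.log (P.v t) := by
      rwa [← WithZero.exp_lt_exp, WithZero.exp_log h0, WithZero.exp_zero]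
    refine ⟨(WithZero.log (P.v t)).toNat, by omega, t, ht, ?_⟩
    rw [Int.toNat_of_nonneg hl.le, WithZero.exp_log h0]
  classical
  obtain ⟨hn, t, ht, htn⟩ := Nat.find_spec hex
  set n := Nat.find hex with hndef
  have ht1 : 1 < P.v t := by
    rw [htn, ← WithZero.exp_zero]; exact WithZero.exp_lt_exp.2 (by exact_mod_cast hn)
  have ht0 : t ≠ 0 := by rintro rfl; simp at ht1
  have hpow : ∀ x : K, x ^ p ≠ t := by
    rintro x rfl
    have hp := (Fact.out : p.Prime)
    have hxA : x ∈ P.ringA := P.mem_ringA_iff.2 fun O hO =>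
      mem_valuationSubring_of_pow_mem O hp.ne_zero (P.mem_ringA_iff.1 ht O hO)
    have hx0 : P.v x ≠ 0 := (Valuation.ne_zero_iff _).2 fun h => ht0 (by rw [h, zero_pow hp.ne_zero])
    have hlog : (p : ℤ) * WithZero.log (P.v x) = n := by
      have := congrArg WithZero.log htn
      rw [map_pow, WithZero.log_pow, WithZero.log_exp] at this
      simpa using this
    have h2 : (2 : ℤ) ≤ p := by exact_mod_cast hp.two_le
    have hpos : 0 < WithZero.log (P.v x) := by
      by_contra! hneg
      have : (p : ℤ) * WithZero.log (P.v x) ≤ 0 := mul_nonpos_of_nonneg_of_nonpos (by omega) hneg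
      omega
    refine Nat.find_min hex (m := (WithZero.log (P.v x)).toNat) ?_ ⟨by omega, x, hxA, ?_⟩
    · rw [← hndef]
      zify
      rw [Int.toNat_of_nonneg hpos.le, ← hlog]
      nlinarith
    · rw [Int.toNat_of_nonneg hpos.le, WithZero.exp_log hx0]
  have := P.finiteDimensional_of_v_ne_one hK ht0 ht1.ne'
  have := isSeparable_adjoin_of_forall_pow_ne (k := Fq) p hpow
  have htr : Transcendental Fq t := fun h => ht1.ne' (P.v_eq_one_of_isAlgebraic h ht0)
  refine isDedekindDomain_of_forall_mem_iff htr P.ringA fun x => ?_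
  constructor
  · intro hx O hO
    refine P.mem_ringA_iff.1 hx O ?_
    rintro rfl
    exact absurd hO (not_le.2 ht1)
  · intro h
    exact P.mem_ringA_iff.2 fun O hO => h O (P.mem_ringA_iff.1 ht O hO)

end FunctionField
end Place
end FFQSM
end

/-! ### Roots and p-adic powers of 1-units. -/

noncomputable section
namespace FFQSM

/-- The quotient x is a 1-unit with x^n = 1. The p-part of n is removed by injectivity of Frobenius.
For the part m prime to p, a power Q > 1 of p is 1 modulo m, so (x - 1)^Q = x - 1 with |x - 1| < 1,
which forces x = 1. -/
theorem eq_of_pow_eq_pow_of_norm_sub_one_lt {L : Type*} [NormedField L] [IsUltrametricDist L]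
    (p : ℕ) [Fact p.Prime] [CharP L p] {w w' : L} (hw : ‖w - 1‖ < 1) (hw' : ‖w' - 1‖ < 1) {n : ℕ}
    (hn : 0 < n) (h : w ^ n = w' ^ n) : w = w' := by
  have : ExpChar L p := .prime Fact.out
  have hw0 : w' ≠ 0 := by rintro rfl; simp at hw'
  have hw1 : ‖w'‖ = 1 := by
    have := IsUltrametricDist.norm_add_eq_max_of_norm_ne_norm (x := w' - 1) (y := 1)
      (by rw [norm_one]; exact hw'.ne)
    rw [sub_add_cancel, norm_one] at this
    rw [this, max_eq_right hw'.le]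
  set x := w / w' with hx
  have hxn : x ^ n = 1 := by rw [hx, div_pow, h, div_self (pow_ne_zero _ hw0)]
  have hx1 : ‖x - 1‖ < 1 := by
    have : x - 1 = ((w - 1) - (w' - 1)) / w' := by
      rw [hx, eq_div_iff hw0, sub_mul, div_mul_cancel₀ _ hw0]; ring
    rw [this, norm_div, hw1, div_one, sub_eq_add_neg]
    exact (IsUltrametricDist.norm_add_le_max _ _).trans_lt (max_lt hw (by rwa [norm_neg]))
  obtain ⟨e, m, hm, rfl⟩ := Nat.exists_eq_pow_mul_and_not_dvd hn.ne' p (Nat.Prime.ne_one Fact.out)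
  have hxm : x ^ m = 1 := by
    have : (x ^ m - 1) ^ p ^ e = 0 := by
      rw [sub_pow_expChar_pow, one_pow, ← pow_mul, mul_comm, hxn, sub_self]
    exact sub_eq_zero.1 (pow_eq_zero_iff (pow_ne_zero _ (Nat.Prime.ne_zero Fact.out)) |>.1 this)
  have hcop : Nat.Coprime p m := (Nat.Prime.coprime_iff_not_dvd Fact.out).2 hm
  have hm0 : 0 < m := Nat.pos_of_ne_zero fun h0 => by simp [h0] at hn
  have hmod := Nat.ModEq.pow_totient hcop
  have hxp : x ^ p ^ m.totient = x := by
    obtain ⟨c, hc⟩ := (Nat.modEq_iff_dvd' (Nat.one_le_pow _ _ (Nat.Prime.pos Fact.out))).1 hmod.symm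
    have : p ^ m.totient = m * c + 1 := by
      have := Nat.one_le_pow m.totient p (Nat.Prime.pos Fact.out)
      omega
    rw [this, pow_succ, pow_mul, hxm, one_pow, one_mul]
  have hfix : (x - 1) ^ p ^ m.totient = x - 1 := by rw [sub_pow_expChar_pow, one_pow, hxp]
  have hx0 : x = 1 := by
    by_contra hne
    have h0 : 0 < ‖x - 1‖ := norm_pos_iff.2 (sub_ne_zero.2 hne)
    have h1 : ‖x - 1‖ ^ p ^ m.totient = ‖x - 1‖ := by rw [← norm_pow, hfix]
    have h2 : 1 < p ^ m.totient :=
      Nat.one_lt_pow (Nat.totient_pos.2 hm0).ne' (Nat.Prime.one_lt Fact.out)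
    have h3 := pow_lt_pow_right_of_lt_one₀ h0 hx1 h2
    rw [h1, pow_one] at h3
    exact lt_irrefl _ h3
  rwa [hx, div_eq_one_iff_eq hw0] at hx0

theorem norm_eq_one_of_norm_sub_one_lt {L : Type*} [NormedField L] [IsUltrametricDist L]
    {w : L} (hw : ‖w - 1‖ < 1) : ‖w‖ = 1 := by
  have := IsUltrametricDist.norm_add_eq_max_of_norm_ne_norm (x := w - 1) (y := 1)
    (by rw [norm_one]; exact hw.ne)
  rw [sub_add_cancel, norm_one] at this
  rw [this, max_eq_right hw.le]

theorem norm_mul_sub_one_lt {L : Type*} [NormedField L] [IsUltrametricDist L]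
    {w w' : L} (hw : ‖w - 1‖ < 1) (hw' : ‖w' - 1‖ < 1) : ‖w * w' - 1‖ < 1 := by
  have : w * w' - 1 = w * (w' - 1) + (w - 1) := by ring
  rw [this]
  refine (IsUltrametricDist.norm_add_le_max _ _).trans_lt (max_lt ?_ hw)
  rw [norm_mul, norm_eq_one_of_norm_sub_one_lt hw, one_mul]
  exact hw'

theorem norm_pow_sub_one_lt {L : Type*} [NormedField L] [IsUltrametricDist L]
    {w : L} (hw : ‖w - 1‖ < 1) (n : ℕ) : ‖w ^ n - 1‖ < 1 := by
  induction n with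
  | zero => simp
  | succ n ih => rw [pow_succ]; exact norm_mul_sub_one_lt ih hw

variable {K : Type*} [Field K]
namespace Place
variable (P : Place K)

/-- The embedding of `K` in `K_∞`, as a ring homomorphism. -/
def toKinfHom : K →+* P.Kinf :=
  UniformSpace.Completion.coeRingHom.comp (WithAbs.equiv P.abv).symm.toRingHom

theorem toKinfHom_apply (x : K) : P.toKinfHom x = P.toKinf x := rfl

/-- The embedding of `K_∞` in `C_∞`, as a ring homomorphism. -/
def toCinfHom : P.Kinf →+* P.Cinf :=
  (UniformSpace.Completion.coeRingHom (α := P.KinfAlgCl)).comp (algebraMap P.Kinf P.KinfAlgCl)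

theorem toCinfHom_apply (x : P.Kinf) : P.toCinfHom x = P.toCinf x := rfl

instance : IsUltrametricDist P.KinfAlgCl :=
  IsUltrametricDist.isUltrametricDist_of_forall_norm_add_le_max_norm
    isNonarchimedean_spectralNorm

instance : IsUltrametricDist P.Cinf := by
  refine IsUltrametricDist.isUltrametricDist_of_forall_norm_add_le_max_norm fun x y => ?_
  induction x, y using UniformSpace.Completion.induction_on₂ (α := P.KinfAlgCl) (β := P.KinfAlgCl) with
  | hp => 
    refine isClosed_le ?_ ?_
    · exact (continuous_norm (E := P.Cinf)).comp continuous_add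
    · exact ((continuous_norm (E := P.Cinf)).comp continuous_fst).max
        ((continuous_norm (E := P.Cinf)).comp continuous_snd)
  | ih a b =>
    have := IsUltrametricDist.norm_add_le_max a b
    rw [← UniformSpace.Completion.norm_coe, ← UniformSpace.Completion.norm_coe a,
      ← UniformSpace.Completion.norm_coe b, UniformSpace.Completion.coe_add] at this
    exact this

/-- Evaluating T^h - γ at 1 gives 1 - γ = ∏ (1 - z) over the roots z. As this has norm less than 1,
some root is a 1-unit. -/
theorem exists_pow_eq_toCinf {γ : P.Kinf} (hγ : ‖γ - 1‖ < 1) {h : ℕ} (hh : 0 < h) :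
    ∃ w : P.Cinf, ‖w - 1‖ < 1 ∧ w ^ h = P.toCinf γ := by
  let γ' := algebraMap P.Kinf P.KinfAlgCl γ
  have hγ' : ‖γ' - 1‖ < 1 := by
    have : ‖γ' - 1‖ = ‖γ - 1‖ := by
      rw [← norm_algebraMap' P.KinfAlgCl (γ - 1), map_sub, map_one]
    rwa [this]
  have hsplit := IsAlgClosed.splits (Polynomial.X ^ h - Polynomial.C γ')
  have hmon : (Polynomial.X ^ h - Polynomial.C γ').Monic := Polynomial.monic_X_pow_sub_C _ hh.ne'
  obtain ⟨z, hz, hz1⟩ : ∃ z ∈ (Polynomial.X ^ h - Polynomial.C γ').roots, ‖z - 1‖ < 1 := by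
    by_contra! H
    have h1 := hsplit.eval_eq_prod_roots_of_monic hmon 1
    have h2 : 1 ≤ ‖((Polynomial.X ^ h - Polynomial.C γ').roots.map (fun a => 1 - a)).prod‖ := by
      have : ∀ s : Multiset P.KinfAlgCl, (∀ z ∈ s, 1 ≤ ‖z - 1‖) →
          1 ≤ ‖(s.map fun a => 1 - a).prod‖ := fun s => by
        induction s using Multiset.induction_on with
        | empty => intro _; simp
        | cons a s ih =>
          intro hs
          rw [Multiset.map_cons, Multiset.prod_cons, norm_mul, norm_sub_rev]
          exact one_le_mul_of_one_le_of_one_le (hs a (Multiset.mem_cons_self a s))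
            (ih fun z hz => hs z (Multiset.mem_cons_of_mem hz))
      exact this _ H
    rw [← h1] at h2
    simp only [Polynomial.eval_sub, Polynomial.eval_pow, Polynomial.eval_X, one_pow,
      Polynomial.eval_C] at h2
    rw [norm_sub_rev] at h2
    exact absurd hγ' (not_lt.2 h2)
  rw [Polynomial.mem_roots hmon.ne_zero, Polynomial.IsRoot.def] at hz
  simp only [Polynomial.eval_sub, Polynomial.eval_pow, Polynomial.eval_X,
      Polynomial.eval_C, sub_eq_zero] at hz
  let ι : P.KinfAlgCl →+* P.Cinf := UniformSpace.Completion.coeRingHom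
  refine ⟨ι z, ?_, ?_⟩
  · rw [← map_one ι, ← map_sub]
    exact (UniformSpace.Completion.norm_coe (z - 1)).trans_lt hz1
  · rw [← map_pow, hz]; rfl

theorem charP_Cinf (p : ℕ) [CharP K p] : CharP P.Cinf p :=
  charP_of_injective_ringHom (f := P.toCinfHom.comp P.toKinfHom) (RingHom.injective _) p

theorem norm_natCast_le_one (n : ℕ) : ‖(n : P.Cinf)‖ ≤ 1 := by
  exact IsUltrametricDist.norm_natCast_le_one P.Cinf n

section UnitPow

variable {p : ℕ} [Fact p.Prime] {w w' : P.Cinf}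

theorem norm_unitPow_term_le (y : ℤ_[p]) (j : ℕ) :
    ‖((PadicInt.toZMod (Ring.choose y j)).val : P.Cinf) * (w - 1) ^ j‖ ≤ ‖w - 1‖ ^ j := by
  rw [norm_mul, norm_pow]
  exact mul_le_of_le_one_left (by positivity) (P.norm_natCast_le_one _)

/-- The series converges uniformly in y, being dominated by a geometric series, and its coefficients
are continuous since reduction modulo p is locally constant. -/
theorem continuous_unitPow (hw : ‖w - 1‖ < 1) : Continuous fun y : ℤ_[p] => P.unitPow w y := by
  refine continuous_tsum (fun j => ?_) (summable_geometric_of_lt_one (norm_nonneg _) hw)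
    fun j y => P.norm_unitPow_term_le y j
  refine Continuous.mul ?_ continuous_const
  have h1 : IsLocallyConstant fun y : ℤ_[p] => PadicInt.toZMod y := by
    refine (IsLocallyConstant.iff_exists_open _).2 fun y => ⟨Metric.ball y 1, Metric.isOpen_ball,
      Metric.mem_ball_self one_pos, fun z hz => ?_⟩
    rw [← sub_eq_zero, ← map_sub, ← RingHom.mem_ker, PadicInt.ker_toZMod,
      IsLocalRing.mem_maximalIdeal, PadicInt.mem_nonunits]
    rwa [Metric.mem_ball, dist_eq_norm] at hz
  exact ((h1.comp fun z => ((z.val : ℕ) : P.Cinf)).continuous).comp (PadicInt.continuous_choose j)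

theorem unitPow_natCast [CharP K p] (w : P.Cinf) (n : ℕ) : P.unitPow w (n : ℤ_[p]) = w ^ n := by
  have := P.charP_Cinf p
  have h : ∀ j, ((PadicInt.toZMod (Ring.choose (n : ℤ_[p]) j)).val : P.Cinf) * (w - 1) ^ j =
      (n.choose j : P.Cinf) * (w - 1) ^ j := fun j => by
    rw [Ring.choose_natCast, map_natCast, ZMod.val_natCast, ← CharP.cast_eq_mod P.Cinf p]
  have e : w ^ n = ∑ j ∈ Finset.range (n + 1), (n.choose j : P.Cinf) * (w - 1) ^ j := by
    conv_lhs => rw [← sub_add_cancel w 1, add_pow]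
    exact Finset.sum_congr rfl fun j _ => by rw [one_pow, mul_one, mul_comm]
  rw [unitPow, e]
  simp_rw [h]
  refine tsum_eq_sum fun j hj => ?_
  rw [Nat.choose_eq_zero_of_lt (by simpa [Nat.lt_succ_iff] using hj)]
  simp

/-- Natural numbers are dense in ℤ_p, so the laws of exponents for `unitPow` reduce to those of
ordinary powers. -/
theorem unitPow_eq_of_forall_nat {f g : ℤ_[p] → P.Cinf} (hf : Continuous f) (hg : Continuous g)
    (h : ∀ n : ℕ, f n = g n) (y : ℤ_[p]) : f y = g y :=
  congrFun (PadicInt.denseRange_natCast.equalizer hf hg (funext h)) y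

variable [CharP K p]

theorem unitPow_mul (hw : ‖w - 1‖ < 1) (hw' : ‖w' - 1‖ < 1) (y : ℤ_[p]) :
    P.unitPow (w * w') y = P.unitPow w y * P.unitPow w' y :=
  P.unitPow_eq_of_forall_nat (P.continuous_unitPow (norm_mul_sub_one_lt hw hw'))
    ((P.continuous_unitPow hw).mul (P.continuous_unitPow hw'))
    (fun n => by simp only [unitPow_natCast, mul_pow, Pi.mul_apply]) y

theorem unitPow_add (hw : ‖w - 1‖ < 1) (y y' : ℤ_[p]) :
    P.unitPow w (y + y') = P.unitPow w y * P.unitPow w y' := by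
  refine P.unitPow_eq_of_forall_nat (f := fun y => P.unitPow w (y + y'))
    (g := fun y => P.unitPow w y * P.unitPow w y')
    ((P.continuous_unitPow hw).comp (continuous_add_const y'))
    ((P.continuous_unitPow hw).mul continuous_const) (fun n => ?_) y
  refine P.unitPow_eq_of_forall_nat (f := fun y' => P.unitPow w ((n : ℤ_[p]) + y'))
    (g := fun y' => P.unitPow w (n : ℤ_[p]) * P.unitPow w y')
    ((P.continuous_unitPow hw).comp (continuous_const_add _))
    (continuous_const.mul (P.continuous_unitPow hw)) (fun m => ?_) y'
  rw [← Nat.cast_add]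
  simp only [unitPow_natCast, pow_add]

theorem norm_unitPow (hw : ‖w - 1‖ < 1) (y : ℤ_[p]) : ‖P.unitPow w y‖ = 1 :=
  congrFun (PadicInt.denseRange_natCast.equalizer (P.continuous_unitPow hw).norm
    (continuous_const (y := (1 : ℝ))) (funext fun n => by
      simp only [Function.comp, unitPow_natCast, norm_pow, norm_eq_one_of_norm_sub_one_lt hw,
        one_pow])) y

theorem unitPow_ne_zero (hw : ‖w - 1‖ < 1) (y : ℤ_[p]) : P.unitPow w y ≠ 0 :=
  norm_ne_zero_iff.1 (by rw [P.norm_unitPow hw]; exact one_ne_zero)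

theorem unitPow_zero (w : P.Cinf) : P.unitPow w (0 : ℤ_[p]) = 1 := by
  simpa using P.unitPow_natCast (p := p) w 0

end UnitPow
end Place
end FFQSM
end

/-! ### The 1-unit of a fractional ideal. -/

noncomputable section
namespace FFQSM
variable {K : Type*} [Field K]
namespace Place
variable (P : Place K)

theorem exists_pow_eq_span [IsDedekindDomain P.ringA] [IsFractionRing P.ringA K]
    [Finite (ClassGroup P.ringA)] {I : Submodule P.ringA K} (hfg : I.FG) (hI : I ≠ ⊥) :
    ∃ (h : ℕ) (a : K), 0 < h ∧ I ^ h = Submodule.span P.ringA {a} := by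
  let J : FractionalIdeal (nonZeroDivisors P.ringA) K :=
    ⟨I, FractionalIdeal.isFractional_of_fg hfg⟩
  have hJ : J ≠ 0 := fun h => hI (by
    have h1 := congrArg (fun J : FractionalIdeal _ K => (J : Submodule P.ringA K)) h
    simpa only [FractionalIdeal.coe_mk, FractionalIdeal.coe_zero, J] using h1)
  let U := Units.mk0 J hJ
  have hU : ClassGroup.mk (K := K) U ^ Nat.card (ClassGroup P.ringA) = 1 := pow_card_eq_one'
  rw [← map_pow, ClassGroup.mk_eq_one_iff] at hU
  obtain ⟨a, ha⟩ := hU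
  refine ⟨Nat.card (ClassGroup P.ringA), a, Nat.card_pos, ?_⟩
  rw [← ha]
  simp only [U, J, Units.val_pow_eq_pow_val, FractionalIdeal.coe_pow]
  rfl

theorem norm_uniformizer_pos {u : P.Kinf} (hu : P.IsUniformizer u) : 0 < ‖u‖ := by
  obtain ⟨x, hx⟩ := P.exists_one_lt_abv
  have hx0 : x ≠ 0 := by rintro rfl; simp at hx; linarith
  have h1 : ‖P.toKinf x⁻¹‖ = (P.abv x)⁻¹ := by rw [norm_toKinf, map_inv₀]
  refine lt_of_lt_of_le ?_ (hu.2 (P.toKinf x⁻¹) (by rw [h1]; exact inv_lt_one_of_one_lt₀ hx))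
  rw [h1]
  positivity

theorem exists_zpow_mul {u : P.Kinf} (hu : P.IsUniformizer u) {x : P.Kinf} (hx : x ≠ 0) :
    ∃ (m : ℤ) (y : P.Kinf), ‖y‖ = 1 ∧ x = u ^ m * y := by
  have hu0 := P.norm_uniformizer_pos hu
  have hune : u ≠ 0 := norm_pos_iff.1 hu0
  -- This m has ‖u‖^(-m) < ‖x‖ ≤ ‖u‖^(-(m+1)), so the quotient by u^(-(m+1)) has norm in (‖u‖, 1];
  -- maximality of ‖u‖ among norms below 1 leaves only 1.
  obtain ⟨m, hm1, hm2⟩ := exists_mem_Ioc_zpow (norm_pos_iff.2 hx) (one_lt_inv₀ hu0 |>.2 hu.1)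
  refine ⟨-(m + 1), x / u ^ (-(m + 1)), ?_, (mul_div_cancel₀ _ (zpow_ne_zero _ hune)).symm⟩
  have e : ‖x / u ^ (-(m + 1))‖ = ‖x‖ * ‖u‖ ^ (m + 1) := by
    rw [norm_div, norm_zpow, zpow_neg, div_inv_eq_mul]
  have hle : ‖x / u ^ (-(m + 1))‖ ≤ 1 := by
    rw [e]
    rw [inv_zpow] at hm2
    calc ‖x‖ * ‖u‖ ^ (m + 1) ≤ (‖u‖ ^ (m + 1))⁻¹ * ‖u‖ ^ (m + 1) := by gcongr
      _ = 1 := inv_mul_cancel₀ (zpow_ne_zero _ hu0.ne')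
  refine le_antisymm hle (not_lt.1 fun hlt => ?_)
  have h1 := hu.2 _ hlt
  rw [e] at h1
  rw [inv_zpow] at hm1
  have h2 : ‖u‖ < ‖x‖ * ‖u‖ ^ (m + 1) := by
    calc ‖u‖ = (‖u‖ ^ m)⁻¹ * ‖u‖ ^ (m + 1) := by
          rw [zpow_add_one₀ hu0.ne', inv_mul_cancel_left₀ (zpow_ne_zero _ hu0.ne')]
      _ < ‖x‖ * ‖u‖ ^ (m + 1) := by gcongr
  linarith

theorem toKinf_ne_zero {a : K} (ha : a ≠ 0) : P.toKinf a ≠ 0 := by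
  rw [← toKinfHom_apply]; exact (map_ne_zero _).2 ha

variable {P}

theorem IsPositiveWith.ne_zero {u x γ : P.Kinf} (hu : P.IsUniformizer u)
    (h : P.IsPositiveWith u x γ) : x ≠ 0 := by
  obtain ⟨h1, m, rfl⟩ := h
  refine mul_ne_zero (zpow_ne_zero _ (norm_pos_iff.1 (P.norm_uniformizer_pos hu))) ?_
  rintro rfl
  simp at h1

theorem IsPositiveWith.mul {u x x' γ γ' : P.Kinf} (hu : P.IsUniformizer u)
    (h : P.IsPositiveWith u x γ) (h' : P.IsPositiveWith u x' γ') :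
    P.IsPositiveWith u (x * x') (γ * γ') := by
  obtain ⟨h1, m, rfl⟩ := h
  obtain ⟨h1', m', rfl⟩ := h'
  refine ⟨norm_mul_sub_one_lt h1 h1', m + m', ?_⟩
  rw [zpow_add₀ (norm_pos_iff.1 (P.norm_uniformizer_pos hu))]
  ring

theorem IsPositiveWith.pow {u x γ : P.Kinf} (h : P.IsPositiveWith u x γ) (n : ℕ) :
    P.IsPositiveWith u (x ^ n) (γ ^ n) := by
  obtain ⟨h1, m, rfl⟩ := h
  exact ⟨norm_pow_sub_one_lt h1 n, m * n, by rw [mul_pow, zpow_mul, zpow_natCast]⟩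

theorem IsPositiveWith.norm_ratio {u x x' γ γ' : P.Kinf} (hu : P.IsUniformizer u)
    (h : P.IsPositiveWith u x γ) (h' : P.IsPositiveWith u x' γ') (hn : ‖x‖ = ‖x'‖) :
    x * γ' = x' * γ := by
  obtain ⟨h1, m, rfl⟩ := h
  obtain ⟨h1', m', rfl⟩ := h'
  rw [norm_mul, norm_mul, norm_zpow, norm_zpow, norm_eq_one_of_norm_sub_one_lt h1,
    norm_eq_one_of_norm_sub_one_lt h1', mul_one, mul_one] at hn
  have := zpow_right_injective₀ (P.norm_uniformizer_pos hu) hu.1.ne hn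
  rw [this]; ring

theorem span_pow_eq (a : K) (n : ℕ) :
    (Submodule.span P.ringA {a}) ^ n = Submodule.span P.ringA {a ^ n} := by
  rw [Submodule.span_pow, Set.singleton_pow]

variable {Fq : Type*} [Field Fq] [Algebra Fq K] [Finite Fq]

/-- By density the unit part of `a` is congruent to some x in K, and a power of x is a 1-unit
because the residue field at ∞ is algebraic over Fq. -/
theorem exists_isPositiveWith_pow (hK : IsCurveFunctionField Fq K) {u : P.Kinf}
    (hu : P.IsUniformizer u) {a : K} (ha : a ≠ 0) :
    ∃ (n : ℕ) (γ : P.Kinf), 0 < n ∧ P.IsPositiveWith u (P.toKinf (a ^ n)) γ := by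
  obtain ⟨m, y, hy, hay⟩ := P.exists_zpow_mul hu (P.toKinf_ne_zero ha)
  obtain ⟨x, hx⟩ : ∃ x : K, ‖y - P.toKinf x‖ < 1 := by
    have hd := UniformSpace.Completion.denseRange_coe (α := WithAbs P.abv)
    obtain ⟨z, hz⟩ := hd.exists_dist_lt y one_pos
    exact ⟨z.ofAbs, by rwa [dist_eq_norm] at hz⟩
  have hx1 : ‖P.toKinf x‖ = 1 := by
    have h2 := IsUltrametricDist.norm_add_eq_max_of_norm_ne_norm (x := P.toKinf x - y) (y := y)
      (by rw [norm_sub_rev, hy]; exact hx.ne)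
    rw [sub_add_cancel, hy, norm_sub_rev, max_eq_right hx.le] at h2
    exact h2
  have hv : P.v x = 1 := by rwa [norm_toKinf, abv_eq_one_iff] at hx1
  obtain ⟨n, hn, hxn⟩ := P.exists_v_pow_sub_one_lt hK hv
  have hxn' : ‖P.toKinf x ^ n - 1‖ < 1 := by
    rw [← abv_lt_one_iff, ← norm_toKinf, ← toKinfHom_apply, map_sub, map_pow, map_one] at hxn
    exact hxn
  have hx0 : P.toKinf x ≠ 0 := norm_ne_zero_iff.1 (by rw [hx1]; exact one_ne_zero)
  have hyx : ‖y / P.toKinf x - 1‖ < 1 := by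
    rw [div_sub_one hx0, norm_div, hx1, div_one]; exact hx
  refine ⟨n, y ^ n, hn, ?_, m * n, ?_⟩
  · have := norm_mul_sub_one_lt (norm_pow_sub_one_lt hyx n) hxn'
    rwa [div_pow, div_mul_cancel₀ _ (pow_ne_zero _ hx0)] at this
  · rw [← toKinfHom_apply, map_pow, toKinfHom_apply, hay, mul_pow, zpow_mul, zpow_natCast]

theorem exists_isIdealUnit [IsDedekindDomain P.ringA] [IsFractionRing P.ringA K]
    [Finite (ClassGroup P.ringA)] (hK : IsCurveFunctionField Fq K) {u : P.Kinf}
    (hu : P.IsUniformizer u) {I : Submodule P.ringA K} (hfg : I.FG) (hI : I ≠ ⊥) :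
    ∃ w, P.IsIdealUnit u I w := by
  obtain ⟨h, a, hh, ha⟩ := P.exists_pow_eq_span hfg hI
  have ha0 : a ≠ 0 := by
    rintro rfl
    rw [Submodule.span_zero_singleton] at ha
    obtain ⟨x, hx, hx0⟩ := Submodule.exists_mem_ne_zero_of_ne_bot hI
    have := Submodule.pow_mem_pow _ hx h
    rw [ha, Submodule.mem_bot] at this
    exact hx0 (pow_eq_zero_iff hh.ne' |>.1 this)
  obtain ⟨n, γ, hn, hγ⟩ := exists_isPositiveWith_pow hK hu ha0
  obtain ⟨w, hw, hwn⟩ := P.exists_pow_eq_toCinf hγ.1 (Nat.mul_pos hh hn)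
  exact ⟨w, hw, h * n, a ^ n, γ, Nat.mul_pos hh hn, hγ, by rw [pow_mul, ha, span_pow_eq], hwn⟩

/-- The quotient a/b is a unit of A, hence a constant of absolute value 1. Two positive elements of
equal absolute value have a 1-unit as quotient, and the only constant which is a 1-unit is 1. -/
theorem eq_toCinf_of_span_eq (Fq : Type*) [Field Fq] [Algebra Fq K] [Finite Fq] {u : P.Kinf}
    (hu : P.IsUniformizer u) {a b : K} {γ δ : P.Kinf}
    (ha : P.IsPositiveWith u (P.toKinf a) γ) (hb : P.IsPositiveWith u (P.toKinf b) δ)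
    (h : Submodule.span P.ringA {a} = Submodule.span P.ringA {b}) : γ = δ := by
  have ha0 : a ≠ 0 := by
    rintro rfl
    exact ha.ne_zero hu (P.toKinfHom.map_zero)
  have hb0 : b ≠ 0 := by
    rintro rfl
    exact hb.ne_zero hu (P.toKinfHom.map_zero)
  obtain ⟨e, he⟩ := Submodule.mem_span_singleton.1 (h ▸ Submodule.mem_span_singleton_self a)
  obtain ⟨e', he'⟩ := Submodule.mem_span_singleton.1 (h ▸ Submodule.mem_span_singleton_self b)
  rw [Subring.smul_def, smul_eq_mul] at he he'
  have hmem : (a / b) ∈ P.ringA := by rw [← he, mul_div_cancel_right₀ _ hb0]; exact e.2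
  have hmem' : (a / b)⁻¹ ∈ P.ringA := by
    rw [inv_div, ← he', mul_div_cancel_right₀ _ ha0]; exact e'.2
  have hv : P.v (a / b) = 1 := P.v_eq_one_of_mem_ringA_of_inv_mem Fq hmem hmem'
    (div_ne_zero ha0 hb0)
  have hnorm : ‖P.toKinf a‖ = ‖P.toKinf b‖ := by
    rw [norm_toKinf, norm_toKinf, ← div_eq_one_iff_eq ((map_ne_zero P.abv).2 hb0), ← map_div₀,
      abv_eq_one_iff, hv]
  have h1 := ha.norm_ratio hu hb hnorm
  have hδ : δ ≠ 0 := by rintro rfl; simpa using hb.1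
  have hbn := P.toKinf_ne_zero hb0
  have hab : a / b = 1 := by
    refine P.eq_one_of_mem_ringA_of_inv_mem Fq hmem hmem' ?_
    rw [← abv_lt_one_iff, ← norm_toKinf, ← toKinfHom_apply, map_sub, map_div₀, map_one,
      toKinfHom_apply, toKinfHom_apply]
    have : P.toKinf a / P.toKinf b - 1 = ((γ - 1) - (δ - 1)) / δ := by
      field_simp
      linear_combination h1
    rw [this, norm_div, norm_eq_one_of_norm_sub_one_lt hb.1, div_one, sub_eq_add_neg]
    exact (IsUltrametricDist.norm_add_le_max _ _).trans_lt
      (max_lt ha.1 (by rw [norm_neg]; exact hb.1))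
  rw [div_eq_one_iff_eq hb0] at hab
  rw [hab] at h1
  exact (mul_left_cancel₀ hbn h1).symm

/-- Both candidates are compared through the generators of the common power of I with exponent n n';
uniqueness of roots among 1-units concludes. -/
theorem IsIdealUnit.unique (Fq : Type*) [Field Fq] [Algebra Fq K] [Finite Fq] {u : P.Kinf}
    (hu : P.IsUniformizer u) {I : Submodule P.ringA K} {w w' : P.Cinf}
    (h : P.IsIdealUnit u I w) (h' : P.IsIdealUnit u I w') : w = w' := by
  obtain ⟨p, _⟩ := CharP.exists Fq
  have : Fact p.Prime := ⟨CharP.char_is_prime Fq p⟩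
  have : CharP K p := charP_of_injective_algebraMap (algebraMap Fq K).injective p
  have := P.charP_Cinf p
  obtain ⟨h1, n, a, γ, hn, ha, hI, hw⟩ := h
  obtain ⟨h1', n', a', γ', hn', ha', hI', hw'⟩ := h'
  refine eq_of_pow_eq_pow_of_norm_sub_one_lt p h1 h1' (Nat.mul_pos hn hn') ?_
  have e1 : P.IsPositiveWith u (P.toKinf (a ^ n')) (γ ^ n') := by
    rw [← toKinfHom_apply, map_pow]; exact ha.pow n'
  have e2 : P.IsPositiveWith u (P.toKinf (a' ^ n)) (γ' ^ n) := by
    rw [← toKinfHom_apply, map_pow]; exact ha'.pow n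
  have := eq_toCinf_of_span_eq Fq hu e1 e2 (by
    rw [← span_pow_eq, ← span_pow_eq, ← hI, ← hI', ← pow_mul, ← pow_mul, mul_comm])
  rw [pow_mul, hw, mul_comm, pow_mul, hw', ← toCinfHom_apply, ← toCinfHom_apply, ← map_pow,
    ← map_pow, this]

theorem IsIdealUnit.mul {u : P.Kinf} (hu : P.IsUniformizer u) {I J : Submodule P.ringA K}
    {w w' : P.Cinf} (h : P.IsIdealUnit u I w) (h' : P.IsIdealUnit u J w') :
    P.IsIdealUnit u (I * J) (w * w') := by
  obtain ⟨h1, n, a, γ, hn, ha, hI, hw⟩ := h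
  obtain ⟨h1', n', a', γ', hn', ha', hI', hw'⟩ := h'
  refine ⟨norm_mul_sub_one_lt h1 h1', n * n', a ^ n' * a' ^ n, γ ^ n' * γ' ^ n,
    Nat.mul_pos hn hn', ?_, ?_, ?_⟩
  · rw [← toKinfHom_apply, map_mul, map_pow, map_pow]
    exact (ha.pow n').mul hu (ha'.pow n)
  · rw [mul_pow, pow_mul, hI, mul_comm n, pow_mul, hI', span_pow_eq, span_pow_eq,
      Submodule.span_mul_span, Set.singleton_mul_singleton]
  · rw [mul_pow, pow_mul, hw, mul_comm n, pow_mul, hw', ← toCinfHom_apply, ← toCinfHom_apply,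
      ← toCinfHom_apply, map_mul, map_pow, map_pow]

theorem idealUnit_spec [IsDedekindDomain P.ringA] [IsFractionRing P.ringA K]
    [Finite (ClassGroup P.ringA)] (hK : IsCurveFunctionField Fq K) {u : P.Kinf}
    (hu : P.IsUniformizer u) {I : Submodule P.ringA K} (hfg : I.FG) (hI : I ≠ ⊥) :
    P.IsIdealUnit u I (P.idealUnit u I) := by
  have h := exists_isIdealUnit hK hu hfg hI
  rw [idealUnit, dif_pos h]
  exact h.choose_spec

theorem idealUnit_mul [IsDedekindDomain P.ringA] [IsFractionRing P.ringA K]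
    [Finite (ClassGroup P.ringA)] (hK : IsCurveFunctionField Fq K) {u : P.Kinf}
    (hu : P.IsUniformizer u) {I J : Submodule P.ringA K} (hfg : I.FG) (hI : I ≠ ⊥)
    (hfg' : J.FG) (hJ : J ≠ ⊥) :
    P.idealUnit u (I * J) = P.idealUnit u I * P.idealUnit u J := by
  have h := (idealUnit_spec hK hu hfg hI).mul hu (idealUnit_spec hK hu hfg' hJ)
  have h2 : ∃ w, P.IsIdealUnit u (I * J) w := ⟨_, h⟩
  have h3 : P.IsIdealUnit u (I * J) (P.idealUnit u (I * J)) := by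
    rw [idealUnit, dif_pos h2]
    exact h2.choose_spec
  exact h3.unique Fq hu h

end Place
end FFQSM
end

/-! ### Commensurable lattices and their determination by the ideal. -/

noncomputable section
namespace FFQSM
variable {K : Type*} [Field K]
namespace Place
variable {P : Place K}

section Multiples

variable [IsFractionRing P.ringA K]

/-- Any lattice becomes contained in any other one after multiplication by a nonzero element
of `A`. -/
theorem exists_mul_mem {Λ Λ' : Submodule P.ringA K} (hfg : Λ.FG) (h' : Λ' ≠ ⊥) :
    ∃ a : P.ringA, (a : K) ≠ 0 ∧ ∀ z ∈ Λ, (a : K) * z ∈ Λ' := by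
  obtain ⟨y, hy, hy0⟩ := Submodule.exists_mem_ne_zero_of_ne_bot h'
  obtain ⟨s, rfl⟩ := hfg
  classical
  obtain ⟨⟨a, ha⟩, h⟩ := IsLocalization.exist_integer_multiples_of_finset
    (nonZeroDivisors P.ringA) (s.image fun z => z / y)
  refine ⟨a, fun h0 => nonZeroDivisors.ne_zero ha (Subtype.ext h0), fun z hz => ?_⟩
  induction hz using Submodule.span_induction with
  | mem z hz =>
    obtain ⟨r, hr⟩ := h (z / y) (Finset.mem_image_of_mem _ hz)
    have hr' : (r : K) = a * (z / y) := hr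
    have : (a : K) * z = r • y := by
      rw [Subring.smul_def, smul_eq_mul, hr', mul_assoc, div_mul_cancel₀ _ hy0]
    rw [this]
    exact Λ'.smul_mem r hy
  | zero => simp
  | add z w _ _ hz hw => rw [mul_add]; exact add_mem hz hw
  | smul r z _ hz =>
    have : (a : K) * r • z = r • ((a : K) * z) := by
      simp only [Subring.smul_def, smul_eq_mul]; ring
    rw [this]
    exact Λ'.smul_mem r hz

end Multiples

namespace KLattice

/-- `φ(x) = z` modulo `Λ`. -/
def Rep (L : P.KLattice) (x z : K) : Prop :=
  L.φ (Submodule.Quotient.mk x) = Submodule.Quotient.mk z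

variable {L M N : P.KLattice} {x y z : K}

theorem exists_rep (L : P.KLattice) (x : K) : ∃ z, L.Rep x z := by
  obtain ⟨z, hz⟩ := Submodule.Quotient.mk_surjective _ (L.φ (Submodule.Quotient.mk x))
  exact ⟨z, hz.symm⟩

theorem Rep.iff_sub_mem (h : L.Rep x y) : L.Rep x z ↔ y - z ∈ L.Λ := by
  rw [Rep, h, Submodule.Quotient.eq]

theorem Rep.mul (h : L.Rep x y) (a : P.ringA) : L.Rep (a * x) (a * y) := by
  have : L.φ (Submodule.Quotient.mk (a • x)) = Submodule.Quotient.mk (a • y) := by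
    rw [Submodule.Quotient.mk_smul, map_smul, h, Submodule.Quotient.mk_smul]
  exact this

theorem rep_one_zero (L : P.KLattice) : L.Rep 1 0 := by
  have h1 : (Submodule.Quotient.mk 1 : K ⧸ (1 : Submodule P.ringA K)) = 0 :=
    (Submodule.Quotient.mk_eq_zero _).2 (Submodule.one_le.1 le_rfl)
  rw [Rep, h1, map_zero, Submodule.Quotient.mk_zero]

theorem ext_rep (hΛ : L.Λ = M.Λ) (h : ∀ x z, L.Rep x z ↔ M.Rep x z) : L = M := by
  obtain ⟨Λ, fg, hb, φ⟩ := L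
  obtain ⟨Λ', fg', hb', φ'⟩ := M
  obtain rfl : Λ = Λ' := hΛ
  congr 1
  refine LinearMap.ext fun x => ?_
  obtain ⟨x, rfl⟩ := Submodule.Quotient.mk_surjective _ x
  obtain ⟨z, hz⟩ := exists_rep ⟨Λ, fg, hb, φ⟩ x
  exact Eq.trans hz ((h x z).1 hz).symm

/-- If representatives y and z differ by an element l + m of the sum of the two lattices, then y - l
represents both values. This form avoids the quotient by the sum. -/
theorem commens_iff : L.Commens M ↔ ∀ x, ∃ z, L.Rep x z ∧ M.Rep x z := by
  constructor
  · intro h x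
    obtain ⟨y, hy⟩ := L.exists_rep x
    obtain ⟨z, hz⟩ := M.exists_rep x
    have h1 := LinearMap.congr_fun h (Submodule.Quotient.mk x)
    rw [LinearMap.comp_apply, LinearMap.comp_apply, hy, hz] at h1
    have h2 : y - z ∈ L.Λ ⊔ M.Λ := (Submodule.Quotient.eq _).1 h1
    obtain ⟨l, hl, m, hm, hlm⟩ := Submodule.mem_sup.1 h2
    refine ⟨y - l, (hy.iff_sub_mem).2 (by simpa using hl), (hz.iff_sub_mem).2 ?_⟩
    have : z - (y - l) = -m := by linear_combination hlm
    rw [this]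
    exact neg_mem hm
  · intro h
    refine LinearMap.ext fun x => ?_
    obtain ⟨x, rfl⟩ := Submodule.Quotient.mk_surjective _ x
    obtain ⟨z, hz, hz'⟩ := h x
    rw [LinearMap.comp_apply, LinearMap.comp_apply, hz, hz']
    rfl

theorem Commens.symm (h : L.Commens M) : M.Commens L :=
  commens_iff.2 fun x => (commens_iff.1 h x).imp fun _ h => h.symm

/-- Divisibility of K/A: φ'(x) = a φ'(x/a), and multiplication by `a` carries the ambiguity in L.Λ
into M.Λ. So L and the ideal of M determine M. -/
theorem Commens.rep (h : L.Commens M) {a : P.ringA} (ha : (a : K) ≠ 0)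
    (haL : ∀ z ∈ L.Λ, (a : K) * z ∈ M.Λ) (hx : L.Rep (x / a) y) : M.Rep x (a * y) := by
  obtain ⟨z, hz, hz'⟩ := commens_iff.1 h (x / a)
  have h1 := hz'.mul a
  rw [mul_div_cancel₀ _ ha] at h1
  rw [h1.iff_sub_mem, ← mul_sub]
  exact haL _ (hz.iff_sub_mem.1 hx)

theorem Commens.rep_iff (h : L.Commens M) {a : P.ringA} (ha : (a : K) ≠ 0)
    (haL : ∀ z ∈ L.Λ, (a : K) * z ∈ M.Λ) :
    M.Rep x z ↔ ∃ y, L.Rep (x / a) y ∧ a * y - z ∈ M.Λ := by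
  constructor
  · intro hz
    obtain ⟨y, hy⟩ := L.exists_rep (x / a)
    exact ⟨y, hy, (h.rep ha haL hy).iff_sub_mem.1 hz⟩
  · rintro ⟨y, hy, hyz⟩
    exact (h.rep ha haL hy).iff_sub_mem.2 hyz

section

variable [IsFractionRing P.ringA K]

/-- Dividing x by b and then by `a` first, the element b a y represents the values of L and N at x
simultaneously. -/
theorem Commens.trans (h : L.Commens M) (h' : M.Commens N) : L.Commens N := by
  obtain ⟨a, ha, haL⟩ := exists_mul_mem L.fg M.ne_bot
  obtain ⟨b, hb, hbM⟩ := exists_mul_mem M.fg N.ne_bot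
  refine commens_iff.2 fun x => ?_
  obtain ⟨y, hy⟩ := L.exists_rep (x / b / a)
  refine ⟨b * (a * y), ?_, h'.rep hb hbM (h.rep ha haL hy)⟩
  have := (hy.mul a).mul b
  rwa [mul_div_cancel₀ _ ha, mul_div_cancel₀ _ hb] at this

theorem Commens.eq (h : L.Commens M) (h' : L.Commens N) (hΛ : M.Λ = N.Λ) : M = N := by
  have hMN := commens_iff.1 (h.symm.trans h')
  refine ext_rep hΛ fun x z => ?_
  obtain ⟨y, hy, hy'⟩ := hMN x
  rw [hy.iff_sub_mem, hy'.iff_sub_mem, hΛ]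

end

/-- The only possible choice is φ'(x) = a φ(x/a) modulo Λ'. It descends to K/A exactly when it kills
1, that is, when a y is in Λ'. -/
theorem exists_commens_of_rep {a : P.ringA} (ha : (a : K) ≠ 0) {Λ' : Submodule P.ringA K}
    (hfg : Λ'.FG) (hbot : Λ' ≠ ⊥) (haL : ∀ z ∈ L.Λ, (a : K) * z ∈ Λ')
    (h : L.Rep (a : K)⁻¹ y) (hy : (a : K) * y ∈ Λ') :
    ∃ M : P.KLattice, M.Λ = Λ' ∧ L.Commens M := by
  let m : K → (K →ₗ[P.ringA] K) := fun c => LinearMap.mulLeft P.ringA c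
  let ψ : K →ₗ[P.ringA] K ⧸ Λ' :=
    (Submodule.mapQ L.Λ Λ' (m a) fun z hz => haL z hz) ∘ₗ L.φ ∘ₗ
      (Submodule.mkQ (1 : Submodule P.ringA K)) ∘ₗ m (a : K)⁻¹
  have hψ : ∀ x z, L.Rep ((a : K)⁻¹ * x) z → ψ x = Submodule.Quotient.mk (a * z) := fun x z hz => by
    have h1 : ψ x = Submodule.mapQ L.Λ Λ' (m a) (fun z hz => haL z hz)
      (L.φ (Submodule.Quotient.mk ((a : K)⁻¹ * x))) := rfl
    rw [h1, hz]
    rfl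
  have h1 : ψ 1 = 0 := by
    rw [hψ 1 y (by rwa [mul_one]), Submodule.Quotient.mk_eq_zero]
    exact hy
  have hker : (1 : Submodule P.ringA K) ≤ LinearMap.ker ψ := by
    intro x hx
    obtain ⟨r, rfl⟩ := Submodule.mem_one.1 hx
    rw [LinearMap.mem_ker, Algebra.algebraMap_eq_smul_one, map_smul, h1, smul_zero]
  refine ⟨⟨Λ', hfg, hbot, Submodule.liftQ _ ψ hker⟩, rfl, commens_iff.2 fun x => ?_⟩
  obtain ⟨z, hz⟩ := L.exists_rep ((a : K)⁻¹ * x)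
  refine ⟨a * z, ?_, ?_⟩
  · have := hz.mul a
    rwa [mul_inv_cancel_left₀ ha] at this
  · exact hψ x z hz

/-- The existence of a commensurable lattice with ideal Λ' depends on Λ and on the single value
φ(1/a), so it is a locally constant condition on L. -/
theorem exists_commens_iff {a : P.ringA} (ha : (a : K) ≠ 0) {Λ' : Submodule P.ringA K}
    (hfg : Λ'.FG) (hbot : Λ' ≠ ⊥) (haL : ∀ z ∈ L.Λ, (a : K) * z ∈ Λ')
    (h : L.Rep (a : K)⁻¹ y) :
    (∃ M : P.KLattice, M.Λ = Λ' ∧ L.Commens M) ↔ (a : K) * y ∈ Λ' := by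
  constructor
  · rintro ⟨M, rfl, hM⟩
    have := hM.rep (x := 1) ha haL (by rwa [one_div])
    have := this.iff_sub_mem.1 M.rep_one_zero
    rwa [sub_zero] at this
  · exact exists_commens_of_rep ha hfg hbot haL h

section Scale

open scoped Pointwise

theorem mem_smul_iff {k : Kˣ} {Λ : Submodule P.ringA K} {x : K} :
    (k : K) * x ∈ k • Λ ↔ x ∈ Λ := by
  constructor
  · rintro ⟨y, hy, h⟩
    have h' : k • y = k • x := h
    rwa [← smul_left_cancel k h']
  · exact fun h => ⟨x, h, rfl⟩

/-- The lattice `k L`. -/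
def scale (k : Kˣ) (L : P.KLattice) : P.KLattice where
  Λ := k • L.Λ
  fg := L.fg.map _
  ne_bot := fun h => L.ne_bot (by
    refine (Submodule.eq_bot_iff _).2 fun x hx => ?_
    have := (mem_smul_iff (k := k)).2 hx
    rw [h, Submodule.mem_bot] at this
    exact (mul_eq_zero_iff_left k.ne_zero).1 this)
  φ := (Submodule.mapQ L.Λ (k • L.Λ) (LinearMap.mulLeft P.ringA (k : K))
    fun _ hz => mem_smul_iff.2 hz) ∘ₗ L.φ

theorem rep_scale {k : Kˣ} : (L.scale k).Rep x (k * z) ↔ L.Rep x z := by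
  obtain ⟨y, hy⟩ := L.exists_rep x
  have h1 : (L.scale k).Rep x (k * y) := by
    have h2 : (L.scale k).φ (Submodule.Quotient.mk x) = Submodule.mapQ L.Λ (k • L.Λ)
      (LinearMap.mulLeft P.ringA (k : K)) (fun _ hz => mem_smul_iff.2 hz)
        (L.φ (Submodule.Quotient.mk x)) := rfl
    rw [Rep, h2, hy]
    rfl
  rw [h1.iff_sub_mem, hy.iff_sub_mem, ← mul_sub]
  exact mem_smul_iff

theorem isScaling_scale (k : Kˣ) (L : P.KLattice) : IsScaling k L (L.scale k) :=
  ⟨fun _ => mem_smul_iff.symm, fun _ _ h => rep_scale.2 h⟩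

theorem IsScaling.eq {k : Kˣ} (h : IsScaling k L M) : M = L.scale k := by
  have hmul : ∀ z : K, z = k * ((k⁻¹ : Kˣ) * z) := fun z => by simp
  have hΛ : M.Λ = (L.scale k).Λ := by
    ext z
    rw [hmul z, ← h.1]
    exact mem_smul_iff.symm
  refine ext_rep hΛ fun x z => ?_
  obtain ⟨y, hy⟩ := L.exists_rep x
  have h1 : M.Rep x (k * y) := h.2 x y hy
  rw [h1.iff_sub_mem, (rep_scale.2 hy).iff_sub_mem, hΛ]

theorem scale_one (L : P.KLattice) : L.scale 1 = L := by
  refine (IsScaling.eq ⟨fun x => ?_, fun x y h => ?_⟩).symm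
  · simp
  · simpa using h

theorem scale_scale (k l : Kˣ) (L : P.KLattice) : (L.scale k).scale l = L.scale (l * k) := by
  refine IsScaling.eq ⟨fun x => ?_, fun x y h => ?_⟩
  · rw [Units.val_mul, mul_assoc, (isScaling_scale k L).1, (isScaling_scale l _).1]
  · rw [Units.val_mul, mul_assoc]
    exact (isScaling_scale l _).2 _ _ ((isScaling_scale k L).2 _ _ h)

/-- Multiplication by `k` as a permutation of the set of lattices. -/
def scaleEquiv (k : Kˣ) : P.KLattice ≃ P.KLattice where
  toFun := scale k
  invFun := scale k⁻¹
  left_inv L := by rw [scale_scale, inv_mul_cancel, scale_one]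
  right_inv L := by rw [scale_scale, mul_inv_cancel, scale_one]

theorem Commens.scale (h : L.Commens M) (k : Kˣ) : (L.scale k).Commens (M.scale k) :=
  commens_iff.2 fun x => by
    obtain ⟨z, hz, hz'⟩ := commens_iff.1 h x
    exact ⟨k * z, rep_scale.2 hz, rep_scale.2 hz'⟩

theorem commens_scale_iff (k : Kˣ) : (L.scale k).Commens (M.scale k) ↔ L.Commens M :=
  ⟨fun h => by simpa only [scale_scale, inv_mul_cancel, scale_one] using h.scale k⁻¹,
    fun h => h.scale k⟩

end Scale

end KLattice
end Place
end FFQSM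
end

/-! ### Topology of the space of lattices and of the groupoid. -/

noncomputable section
namespace FFQSM
variable {K : Type*} [Field K]
namespace Place
variable {P : Place K}

namespace KLattice

variable {L M N : P.KLattice} {x y z : K}

theorem isOpen_rep_of_eq (Λ₀ : Submodule P.ringA K) (x y : K) :
    IsOpen {L : P.KLattice | L.Λ = Λ₀ ∧ L.Rep x y} :=
  TopologicalSpace.isOpen_generateFrom_of_mem ⟨Λ₀, x, y, rfl⟩

theorem isOpen_setOf_Λ (S : Set (Submodule P.ringA K)) : IsOpen {L : P.KLattice | L.Λ ∈ S} := by
  have : {L : P.KLattice | L.Λ ∈ S} = ⋃ Λ₀ ∈ S, {L : P.KLattice | L.Λ = Λ₀ ∧ L.Rep 1 0} := by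
    ext L
    simp [L.rep_one_zero]
  rw [this]
  exact isOpen_biUnion fun Λ₀ _ => isOpen_rep_of_eq Λ₀ _ _

theorem isOpen_rep (x y : K) : IsOpen {L : P.KLattice | L.Rep x y} := by
  have : {L : P.KLattice | L.Rep x y} = ⋃ Λ₀, {L : P.KLattice | L.Λ = Λ₀ ∧ L.Rep x y} := by
    ext L; simp
  rw [this]
  exact isOpen_iUnion fun Λ₀ => isOpen_rep_of_eq Λ₀ _ _

theorem continuous_of_isOpen {X : Type*} [TopologicalSpace X] {f : X → P.KLattice}
    (h1 : ∀ Λ₀, IsOpen {c | (f c).Λ = Λ₀}) (h2 : ∀ x y, IsOpen {c | (f c).Rep x y}) :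
    Continuous f := by
  refine continuous_generateFrom_iff.2 ?_
  rintro _ ⟨Λ₀, x, y, rfl⟩
  exact (h1 Λ₀).inter (h2 x y)

theorem isOpen_setOf_exists_rep (Q : P.ringA → Submodule P.ringA K → Prop) (g : P.ringA → K)
    (R : P.ringA → K → Prop) :
    IsOpen {L : P.KLattice | ∃ a : P.ringA, (a : K) ≠ 0 ∧ Q a L.Λ ∧ ∃ y, L.Rep (g a) y ∧ R a y} := by
  have : {L : P.KLattice | ∃ a : P.ringA, (a : K) ≠ 0 ∧ Q a L.Λ ∧ ∃ y, L.Rep (g a) y ∧ R a y} =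
      ⋃ (a : P.ringA) (_ : (a : K) ≠ 0) (y : K) (_ : R a y),
        {L : P.KLattice | L.Λ ∈ {Λ | Q a Λ}} ∩ {L : P.KLattice | L.Rep (g a) y} := by
    ext L
    simp only [Set.mem_ofPred_eq, Set.mem_iUnion, Set.mem_inter_iff, exists_prop]
    tauto
  rw [this]
  exact isOpen_iUnion fun a => isOpen_iUnion fun _ => isOpen_iUnion fun y => isOpen_iUnion fun _ =>
    (isOpen_setOf_Λ _).inter (isOpen_rep _ _)

/-- The set of lattices which are commensurable with some `(Λ', φ')`. -/
def partnerSet (P : Place K) (Λ' : Submodule P.ringA K) : Set P.KLattice :=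
  {L | ∃ M : P.KLattice, M.Λ = Λ' ∧ L.Commens M}

open Classical in
/-- The lattice `(Λ', φ')` commensurable with `L`, if there is one. -/
def partner (L : P.KLattice) (Λ' : Submodule P.ringA K) : P.KLattice :=
  if h : L ∈ partnerSet P Λ' then h.choose else L

theorem partner_Λ {Λ' : Submodule P.ringA K} (h : L ∈ partnerSet P Λ') : (L.partner Λ').Λ = Λ' := by
  rw [partner, dif_pos h]; exact h.choose_spec.1

theorem commens_partner {Λ' : Submodule P.ringA K} (h : L ∈ partnerSet P Λ') :
    L.Commens (L.partner Λ') := by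
  rw [partner, dif_pos h]; exact h.choose_spec.2

theorem Commens.mem_partnerSet (h : L.Commens M) : L ∈ partnerSet P M.Λ := ⟨M, rfl, h⟩

section

variable [IsFractionRing P.ringA K]

theorem Commens.partner_eq (h : L.Commens M) : L.partner M.Λ = M :=
  (commens_partner h.mem_partnerSet).eq h (partner_Λ h.mem_partnerSet)

theorem mem_partnerSet_iff {Λ' : Submodule P.ringA K} (hfg : Λ'.FG) (hbot : Λ' ≠ ⊥) :
    L ∈ partnerSet P Λ' ↔ ∃ a : P.ringA, (a : K) ≠ 0 ∧ (∀ z ∈ L.Λ, (a : K) * z ∈ Λ') ∧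
      ∃ y, L.Rep (a : K)⁻¹ y ∧ (a : K) * y ∈ Λ' := by
  constructor
  · intro h
    obtain ⟨a, ha, haL⟩ := exists_mul_mem L.fg hbot
    obtain ⟨y, hy⟩ := L.exists_rep (a : K)⁻¹
    exact ⟨a, ha, haL, y, hy, (exists_commens_iff ha hfg hbot haL hy).1 h⟩
  · rintro ⟨a, ha, haL, y, hy, h⟩
    exact (exists_commens_iff ha hfg hbot haL hy).2 h

theorem notMem_partnerSet_iff {Λ' : Submodule P.ringA K} (hfg : Λ'.FG) (hbot : Λ' ≠ ⊥) :
    L ∉ partnerSet P Λ' ↔ ∃ a : P.ringA, (a : K) ≠ 0 ∧ (∀ z ∈ L.Λ, (a : K) * z ∈ Λ') ∧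
      ∃ y, L.Rep (a : K)⁻¹ y ∧ (a : K) * y ∉ Λ' := by
  constructor
  · intro h
    obtain ⟨a, ha, haL⟩ := exists_mul_mem L.fg hbot
    obtain ⟨y, hy⟩ := L.exists_rep (a : K)⁻¹
    exact ⟨a, ha, haL, y, hy, fun h' => h ((exists_commens_iff ha hfg hbot haL hy).2 h')⟩
  · rintro ⟨a, ha, haL, y, hy, h⟩ h'
    exact h ((exists_commens_iff ha hfg hbot haL hy).1 h')

/-- The set and its complement are both described by the ideal of L and one value of φ, which are
open conditions. -/
theorem isClopen_partnerSet (Λ' : Submodule P.ringA K) : IsClopen (partnerSet P Λ') := by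
  by_cases h : Λ'.FG ∧ Λ' ≠ ⊥
  · obtain ⟨hfg, hbot⟩ := h
    refine ⟨⟨?_⟩, ?_⟩
    · have : (partnerSet P Λ')ᶜ = {L : P.KLattice | ∃ a : P.ringA, (a : K) ≠ 0 ∧
          (∀ z ∈ L.Λ, (a : K) * z ∈ Λ') ∧ ∃ y, L.Rep (a : K)⁻¹ y ∧ (a : K) * y ∉ Λ'} :=
        Set.ext fun L => notMem_partnerSet_iff hfg hbot
      rw [this]
      exact isOpen_setOf_exists_rep (fun a Λ => ∀ z ∈ Λ, (a : K) * z ∈ Λ') _ _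
    · have : partnerSet P Λ' = {L : P.KLattice | ∃ a : P.ringA, (a : K) ≠ 0 ∧
          (∀ z ∈ L.Λ, (a : K) * z ∈ Λ') ∧ ∃ y, L.Rep (a : K)⁻¹ y ∧ (a : K) * y ∈ Λ'} :=
        Set.ext fun L => mem_partnerSet_iff hfg hbot
      rw [this]
      exact isOpen_setOf_exists_rep (fun a Λ => ∀ z ∈ Λ, (a : K) * z ∈ Λ') _ _
  · have : partnerSet P Λ' = ∅ := by
      refine Set.eq_empty_of_forall_notMem ?_
      rintro L ⟨M, rfl, -⟩
      exact h ⟨M.fg, M.ne_bot⟩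
    rw [this]
    exact isClopen_empty

theorem continuousOn_partner (Λ' : Submodule P.ringA K) :
    ContinuousOn (fun L : P.KLattice => L.partner Λ') (partnerSet P Λ') := by
  rw [continuousOn_iff_continuous_domRestrict]
  change Continuous fun L : partnerSet P Λ' => L.1.partner Λ'
  refine continuous_of_isOpen (fun Λ₀ => ?_) fun x y => ?_
  · have : {L : partnerSet P Λ' | (L.1.partner Λ').Λ = Λ₀} = {_L | Λ' = Λ₀} :=
      Set.ext fun L => by simp only [Set.mem_ofPred_eq, partner_Λ L.2]
    rw [this]
    exact isOpen_const
  · have h : {L : partnerSet P Λ' | (L.1.partner Λ').Rep x y} =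
        Subtype.val ⁻¹' {L : P.KLattice | ∃ a : P.ringA, (a : K) ≠ 0 ∧
          (∀ z ∈ L.Λ, (a : K) * z ∈ Λ') ∧ ∃ y', L.Rep (x / a) y' ∧ (a : K) * y' - y ∈ Λ'} := by
      ext L
      have hc := commens_partner L.2
      have hΛ := partner_Λ L.2
      simp only [Set.mem_ofPred_eq, Set.mem_preimage]
      constructor
      · intro hr
        obtain ⟨a, ha, haL⟩ := exists_mul_mem L.1.fg (L.1.partner Λ').ne_bot
        obtain ⟨y', h1, h2⟩ := (hc.rep_iff ha haL).1 hr
        simp only [hΛ] at haL h2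
        exact ⟨a, ha, haL, y', h1, h2⟩
      · rintro ⟨a, ha, haL, y', h1, h2⟩
        exact (hc.rep_iff ha (by simpa only [hΛ] using haL)).2 ⟨y', h1, by rwa [hΛ]⟩
    rw [h]
    exact (isOpen_setOf_exists_rep (fun a Λ => ∀ z ∈ Λ, (a : K) * z ∈ Λ') _ _).preimage
      continuous_subtype_val

end

/-- Multiplication by `a` embeds the a-torsion of K/Λ in Λ/aΛ, which is finite since A/a is. -/
theorem finite_setOf_smul_eq_zero [IsDedekindDomain P.ringA] [Ring.HasFiniteQuotients P.ringA]
    {Λ : Submodule P.ringA K} (hfg : Λ.FG) {a : P.ringA} (ha : (a : K) ≠ 0) :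
    {d : K ⧸ Λ | a • d = 0}.Finite := by
  have ha' : a ≠ 0 := fun h => ha (by simp [h])
  have : Module.Finite P.ringA Λ := Module.Finite.iff_fg.2 hfg
  have hfin : Finite (P.ringA ⧸ Ideal.span {a}) :=
    Ring.HasFiniteQuotients.finiteQuotient (by simpa using ha')
  have hfin' : Finite (Λ ⧸ (Ideal.span {a} • (⊤ : Submodule P.ringA Λ))) :=
    Submodule.finite_quotient_smul _ Module.Finite.fg_top
  choose r hr using Submodule.Quotient.mk_surjective Λ
  have hmem : ∀ d : {d : K ⧸ Λ | a • d = 0}, a • r d ∈ Λ := fun d => by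
    rw [← Submodule.Quotient.mk_eq_zero, Submodule.Quotient.mk_smul, hr]
    exact d.2
  let f : {d : K ⧸ Λ | a • d = 0} → Λ ⧸ (Ideal.span {a} • (⊤ : Submodule P.ringA Λ)) :=
    fun d => Submodule.Quotient.mk ⟨a • r d, hmem d⟩
  have hf : Function.Injective f := fun d d' h => by
    have h1 := (Submodule.Quotient.eq _).1 h
    rw [Submodule.ideal_span_singleton_smul] at h1
    obtain ⟨l, -, hl⟩ := h1
    have h2 : (a : K) * l = a * r d - a * r d' := congrArg Subtype.val hl
    have h3 : (l : K) = r d - r d' := mul_left_cancel₀ ha (by rw [h2, mul_sub])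
    refine Subtype.ext ?_
    rw [← hr d, ← hr d', Submodule.Quotient.eq, ← h3]
    exact l.2
  exact Set.finite_coe_iff.1 (Finite.of_injective f hf)

/-- The lattices `(Λ₀, φ)` form a compact set. -/
theorem isCompact_setOf_Λ_eq [IsDedekindDomain P.ringA] [IsFractionRing P.ringA K]
    [Ring.HasFiniteQuotients P.ringA] (Λ₀ : Submodule P.ringA K) :
    IsCompact {L : P.KLattice | L.Λ = Λ₀} := by
  by_cases hL : Λ₀.FG ∧ Λ₀ ≠ ⊥
  swap
  · have : {L : P.KLattice | L.Λ = Λ₀} = ∅ := by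
      refine Set.eq_empty_of_forall_notMem ?_
      rintro L rfl
      exact hL ⟨L.fg, L.ne_bot⟩
    rw [this]
    exact isCompact_empty
  obtain ⟨hfg, hbot⟩ := hL
  let D := K ⧸ Λ₀
  let X := K ⧸ (1 : Submodule P.ringA K)
  let tD : TopologicalSpace D := ⊥
  have : DiscreteTopology D := ⟨rfl⟩
  let S : Set (X → D) := {f | ∃ φ : X →ₗ[P.ringA] D, ⇑φ = f}
  have htors : ∀ x : X, ∃ a : P.ringA, (a : K) ≠ 0 ∧ a • x = 0 := fun x => by
    obtain ⟨x, rfl⟩ := Submodule.Quotient.mk_surjective _ x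
    obtain ⟨n, d, hd, rfl⟩ := IsFractionRing.div_surjective (A := P.ringA) x
    have hd0 : (d : K) ≠ 0 := fun h => nonZeroDivisors.ne_zero hd (Subtype.ext h)
    refine ⟨d, hd0, ?_⟩
    rw [← Submodule.Quotient.mk_smul, Submodule.Quotient.mk_eq_zero]
    refine Submodule.mem_one.2 ⟨n, ?_⟩
    change (n : K) = d * ((n : K) / d)
    rw [mul_div_cancel₀ _ hd0]
  choose a ha hax using htors
  -- As K/A is torsion, a homomorphism sends each x into a fixed finite torsion subset of K/Λ₀.
  -- Additivity and linearity are closed conditions, so Tychonoff's theorem applies.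
  have hScomp : IsCompact S := by
    have h1 : IsCompact (Set.univ.pi fun x : X => {d : D | a x • d = 0}) :=
      isCompact_univ_pi fun x => (finite_setOf_smul_eq_zero hfg (ha x)).isCompact
    refine h1.of_isClosed_subset ?_ ?_
    · have : S = (⋂ (x : X) (y : X), {f : X → D | f (x + y) = f x + f y}) ∩
          ⋂ (r : P.ringA) (x : X), {f : X → D | f (r • x) = r • f x} := by
        ext f
        simp only [Set.mem_inter_iff, Set.mem_iInter, Set.mem_ofPred_eq, S]
        constructor
        · rintro ⟨φ, rfl⟩
          exact ⟨map_add φ, map_smul φ⟩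
        · rintro ⟨h1, h2⟩
          exact ⟨⟨⟨f, h1⟩, h2⟩, rfl⟩
      rw [this]
      refine (isClosed_iInter fun x => isClosed_iInter fun y => ?_).inter
        (isClosed_iInter fun r => isClosed_iInter fun x => ?_)
      · have : ContinuousAdd D := ⟨continuous_of_discreteTopology⟩
        exact isClosed_eq (continuous_apply _) ((continuous_apply x).add (continuous_apply y))
      · exact isClosed_eq (continuous_apply _) ((continuous_of_discreteTopology
          (f := fun d : D => r • d)).comp (continuous_apply x))
    · rintro _ ⟨φ, rfl⟩ x -
      change a x • φ x = 0
      rw [← map_smul, hax, map_zero]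
  have : CompactSpace S := isCompact_iff_compactSpace.1 hScomp
  let g : S → P.KLattice := fun f => ⟨Λ₀, hfg, hbot, f.2.choose⟩
  have hg : ∀ f : S, ⇑(g f).φ = f.1 := fun f => f.2.choose_spec
  have hgc : Continuous g := by
    refine continuous_of_isOpen
      (fun Λ₁ => (isOpen_const : IsOpen {_f : S | Λ₀ = Λ₁})) fun x y => ?_
    have : {f : S | (g f).Rep x y} = (fun f : S => f.1 (Submodule.Quotient.mk x)) ⁻¹'
        {Submodule.Quotient.mk y} := by
      ext f
      change (g f).φ (Submodule.Quotient.mk x) = Submodule.Quotient.mk y ↔ _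
      rw [hg]
      rfl
    rw [this]
    exact (isOpen_discrete _).preimage ((continuous_apply _).comp continuous_subtype_val)
  have hrange : {L : P.KLattice | L.Λ = Λ₀} = Set.range g := by
    ext L
    constructor
    · rintro rfl
      refine ⟨⟨L.φ, L.φ, rfl⟩, ?_⟩
      refine ext_rep rfl fun x z => ?_
      rw [Rep, hg]
      rfl
    · rintro ⟨f, rfl⟩
      rfl
  rw [hrange]
  exact isCompact_range hgc

section Orbits

open scoped Pointwise

/-- Pairs of submodules of `K` up to simultaneous multiplication by an element of `K^*`. -/
abbrev Orbits (P : Place K) :=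
  MulAction.orbitRel.Quotient Kˣ (Submodule P.ringA K × Submodule P.ringA K)

/-- The class of `(Λ, Λ')` modulo `K^*`. -/
def orbitMk (Λ Λ' : Submodule P.ringA K) : Orbits P := Quotient.mk'' (Λ, Λ')

theorem orbitMk_eq_iff {Λ₁ Λ₁' Λ₂ Λ₂' : Submodule P.ringA K} :
    orbitMk Λ₁ Λ₁' = orbitMk Λ₂ Λ₂' ↔ ∃ k : Kˣ, k • Λ₂ = Λ₁ ∧ k • Λ₂' = Λ₁' := by
  rw [orbitMk, orbitMk, Quotient.eq'']
  change (_ ∈ MulAction.orbit Kˣ _) ↔ _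
  simp only [MulAction.mem_orbit_iff, Prod.smul_mk, Prod.mk.injEq]

theorem orbitMk_smul (k : Kˣ) (Λ Λ' : Submodule P.ringA K) :
    orbitMk (k • Λ) (k • Λ') = orbitMk Λ Λ' := orbitMk_eq_iff.2 ⟨k, rfl, rfl⟩

theorem mem_ringA_of_smul_le [IsDedekindDomain P.ringA] [IsFractionRing P.ringA K]
    {Λ : Submodule P.ringA K} (hfg : Λ.FG) (hbot : Λ ≠ ⊥) {k : Kˣ} (h : k • Λ ≤ Λ) :
    (k : K) ∈ P.ringA := by
  have h1 : IsIntegral P.ringA (k : K) := isIntegral_of_smul_mem_submodule Λ hbot hfg (k : K)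
    fun n hn => h (mem_smul_iff.2 hn)
  obtain ⟨r, hr⟩ := IsIntegrallyClosed.isIntegral_iff.1 h1
  rw [← hr]
  exact r.2

/-- An element stabilizing Λ is integral over A together with its inverse, hence a unit of A, which
stabilizes every submodule of K. -/
theorem smul_eq_of_smul_eq [IsDedekindDomain P.ringA] [IsFractionRing P.ringA K]
    {Λ : Submodule P.ringA K} (hfg : Λ.FG) (hbot : Λ ≠ ⊥) {k : Kˣ} (h : k • Λ = Λ)
    (Λ' : Submodule P.ringA K) : k • Λ' = Λ' := by
  have h' : k⁻¹ • Λ = Λ := by rw [inv_smul_eq_iff, h]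
  have hle : ∀ k : Kˣ, (k : K) ∈ P.ringA → k • Λ' ≤ Λ' := by
    rintro k hk _ ⟨x, hx, rfl⟩
    exact Λ'.smul_mem ⟨k, hk⟩ hx
  refine le_antisymm (hle k (mem_ringA_of_smul_le hfg hbot h.le)) ?_
  have := hle k⁻¹ (mem_ringA_of_smul_le hfg hbot h'.le)
  intro x hx
  have h2 := this (mem_smul_iff.2 hx)
  have h3 := (mem_smul_iff (k := k)).2 h2
  rwa [Units.mul_inv_cancel_left] at h3

/-- For a fixed Λ the orbit of (Λ, Λ') determines Λ', by the preceding description of stabilizers.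
-/
theorem finite_setOf_orbitMk_mem_right [IsDedekindDomain P.ringA] [IsFractionRing P.ringA K]
    {Λ : Submodule P.ringA K} (hfg : Λ.FG) (hbot : Λ ≠ ⊥) {S : Set (Orbits P)} (hS : S.Finite) :
    {Λ' | orbitMk Λ Λ' ∈ S}.Finite := by
  refine hS.preimage fun Λ₁ _ Λ₂ _ h => ?_
  obtain ⟨k, hk, hk'⟩ := orbitMk_eq_iff.1 h
  rw [← hk', smul_eq_of_smul_eq hfg hbot hk]

theorem finite_setOf_orbitMk_mem_left [IsDedekindDomain P.ringA] [IsFractionRing P.ringA K]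
    {Λ' : Submodule P.ringA K} (hfg : Λ'.FG) (hbot : Λ' ≠ ⊥) {S : Set (Orbits P)} (hS : S.Finite) :
    {Λ | orbitMk Λ Λ' ∈ S}.Finite := by
  refine hS.preimage fun Λ₁ _ Λ₂ _ h => ?_
  obtain ⟨k, hk, hk'⟩ := orbitMk_eq_iff.1 h
  rw [← hk, smul_eq_of_smul_eq hfg hbot hk']

end Orbits

end KLattice

namespace Groupoid

open KLattice

/-- The class of a pair of commensurable lattices. -/
def mk (c : P.CommensPair) : P.Groupoid := Quot.mk _ c

theorem isQuotientMap_mk : Topology.IsQuotientMap (mk : P.CommensPair → P.Groupoid) :=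
  isQuotientMap_quot_mk

theorem mk_scale (k : Kˣ) {L M : P.KLattice} (h : L.Commens M) :
    mk ⟨(L.scale k, M.scale k), h.scale k⟩ = mk ⟨(L, M), h⟩ :=
  (Quot.sound ⟨k, isScaling_scale k L, isScaling_scale k M⟩).symm

/-- The class of `(Λ, Λ')` modulo `K^*`, for a class of pairs of lattices. -/
def orbit : P.Groupoid → Orbits P :=
  Quot.lift (fun c => orbitMk c.1.1.Λ c.1.2.Λ) fun c d ⟨k, h1, h2⟩ => by
    rw [h1.eq, h2.eq]
    exact (orbitMk_smul k _ _).symm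

theorem orbit_mk (c : P.CommensPair) : orbit (mk c) = orbitMk c.1.1.Λ c.1.2.Λ := rfl

theorem isOpen_preimage_orbit (S : Set (Orbits P)) : IsOpen (orbit ⁻¹' S) := by
  rw [← isQuotientMap_mk.isOpen_preimage]
  have : (mk : P.CommensPair → P.Groupoid) ⁻¹' (orbit ⁻¹' S) =
      ⋃ (Λ) (Λ') (_ : orbitMk Λ Λ' ∈ S), {c : P.CommensPair | c.1.1.Λ ∈ ({Λ} : Set _)} ∩
        {c : P.CommensPair | c.1.2.Λ ∈ ({Λ'} : Set _)} := by
    ext c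
    simp [orbit_mk]
  rw [this]
  refine isOpen_iUnion fun Λ => isOpen_iUnion fun Λ' => isOpen_iUnion fun _ => ?_
  exact ((isOpen_setOf_Λ _).preimage (continuous_fst.comp continuous_subtype_val)).inter
    ((isOpen_setOf_Λ _).preimage (continuous_snd.comp continuous_subtype_val))

theorem isClopen_preimage_orbit (S : Set (Orbits P)) : IsClopen (orbit ⁻¹' S) :=
  ⟨⟨isOpen_preimage_orbit Sᶜ⟩, isOpen_preimage_orbit S⟩

/-- Over the orbit of (Λ, Λ') every class has a representative with first ideal Λ and second ideal
Λ'. So the fibre is the image of the compact set of those L with ideal Λ which have a commensurable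
partner with ideal Λ'. -/
theorem isCompact_preimage_orbit [IsDedekindDomain P.ringA] [IsFractionRing P.ringA K]
    [Ring.HasFiniteQuotients P.ringA] {S : Set (Orbits P)} (hS : S.Finite) :
    IsCompact (orbit ⁻¹' S) := by
  have : (orbit : P.Groupoid → _) ⁻¹' S = ⋃ o ∈ S, orbit ⁻¹' {o} := by ext; simp
  rw [this]
  refine hS.isCompact_biUnion fun o _ => ?_
  obtain ⟨⟨Λ, Λ'⟩, rfl⟩ := Quotient.mk''_surjective o
  change IsCompact (orbit ⁻¹' {orbitMk Λ Λ'})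
  have hcomp : IsCompact ({L : P.KLattice | L.Λ = Λ} ∩ partnerSet P Λ') :=
    (isCompact_setOf_Λ_eq Λ).inter_right (isClopen_partnerSet Λ').1
  have hcs : CompactSpace ↥({L : P.KLattice | L.Λ = Λ} ∩ partnerSet P Λ') :=
    isCompact_iff_compactSpace.1 hcomp
  let g : ↥({L : P.KLattice | L.Λ = Λ} ∩ partnerSet P Λ') → P.CommensPair :=
    fun L => ⟨(L.1, L.1.partner Λ'), commens_partner L.2.2⟩
  have hg : Continuous g := by
    refine Continuous.subtype_mk (continuous_subtype_val.prodMk ?_) _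
    exact ((continuousOn_partner Λ').mono Set.inter_subset_right).domRestrict
  have hrange : orbit ⁻¹' {orbitMk Λ Λ'} = Set.range (mk ∘ g) := by
    ext c
    constructor
    · intro hc
      obtain ⟨⟨⟨L, M⟩, hLM⟩, rfl⟩ := Quot.exists_rep c
      obtain ⟨k, h1, h2⟩ := orbitMk_eq_iff.1 (Eq.symm hc : orbitMk Λ Λ' = orbitMk L.Λ M.Λ)
      have hs := hLM.scale k
      obtain rfl : (M.scale k).Λ = Λ' := h2
      refine ⟨⟨L.scale k, h1, hs.mem_partnerSet⟩, ?_⟩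
      refine Eq.trans ?_ (mk_scale k hLM)
      exact congrArg mk (Subtype.ext (Prod.ext rfl hs.partner_eq))
    · rintro ⟨L, rfl⟩
      change orbitMk L.1.Λ (L.1.partner Λ').Λ = orbitMk Λ Λ'
      rw [partner_Λ L.2.2, L.2.1]
  rw [hrange]
  exact isCompact_range (isQuotientMap_mk.continuous.comp hg)

theorem finite_image_orbit {C : Set P.Groupoid} (hC : IsCompact C) : (orbit '' C).Finite := by
  let t : TopologicalSpace (Orbits P) := ⊥
  have : DiscreteTopology (Orbits P) := ⟨rfl⟩
  have hcont : Continuous (orbit : P.Groupoid → Orbits P) :=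
    continuous_def.2 fun S _ => isOpen_preimage_orbit S
  exact (hC.image hcont).finite_of_discrete

end Groupoid

end Place
end FFQSM
end

/-! ### The convolution product. -/

noncomputable section
namespace FFQSM
variable {K : Type*} [Field K]
namespace Place
variable {P : Place K}

namespace KLattice

theorem finite_setOf_commens [IsFractionRing P.ringA K] (L : P.KLattice)
    {T : Set (Submodule P.ringA K)} (hT : T.Finite) :
    {M : P.KLattice | L.Commens M ∧ M.Λ ∈ T}.Finite := by
  refine (hT.image L.partner).subset ?_
  rintro M ⟨h, hM⟩
  exact ⟨M.Λ, hM, h.partner_eq⟩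

/-- This bounds the support of a convolution. After scaling (L, M) to the chosen representative of
its orbit, the ideal of N has finitely many possibilities. -/
theorem finite_setOf_orbitMk_comp [IsDedekindDomain P.ringA] [IsFractionRing P.ringA K]
    {S T : Set (Orbits P)} (hS : S.Finite) (hT : T.Finite) :
    {o | ∃ L M N : P.KLattice, orbitMk L.Λ M.Λ ∈ S ∧ orbitMk M.Λ N.Λ ∈ T ∧
      orbitMk L.Λ N.Λ = o}.Finite := by
  open scoped Pointwise in
  have hfin : (⋃ o ∈ S, (fun Λ' => orbitMk o.out.1 Λ') ''
      {Λ' | (o.out.2.FG ∧ o.out.2 ≠ ⊥) ∧ orbitMk o.out.2 Λ' ∈ T}).Finite := by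
    refine hS.biUnion fun o _ => Set.Finite.image _ ?_
    by_cases h : o.out.2.FG ∧ o.out.2 ≠ ⊥
    · exact (finite_setOf_orbitMk_mem_right h.1 h.2 hT).subset fun _ h => h.2
    · exact (Set.finite_empty).subset fun _ h' => h h'.1
  refine hfin.subset ?_
  rintro _ ⟨L, M, N, h1, h2, rfl⟩
  have hout : orbitMk (orbitMk L.Λ M.Λ).out.1 (orbitMk L.Λ M.Λ).out.2 = orbitMk L.Λ M.Λ :=
    Quotient.out_eq' _
  obtain ⟨k, hk, hk'⟩ := orbitMk_eq_iff.1 hout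
  refine Set.mem_biUnion h1 ⟨k • N.Λ, ⟨?_, ?_⟩, ?_⟩
  · rw [← hk']
    exact ⟨(M.scale k).fg, (M.scale k).ne_bot⟩
  · rw [← hk', orbitMk_smul]
    exact h2
  · change orbitMk _ _ = _
    rw [← hk, orbitMk_smul]

end KLattice

namespace ConvAlg

open KLattice

variable {f g : P.ConvAlg} {L M N : P.KLattice}

theorem val_of_commens (f : P.ConvAlg) (h : L.Commens M) :
    f.val L M = CompactlySupportedContinuousMap.toContinuousMap f (Groupoid.mk ⟨(L, M), h⟩) :=
  dif_pos h

theorem val_of_not_commens (f : P.ConvAlg) (h : ¬ L.Commens M) : f.val L M = 0 := dif_neg h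

theorem commens_of_val_ne_zero (h : f.val L M ≠ 0) : L.Commens M :=
  by_contra fun h' => h (val_of_not_commens f h')

theorem ext_val (h : ∀ L M, L.Commens M → f.val L M = g.val L M) : f = g := by
  refine DFunLike.ext (F := C_c(P.Groupoid, P.Cinf)) f g fun c => ?_
  obtain ⟨⟨⟨L, M⟩, hLM⟩, rfl⟩ := Quot.exists_rep c
  have := h L M hLM
  rwa [val_of_commens f hLM, val_of_commens g hLM] at this

theorem val_add (f g : P.ConvAlg) (L M : P.KLattice) :
    (f + g).val L M = f.val L M + g.val L M := by
  by_cases h : L.Commens M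
  · simp only [val_of_commens _ h]
    rfl
  · simp only [val_of_not_commens _ h, add_zero]

theorem val_smul (c : P.Cinf) (f : P.ConvAlg) (L M : P.KLattice) :
    (c • f).val L M = c * f.val L M := by
  by_cases h : L.Commens M
  · simp only [val_of_commens _ h]
    rfl
  · simp only [val_of_not_commens _ h, mul_zero]

theorem val_zero (L M : P.KLattice) : (0 : P.ConvAlg).val L M = 0 := by
  have := val_smul 0 (0 : P.ConvAlg) L M
  rwa [zero_smul, zero_mul] at this

theorem val_sum {ι : Type*} (s : Finset ι) (F : ι → P.ConvAlg) (L M : P.KLattice) :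
    (∑ i ∈ s, F i).val L M = ∑ i ∈ s, (F i).val L M :=
  map_sum (⟨⟨fun f => f.val L M, val_zero L M⟩, fun f g => val_add f g L M⟩ : P.ConvAlg →+ P.Cinf)
    F s

theorem val_scale (f : P.ConvAlg) (k : Kˣ) (L M : P.KLattice) :
    f.val (L.scale k) (M.scale k) = f.val L M := by
  by_cases h : L.Commens M
  · rw [val_of_commens f h, val_of_commens f (h.scale k), Groupoid.mk_scale k h]
  · rw [val_of_not_commens f h, val_of_not_commens f (mt (commens_scale_iff k).1 h)]

theorem continuous_val (f : P.ConvAlg) : Continuous fun c : P.CommensPair => f.val c.1.1 c.1.2 := by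
  have : (fun c : P.CommensPair => f.val c.1.1 c.1.2) =
      CompactlySupportedContinuousMap.toContinuousMap f ∘ Groupoid.mk :=
    funext fun c => val_of_commens f c.2
  rw [this]
  exact (ContinuousMap.continuous _).comp Groupoid.isQuotientMap_mk.continuous

theorem continuous_val_comp (f : P.ConvAlg) {X : Type*} [TopologicalSpace X] {a b : X → P.KLattice}
    (ha : Continuous a) (hb : Continuous b) (h : ∀ x, (a x).Commens (b x)) :
    Continuous fun x => f.val (a x) (b x) := by
  have h1 : Continuous fun x => (⟨(a x, b x), h x⟩ : P.CommensPair) :=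
    (ha.prodMk hb).subtype_mk h
  have h2 := f.continuous_val.comp h1
  exact h2

/-- A function in the convolution algebra lives on finitely many pairs of ideals modulo `K^*`. -/
theorem exists_finite_orbits (f : P.ConvAlg) : ∃ S : Set (Orbits P), S.Finite ∧
    ∀ L M, f.val L M ≠ 0 → orbitMk L.Λ M.Λ ∈ S := by
  refine ⟨_, Groupoid.finite_image_orbit
    (CompactlySupportedContinuousMap.hasCompactSupport' f), fun L M h => ?_⟩
  have hc := commens_of_val_ne_zero h
  refine ⟨Groupoid.mk ⟨(L, M), hc⟩, subset_closure ?_, rfl⟩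
  rw [val_of_commens f hc] at h
  exact h

theorem exists_norm_val_le (f : P.ConvAlg) : ∃ C, 0 ≤ C ∧ ∀ L M, ‖f.val L M‖ ≤ C := by
  obtain ⟨C, hC⟩ := (CompactlySupportedContinuousMap.hasCompactSupport' f).exists_bound_of_continuous
    (ContinuousMap.continuous (CompactlySupportedContinuousMap.toContinuousMap f))
  refine ⟨max C 0, le_max_right _ _, fun L M => ?_⟩
  by_cases h : L.Commens M
  · rw [val_of_commens f h]
    exact (hC _).trans (le_max_left _ _)
  · rw [val_of_not_commens f h, norm_zero]
    exact le_max_right _ _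

section

variable [IsDedekindDomain P.ringA] [IsFractionRing P.ringA K] [Ring.HasFiniteQuotients P.ringA]

/-- The source of elements of the convolution algebra: support over finitely many orbits is support
in a compact closed set. -/
theorem exists_val_eq (F : P.KLattice → P.KLattice → P.Cinf)
    (hinv : ∀ k L M, L.Commens M → F (L.scale k) (M.scale k) = F L M)
    (hcont : Continuous fun c : P.CommensPair => F c.1.1 c.1.2)
    (hfin : ∃ S : Set (Orbits P), S.Finite ∧ ∀ L M, L.Commens M → F L M ≠ 0 →
      orbitMk L.Λ M.Λ ∈ S) :
    ∃ f : P.ConvAlg, ∀ L M, L.Commens M → f.val L M = F L M := by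
  obtain ⟨S, hS, hFS⟩ := hfin
  let F' : P.Groupoid → P.Cinf := Quot.lift (fun c => F c.1.1 c.1.2) fun c d ⟨k, h1, h2⟩ => by
    rw [h1.eq, h2.eq, hinv k _ _ c.2]
  have hF' : Continuous F' := Groupoid.isQuotientMap_mk.continuous_iff.2 hcont
  have hsupp : HasCompactSupport F' := by
    refine HasCompactSupport.intro' (Groupoid.isCompact_preimage_orbit hS)
      (Groupoid.isClopen_preimage_orbit S).1 fun c hc => ?_
    obtain ⟨c, rfl⟩ := Quot.exists_rep c
    by_contra h
    exact hc (hFS _ _ c.2 h)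
  let f : P.ConvAlg := (⟨⟨F', hF'⟩, hsupp⟩ : C_c(P.Groupoid, P.Cinf))
  exact ⟨f, fun L M h => val_of_commens f h⟩

omit [Ring.HasFiniteQuotients P.ringA] in
theorem finite_support_mul (f g : P.ConvAlg) (L N : P.KLattice) :
    (Function.support fun M : P.KLattice => f.val L M * g.val M N).Finite := by
  obtain ⟨S, hS, hf⟩ := f.exists_finite_orbits
  refine (finite_setOf_commens L (finite_setOf_orbitMk_mem_right L.fg L.ne_bot hS)).subset ?_
  intro M hM
  have h := left_ne_zero_of_mul hM
  exact ⟨commens_of_val_ne_zero h, hf _ _ h⟩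

omit [IsDedekindDomain P.ringA] [Ring.HasFiniteQuotients P.ringA] in
theorem continuous_indicator_partner (f g : P.ConvAlg) (Λ : Submodule P.ringA K) :
    Continuous ({c : P.CommensPair | c.1.1 ∈ partnerSet P Λ}.indicator fun c =>
      f.val c.1.1 (c.1.1.partner Λ) * g.val (c.1.1.partner Λ) c.1.2) := by
  have hc1 : Continuous fun c : P.CommensPair => c.1.1 := continuous_fst.comp continuous_subtype_val
  have hc2 : Continuous fun c : P.CommensPair => c.1.2 := continuous_snd.comp continuous_subtype_val
  have hclopen : IsClopen {c : P.CommensPair | c.1.1 ∈ partnerSet P Λ} :=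
    (isClopen_partnerSet Λ).preimage hc1
  have hp : ContinuousOn (fun c : P.CommensPair => c.1.1.partner Λ)
      {c : P.CommensPair | c.1.1 ∈ partnerSet P Λ} :=
    (continuousOn_partner Λ).comp hc1.continuousOn fun _ h => h
  refine continuous_indicator (fun c hc => ?_) ?_
  · rw [hclopen.frontier_eq] at hc
    exact hc.elim
  rw [hclopen.1.closure_eq]
  rw [continuousOn_iff_continuous_domRestrict] at hp ⊢
  have h1 := hc1.comp (continuous_subtype_val
    (p := fun c => c ∈ {c : P.CommensPair | c.1.1 ∈ partnerSet P Λ}))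
  have h2 := hc2.comp (continuous_subtype_val
    (p := fun c => c ∈ {c : P.CommensPair | c.1.1 ∈ partnerSet P Λ}))
  exact (f.continuous_val_comp h1 hp fun c => commens_partner c.2).mul
    (g.continuous_val_comp hp h2 fun c => (commens_partner c.2).symm.trans c.1.2)

omit [Ring.HasFiniteQuotients P.ringA] in
open Classical in
-- Near a given pair the first ideal is constant, so M can be indexed by a fixed finite set of
-- ideals; each term is then a continuous function on a clopen set, extended by 0.
theorem continuous_finsum_mul (f g : P.ConvAlg) : Continuous fun c : P.CommensPair =>
    ∑ᶠ M : P.KLattice, f.val c.1.1 M * g.val M c.1.2 := by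
  obtain ⟨S, hS, hf⟩ := f.exists_finite_orbits
  refine continuous_iff_continuousAt.2 fun c₀ => ?_
  have hT := finite_setOf_orbitMk_mem_right c₀.1.1.fg c₀.1.1.ne_bot hS
  have hsum := continuous_finsetSum hT.toFinset fun Λ _ => continuous_indicator_partner f g Λ
  refine hsum.continuousAt.congr ?_
  have hU : IsOpen {c : P.CommensPair | c.1.1.Λ ∈ ({c₀.1.1.Λ} : Set _)} :=
    (isOpen_setOf_Λ _).preimage (continuous_fst.comp continuous_subtype_val)
  filter_upwards [hU.mem_nhds rfl] with c hc
  have hc' : c.1.1.Λ = c₀.1.1.Λ := hc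
  have hsub : (Function.support fun M : P.KLattice => f.val c.1.1 M * g.val M c.1.2) ⊆
      ((hT.toFinset.filter fun Λ => c.1.1 ∈ partnerSet P Λ).image c.1.1.partner : Finset _) := by
    intro M hM
    have h := left_ne_zero_of_mul hM
    have hcm := commens_of_val_ne_zero h
    refine Finset.mem_coe.2 (Finset.mem_image.2 ⟨M.Λ, Finset.mem_filter.2
      ⟨hT.mem_toFinset.2 ?_, hcm.mem_partnerSet⟩, hcm.partner_eq⟩)
    change orbitMk _ _ ∈ S
    rw [← hc']
    exact hf _ _ h
  rw [finsum_eq_sum_of_support_subset _ hsub, Finset.sum_image, Finset.sum_filter]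
  · refine Finset.sum_congr rfl fun Λ _ => ?_
    simp only [Set.indicator_apply, Set.mem_ofPred_eq]
  · intro Λ hΛ Λ' hΛ' h
    rw [← partner_Λ (Finset.mem_filter.1 hΛ).2, h, partner_Λ (Finset.mem_filter.1 hΛ').2]

theorem exists_isConvolution (f g : P.ConvAlg) : ∃ h, f.IsConvolution g h := by
  obtain ⟨S, hS, hf⟩ := f.exists_finite_orbits
  obtain ⟨T, hT, hg⟩ := g.exists_finite_orbits
  obtain ⟨h, hh⟩ := exists_val_eq (fun L N => ∑ᶠ M : P.KLattice, f.val L M * g.val M N)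
    (fun k L N _ => by
      -- Scaling permutes the intermediate lattices M, which gives invariance under K^*.
      rw [← finsum_comp_equiv (scaleEquiv k)]
      exact finsum_congr fun M => by
        change f.val _ (M.scale k) * g.val (M.scale k) _ = _
        rw [val_scale, val_scale])
    (continuous_finsum_mul f g)
    ⟨_, finite_setOf_orbitMk_comp hS hT, fun L N _ hLN => by
      obtain ⟨M, hM⟩ := not_forall.1 fun h => hLN (finsum_eq_zero_of_forall_eq_zero h)
      exact ⟨L, M, N, hf _ _ (left_ne_zero_of_mul hM), hg _ _ (right_ne_zero_of_mul hM), rfl⟩⟩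
  exact ⟨h, fun L N hLN => ⟨finite_support_mul f g L N, hh L N hLN⟩⟩

theorem isConvolution_mul (f g : P.ConvAlg) : f.IsConvolution g (f * g) := by
  have H := exists_isConvolution f g
  have : f * g = H.choose := dif_pos H
  rw [this]
  exact H.choose_spec

theorem val_mul (f g : P.ConvAlg) (h : L.Commens N) :
    (f * g).val L N = ∑ᶠ M : P.KLattice, f.val L M * g.val M N :=
  (isConvolution_mul f g L N h).2

end

end ConvAlg
end Place
end FFQSM
end

/-! ### The representations on the spaces 𝒱_L. -/

noncomputable section
namespace FFQSM
variable {K : Type*} [Field K]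
namespace Place
variable {P : Place K}

namespace KLattice

variable {L : P.KLattice}

namespace VL

theorem ext {ξ η : L.VL} (h : ∀ x, ξ x = η x) : ξ = η :=
  DFunLike.ext (F := C₀(L.CommensClass, P.Cinf)) ξ η h

theorem add_apply (ξ η : L.VL) (x : L.CommensClass) : (ξ + η) x = ξ x + η x := rfl

theorem sub_apply (ξ η : L.VL) (x : L.CommensClass) : (ξ - η) x = ξ x - η x := rfl

theorem smul_apply (c : P.Cinf) (ξ : L.VL) (x : L.CommensClass) : (c • ξ) x = c * ξ x := rfl

theorem norm_apply_le (ξ : L.VL) (x : L.CommensClass) : ‖ξ x‖ ≤ ‖ξ‖ :=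
  BoundedContinuousFunction.norm_coe_le_norm
    (ZeroAtInftyContinuousMap.toBCF (show C₀(L.CommensClass, P.Cinf) from ξ)) x

theorem norm_le {ξ : L.VL} {C : ℝ} (hC : 0 ≤ C) (h : ∀ x, ‖ξ x‖ ≤ C) : ‖ξ‖ ≤ C :=
  (BoundedContinuousFunction.norm_le hC
    (f := ZeroAtInftyContinuousMap.toBCF (show C₀(L.CommensClass, P.Cinf) from ξ))).2 h

theorem finite_setOf_le_norm (ξ : L.VL) {ε : ℝ} (hε : 0 < ε) : {x | ε ≤ ‖ξ x‖}.Finite := by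
  have h : Tendsto ξ (cocompact _) (𝓝 0) :=
    ZeroAtInftyContinuousMap.zero_at_infty' (show C₀(L.CommensClass, P.Cinf) from ξ)
  rw [cocompact_eq_cofinite] at h
  have := h.eventually (Metric.ball_mem_nhds 0 hε)
  rw [Filter.eventually_cofinite] at this
  refine this.subset fun x hx hx' => ?_
  exact not_lt.2 hx (mem_ball_zero_iff.1 hx')

theorem exists_apply_eq (F : L.CommensClass → P.Cinf) (h : ∀ ε > 0, {x | ε ≤ ‖F x‖}.Finite) :
    ∃ ξ : L.VL, ∀ x, ξ x = F x := by
  have hF : Tendsto F (cocompact _) (𝓝 0) := by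
    rw [cocompact_eq_cofinite, Metric.tendsto_nhds]
    intro ε hε
    rw [Filter.eventually_cofinite]
    refine (h ε hε).subset fun x hx => ?_
    simpa using hx
  exact ⟨(⟨⟨F, continuous_of_discreteTopology⟩, hF⟩ : C₀(L.CommensClass, P.Cinf)), fun _ => rfl⟩

theorem exists_continuousLinearMap (F : L.VL → L.CommensClass → P.Cinf)
    (hadd : ∀ ξ η x, F (ξ + η) x = F ξ x + F η x) (hsmul : ∀ c ξ x, F (c • ξ) x = c * F ξ x)
    {C : ℝ} (hC : 0 ≤ C) (hbound : ∀ ξ x, ‖F ξ x‖ ≤ C * ‖ξ‖)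
    (hfin : ∀ ξ, ∀ ε > 0, {x | ε ≤ ‖F ξ x‖}.Finite) :
    ∃ T : L.VL →L[P.Cinf] L.VL, ∀ ξ x, T ξ x = F ξ x := by
  choose T hT using fun ξ => exists_apply_eq (F ξ) (hfin ξ)
  let T' : L.VL →ₗ[P.Cinf] L.VL :=
    { toFun := T
      map_add' := fun ξ η => ext fun x => by rw [add_apply, hT, hT, hT, hadd]
      map_smul' := fun c ξ => ext fun x => by rw [hT, hsmul]; exact (congrArg (c * ·) (hT ξ x)).symm }
  exact ⟨T'.mkContinuous C fun ξ => norm_le (mul_nonneg hC (norm_nonneg _)) fun x => by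
    have := hbound ξ x
    rwa [← hT] at this, fun ξ x => hT ξ x⟩

end VL

theorem CommensClass.commens [IsFractionRing P.ringA K] (x y : L.CommensClass) :
    x.1.Commens y.1 := x.2.symm.trans y.2

section

variable [IsDedekindDomain P.ringA] [IsFractionRing P.ringA K]

theorem finite_row (f : P.ConvAlg) (x : L.CommensClass) :
    {y : L.CommensClass | f.val x.1 y.1 ≠ 0}.Finite := by
  obtain ⟨S, hS, hf⟩ := f.exists_finite_orbits
  have := finite_setOf_commens x.1 (finite_setOf_orbitMk_mem_right x.1.fg x.1.ne_bot hS)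
  refine (this.preimage (Subtype.val_injective.injOn)).subset fun y hy =>
    ⟨x.commens y, hf _ _ hy⟩

/-- Finiteness of rows makes the sums finite; finiteness of columns is what keeps the image of a
vector tending to 0. -/
theorem finite_column (f : P.ConvAlg) (y : L.CommensClass) :
    {x : L.CommensClass | f.val x.1 y.1 ≠ 0}.Finite := by
  obtain ⟨S, hS, hf⟩ := f.exists_finite_orbits
  have := finite_setOf_commens y.1 (finite_setOf_orbitMk_mem_left y.1.fg y.1.ne_bot hS)
  refine (this.preimage (Subtype.val_injective.injOn)).subset fun x hx =>
    ⟨y.commens x, hf _ _ hx⟩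

theorem finite_support_mul_apply (f : P.ConvAlg) (ξ : L.VL) (x : L.CommensClass) :
    (Function.support fun y : L.CommensClass => f.val x.1 y.1 * ξ y).Finite :=
  (finite_row f x).subset fun _ hy => left_ne_zero_of_mul hy

theorem _root_.IsUltrametricDist.norm_finsum_le_of_forall_le {E ι : Type*} [NormedAddCommGroup E]
    [IsUltrametricDist E] {a : ι → E} {C : ℝ} (hC : 0 ≤ C) (h : ∀ i, ‖a i‖ ≤ C) :
    ‖∑ᶠ i, a i‖ ≤ C := by
  classical
  rw [finsum_def]
  split_ifs
  · exact IsUltrametricDist.norm_sum_le_of_forall_le_of_nonneg hC fun i _ => h i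
  · rwa [norm_zero]

theorem exists_isPi (L : P.KLattice) (f : P.ConvAlg) : ∃ T, L.IsPi f T := by
  obtain ⟨C, hC, hfC⟩ := f.exists_norm_val_le
  have hbound : ∀ (ξ : L.VL) (x y : L.CommensClass), ‖f.val x.1 y.1 * ξ y‖ ≤ C * ‖ξ y‖ :=
    fun ξ x y => by rw [norm_mul]; exact mul_le_mul_of_nonneg_right (hfC _ _) (norm_nonneg _)
  obtain ⟨T, hT⟩ := VL.exists_continuousLinearMap (L := L)
    (fun ξ x => ∑ᶠ y : L.CommensClass, f.val x.1 y.1 * ξ y)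
    (fun ξ η x => by
      rw [← finsum_add_distrib (finite_support_mul_apply f ξ x) (finite_support_mul_apply f η x)]
      exact finsum_congr fun y => by rw [VL.add_apply, mul_add])
    (fun c ξ x => by
      refine Eq.trans ?_ (mul_finsum _ _).symm
      exact finsum_congr fun y => by rw [VL.smul_apply, mul_left_comm])
    hC
    (fun ξ x => IsUltrametricDist.norm_finsum_le_of_forall_le (mul_nonneg hC (norm_nonneg _))
      fun y => (hbound ξ x y).trans (mul_le_mul_of_nonneg_left (VL.norm_apply_le ξ y) hC))
    (fun ξ ε hε => by
      -- Only finitely many y have |ξ(y)| above this threshold. Outside the finite union of their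
      -- columns all terms are at most ε/2, and so is their ultrametric sum. The denominator C + 1
      -- allows for C = 0.
      have hfin := ξ.finite_setOf_le_norm (ε := ε / 2 / (C + 1)) (by positivity)
      refine (hfin.biUnion fun y _ => finite_column f y).subset fun x hx => ?_
      by_contra hx'
      simp only [Set.mem_iUnion, Set.mem_ofPred_eq, exists_prop, not_exists, not_and, not_not] at hx'
      have : ‖∑ᶠ y : L.CommensClass, f.val x.1 y.1 * ξ y‖ ≤ ε / 2 := by
        refine IsUltrametricDist.norm_finsum_le_of_forall_le (by positivity) fun y => ?_
        by_cases hy : ε / 2 / (C + 1) ≤ ‖ξ y‖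
        · rw [hx' y hy, zero_mul, norm_zero]
          positivity
        · rw [not_le, lt_div_iff₀ (by positivity)] at hy
          refine (hbound ξ x y).trans ?_
          nlinarith [norm_nonneg (ξ y)]
      have h2 : ε ≤ ‖∑ᶠ y : L.CommensClass, f.val x.1 y.1 * ξ y‖ := hx
      linarith)
  exact ⟨T, fun ξ x => ⟨finite_support_mul_apply f ξ x, hT ξ x⟩⟩

theorem isPi_piL (L : P.KLattice) (f : P.ConvAlg) : L.IsPi f (L.piL f) := by
  have H := exists_isPi L f
  have : L.piL f = H.choose := dif_pos H
  rw [this]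
  exact H.choose_spec

theorem piL_apply (L : P.KLattice) (f : P.ConvAlg) (ξ : L.VL) (x : L.CommensClass) :
    L.piL f ξ x = ∑ᶠ y : L.CommensClass, f.val x.1 y.1 * ξ y := (isPi_piL L f ξ x).2

theorem piL_add (L : P.KLattice) (f g : P.ConvAlg) : L.piL (f + g) = L.piL f + L.piL g := by
  refine ContinuousLinearMap.ext fun ξ => VL.ext fun x => ?_
  rw [add_apply, VL.add_apply, piL_apply, piL_apply, piL_apply,
    ← finsum_add_distrib (finite_support_mul_apply f ξ x) (finite_support_mul_apply g ξ x)]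
  exact finsum_congr fun y => by rw [ConvAlg.val_add, add_mul]

theorem piL_smul (L : P.KLattice) (c : P.Cinf) (f : P.ConvAlg) : L.piL (c • f) = c • L.piL f := by
  refine ContinuousLinearMap.ext fun ξ => VL.ext fun x => ?_
  rw [smul_apply, VL.smul_apply, piL_apply, piL_apply]
  refine Eq.trans ?_ (mul_finsum _ _).symm
  exact finsum_congr fun y => by rw [ConvAlg.val_smul, mul_assoc]

/-- `π_L` as a linear map to the Banach algebra. -/
def toBanachAlgHom (L : P.KLattice) : P.ConvAlg →ₗ[P.Cinf] L.BanachAlg where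
  toFun := L.toBanachAlg
  map_add' f g := Subtype.ext (piL_add L f g)
  map_smul' c f := Subtype.ext (piL_smul L c f)

open Classical in
theorem piL_mul [Ring.HasFiniteQuotients P.ringA] (L : P.KLattice) (f g : P.ConvAlg) :
    L.piL (f * g) = L.piL f * L.piL g := by
  refine ContinuousLinearMap.ext fun ξ => VL.ext fun x => ?_
  change _ = L.piL f (L.piL g ξ) x
  rw [piL_apply, piL_apply]
  let s := (finite_row f x).toFinset
  let t := s.biUnion fun y => (finite_row g y).toFinset
  have hs : ∀ y : L.CommensClass, f.val x.1 y.1 ≠ 0 → y ∈ s := fun y hy =>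
    (finite_row f x).mem_toFinset.2 hy
  have ht : ∀ y ∈ s, ∀ z : L.CommensClass, g.val y.1 z.1 ≠ 0 → z ∈ t := fun y hy z hz =>
    Finset.mem_biUnion.2 ⟨y, hy, (finite_row g y).mem_toFinset.2 hz⟩
  have hfg : ∀ z : L.CommensClass,
      (f * g).val x.1 z.1 = ∑ y ∈ s, f.val x.1 y.1 * g.val y.1 z.1 := fun z => by
    -- The convolution runs over all lattices, but its nonzero terms are commensurable with x and so
    -- belong to c(L).
    rw [ConvAlg.val_mul f g (x.commens z), finsum_eq_sum_of_support_subset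
      (s := s.map (⟨fun y => y.1, Subtype.val_injective⟩ : L.CommensClass ↪ P.KLattice))]
    · exact Finset.sum_map s _ _
    · intro M hM
      have h := left_ne_zero_of_mul hM
      exact Finset.mem_coe.2 (Finset.mem_map.2
        ⟨⟨M, x.2.trans (ConvAlg.commens_of_val_ne_zero h)⟩, hs _ h, rfl⟩)
  rw [finsum_eq_sum_of_support_subset (s := t), finsum_eq_sum_of_support_subset (s := s)]
  · have : ∀ y ∈ s, f.val x.1 y.1 * L.piL g ξ y =
        ∑ z ∈ t, f.val x.1 y.1 * (g.val y.1 z.1 * ξ z) := fun y hy => by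
      rw [piL_apply, finsum_eq_sum_of_support_subset (s := t), Finset.mul_sum]
      exact fun z hz => ht y hy z (left_ne_zero_of_mul hz)
    rw [Finset.sum_congr rfl this, Finset.sum_comm]
    refine Finset.sum_congr rfl fun z _ => ?_
    rw [hfg, Finset.sum_mul]
    exact Finset.sum_congr rfl fun y _ => mul_assoc _ _ _
  · exact fun y hy => hs y (left_ne_zero_of_mul hy)
  · intro z hz
    have h := left_ne_zero_of_mul hz
    rw [hfg] at h
    obtain ⟨y, hy, hyz⟩ := Finset.exists_ne_zero_of_sum_ne_zero h
    exact ht y hy z (right_ne_zero_of_mul hyz)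

end

end KLattice
end Place
end FFQSM
end

/-! ### Degrees of fractional ideals and relative indices. -/

noncomputable section
namespace FFQSM
variable {K : Type*} [Field K]
namespace Place
variable {P : Place K}

section Degree

open scoped Pointwise

theorem units_smul_eq_span_mul (k : Kˣ) (I : Submodule P.ringA K) :
    k • I = Submodule.span P.ringA {(k : K)} * I := by
  rw [Submodule.span_singleton_mul]
  rfl

theorem relIndex_units_smul (k : Kˣ) (I J : Submodule P.ringA K) :
    (k • I).toAddSubgroup.relIndex (k • J).toAddSubgroup =
      I.toAddSubgroup.relIndex J.toAddSubgroup := by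
  have h : ∀ I : Submodule P.ringA K,
      (k • I).toAddSubgroup = I.toAddSubgroup.map (AddMonoidHom.mulLeft (k : K)) := fun I =>
    AddSubgroup.ext fun x => Iff.rfl
  rw [h, h]
  exact AddSubgroup.relIndex_map_map_of_injective _ _ (mul_right_injective₀ k.ne_zero)

variable {Fq : Type*} [Field Fq] [Finite Fq] [Algebra Fq K]

theorem algebraMap_mem_ringA (c : Fq) : algebraMap Fq K c ∈ P.ringA :=
  P.mem_ringA_iff.2 fun O _ => algebraMap_mem_valuationSubring O c

variable [IsFractionRing P.ringA K]

theorem inf_ne_bot {I J : Submodule P.ringA K} (hI : I ≠ ⊥) (hJ : J ≠ ⊥) : I ⊓ J ≠ ⊥ := by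
  obtain ⟨x, hx, hx0⟩ := Submodule.exists_mem_ne_zero_of_ne_bot hI
  obtain ⟨a, ha, h⟩ := exists_mul_mem (Submodule.fg_span_singleton (R := P.ringA) x) hJ
  refine (Submodule.ne_bot_iff _).2 ⟨a * x, ⟨I.smul_mem a hx, ?_⟩, mul_ne_zero ha hx0⟩
  exact h x (Submodule.mem_span_singleton_self x)

/-- Some aI lies in N, so I modulo its intersection with N is finite; it is also an Fq-vector space.
Since indices are powers of q, `Nat.log` is exact and additive on them. -/
theorem exists_relIndex_eq_pow [Ring.HasFiniteQuotients P.ringA] (Fq : Type*) [Field Fq] [Finite Fq]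
    [Algebra Fq K] {I N : Submodule P.ringA K} (hI : I.FG) (hN : N ≠ ⊥) :
    ∃ n, N.toAddSubgroup.relIndex I.toAddSubgroup = Nat.card Fq ^ n := by
  obtain ⟨a, ha, haI⟩ := exists_mul_mem hI hN
  have ha' : a ≠ 0 := fun h => ha (by simp [h])
  have : Module.Finite P.ringA I := Module.Finite.iff_fg.2 hI
  have hfin : Finite (P.ringA ⧸ Ideal.span {a}) :=
    Ring.HasFiniteQuotients.finiteQuotient (by simpa using ha')
  have hfin' : Finite (I ⧸ (Ideal.span {a} • (⊤ : Submodule P.ringA I))) :=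
    Submodule.finite_quotient_smul _ Module.Finite.fg_top
  have hle : Ideal.span {a} • (⊤ : Submodule P.ringA I) ≤ N.submoduleOf I := by
    rw [Submodule.ideal_span_singleton_smul]
    rintro _ ⟨x, -, rfl⟩
    exact haI x x.2
  have hfin2 : Finite (I ⧸ N.submoduleOf I) :=
    Finite.of_surjective _ (Submodule.factor_surjective hle)
  let F : Fq →+* P.ringA := (algebraMap Fq K).codRestrict P.ringA algebraMap_mem_ringA
  let _ : Module Fq (I ⧸ N.submoduleOf I) := Module.compHom _ F
  have : Module.Finite Fq (I ⧸ N.submoduleOf I) := Module.Finite.of_finite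
  exact ⟨_, Module.natCard_eq_pow_finrank (K := Fq) (V := I ⧸ N.submoduleOf I)⟩

variable [IsDedekindDomain P.ringA] [Ring.HasFiniteQuotients P.ringA]

theorem log_relIndex_sub (Fq : Type*) [Field Fq] [Finite Fq] [Algebra Fq K]
    {I J N : Submodule P.ringA K} (hI : I.FG) (hJ : J.FG) (hN : N ≠ ⊥) (hNI : N ≤ I) (hNJ : N ≤ J) :
    (Nat.log (Nat.card Fq) (I.toAddSubgroup.relIndex J.toAddSubgroup) : ℤ) -
        Nat.log (Nat.card Fq) (J.toAddSubgroup.relIndex I.toAddSubgroup) =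
      Nat.log (Nat.card Fq) (N.toAddSubgroup.relIndex J.toAddSubgroup) -
        Nat.log (Nat.card Fq) (N.toAddSubgroup.relIndex I.toAddSubgroup) := by
  have hq : 1 < Nat.card Fq := Finite.one_lt_card
  have key : ∀ {I J : Submodule P.ringA K}, I.FG → J.FG → N ≤ I → N ≤ J →
      (Nat.log (Nat.card Fq) (I.toAddSubgroup.relIndex J.toAddSubgroup) : ℤ) =
        Nat.log (Nat.card Fq) (N.toAddSubgroup.relIndex J.toAddSubgroup) -
        Nat.log (Nat.card Fq) (N.toAddSubgroup.relIndex (I ⊓ J).toAddSubgroup) := by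
    intro I J hI hJ hNI hNJ
    have hIJ : (I ⊓ J).FG := by
      have := isNoetherian_of_fg_of_noetherian I hI
      exact (isNoetherian_submodule.1 this) _ inf_le_left
    obtain ⟨a, ha⟩ := exists_relIndex_eq_pow Fq hJ (ne_bot_of_le_ne_bot hN hNI)
    obtain ⟨b, hb⟩ := exists_relIndex_eq_pow Fq hJ hN
    obtain ⟨c, hc⟩ := exists_relIndex_eq_pow Fq hIJ hN
    have hmul : N.toAddSubgroup.relIndex (I ⊓ J).toAddSubgroup *
        (I.toAddSubgroup ⊓ J.toAddSubgroup).relIndex J.toAddSubgroup =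
          N.toAddSubgroup.relIndex J.toAddSubgroup :=
      AddSubgroup.relIndex_mul_relIndex N.toAddSubgroup (I ⊓ J).toAddSubgroup J.toAddSubgroup
        (fun _ hx => ⟨hNI hx, hNJ hx⟩) (fun _ hx => hx.2)
    rw [AddSubgroup.inf_relIndex_right, ha, hb, hc, ← pow_add] at hmul
    have := Nat.pow_right_injective hq hmul
    rw [ha, hb, hc, Nat.log_pow hq, Nat.log_pow hq, Nat.log_pow hq]
    omega
  rw [key hI hJ hNI hNJ, key hJ hI hNJ hNI, inf_comm J I]
  ring

/-- All indices are computed from the common sublattice I ∩ J ∩ A. The reference lattice A drops out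
of the difference, leaving an expression visibly invariant under K^*. -/
theorem idealDeg_sub (Fq : Type*) [Field Fq] [Finite Fq] [Algebra Fq K]
    {I J : Submodule P.ringA K} (hI : I.FG) (hJ : J.FG) (hI0 : I ≠ ⊥) (hJ0 : J ≠ ⊥) :
    P.idealDeg (Nat.card Fq) I - P.idealDeg (Nat.card Fq) J =
      (Nat.log (Nat.card Fq) (I.toAddSubgroup.relIndex J.toAddSubgroup) : ℤ) -
        Nat.log (Nat.card Fq) (J.toAddSubgroup.relIndex I.toAddSubgroup) := by
  have h1 : (1 : Submodule P.ringA K).FG := by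
    rw [Submodule.one_eq_span]
    exact Submodule.fg_span_singleton _
  have hN : I ⊓ J ⊓ 1 ≠ ⊥ := inf_ne_bot (inf_ne_bot hI0 hJ0) one_ne_zero
  have hNI : I ⊓ J ⊓ 1 ≤ I := inf_le_left.trans inf_le_left
  have hNJ : I ⊓ J ⊓ 1 ≤ J := inf_le_left.trans inf_le_right
  rw [idealDeg, idealDeg, log_relIndex_sub Fq hI h1 hN hNI inf_le_right,
    log_relIndex_sub Fq hJ h1 hN hNJ inf_le_right, log_relIndex_sub Fq hI hJ hN hNI hNJ]
  ring

theorem idealDeg_smul_sub (Fq : Type*) [Field Fq] [Finite Fq] [Algebra Fq K] (k : Kˣ)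
    (L M : P.KLattice) :
    P.idealDeg (Nat.card Fq) (k • L.Λ) - P.idealDeg (Nat.card Fq) (k • M.Λ) =
      P.idealDeg (Nat.card Fq) L.Λ - P.idealDeg (Nat.card Fq) M.Λ := by
  rw [idealDeg_sub Fq (I := k • L.Λ) (J := k • M.Λ) (L.scale k).fg (M.scale k).fg
    (L.scale k).ne_bot (M.scale k).ne_bot, idealDeg_sub Fq L.fg M.fg L.ne_bot M.ne_bot,
    relIndex_units_smul, relIndex_units_smul]

end Degree

end Place
end FFQSM
end

/-! ### Weights on ideals and the automorphisms they define. -/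

noncomputable section
namespace FFQSM
variable {K : Type*} [Field K]
namespace Place
variable {P : Place K}

open scoped Pointwise

theorem KLattice.continuous_comp_Λ {X : Type*} [TopologicalSpace X]
    (G : Submodule P.ringA K → X) : Continuous fun L : P.KLattice => G L.Λ :=
  continuous_def.2 fun s _ => isOpen_setOf_Λ (G ⁻¹' s)

namespace ConvAlg

open KLattice

variable [IsDedekindDomain P.ringA] [IsFractionRing P.ringA K] [Ring.HasFiniteQuotients P.ringA]

/-- The ideals of a pair are locally constant, so the factor G is automatically continuous, and it
does not enlarge the set of orbits of f. -/
theorem exists_val_eq_mul (G : Submodule P.ringA K → Submodule P.ringA K → P.Cinf)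
    (hG : ∀ (k : Kˣ) (L M : P.KLattice), G (k • L.Λ) (k • M.Λ) = G L.Λ M.Λ) (f : P.ConvAlg) :
    ∃ g : P.ConvAlg, ∀ L M, g.val L M = G L.Λ M.Λ * f.val L M := by
  obtain ⟨S, hS, hf⟩ := f.exists_finite_orbits
  have hcont : Continuous fun c : P.CommensPair => G c.1.1.Λ c.1.2.Λ := by
    refine continuous_iff_continuousAt.2 fun c₀ => ?_
    have h := (continuous_comp_Λ fun Λ => G Λ c₀.1.2.Λ).comp
      (continuous_fst.comp (continuous_subtype_val (p := fun c : P.KLattice × P.KLattice =>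
        c.1.Commens c.2)))
    refine h.continuousAt.congr ?_
    have hU : IsOpen {c : P.CommensPair | c.1.2.Λ ∈ ({c₀.1.2.Λ} : Set _)} :=
      (isOpen_setOf_Λ _).preimage (continuous_snd.comp continuous_subtype_val)
    filter_upwards [hU.mem_nhds rfl] with c hc
    have hc' : c.1.2.Λ = c₀.1.2.Λ := hc
    simp only [Function.comp, hc']
  obtain ⟨g, hg⟩ := exists_val_eq (fun L M => G L.Λ M.Λ * f.val L M)
    (fun k L M _ => by rw [val_scale]; exact congrArg (· * _) (hG k L M))
    (hcont.mul f.continuous_val)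
    ⟨S, hS, fun L M _ h => hf L M (right_ne_zero_of_mul h)⟩
  refine ⟨g, fun L M => ?_⟩
  by_cases h : L.Commens M
  · exact hg L M h
  · rw [val_of_not_commens _ h, val_of_not_commens _ h, mul_zero]

end ConvAlg

/-- A group of weights on fractional ideals: a family of homomorphisms from `G` to `C_∞^*`, one
for each fractional ideal, such that the ratio of the homomorphisms attached to two ideals depends
on these only up to simultaneous multiplication by an element of `K^*`. -/
structure Weight (P : Place K) (G : Type*) [Group G] where
  toFun : G → Submodule P.ringA K → P.Cinf
  map_one : ∀ Λ, toFun 1 Λ = 1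
  map_mul : ∀ g h Λ, toFun (g * h) Λ = toFun g Λ * toFun h Λ
  smul_div_smul : ∀ (g : G) (k : Kˣ) (L M : P.KLattice),
    toFun g (k • L.Λ) / toFun g (k • M.Λ) = toFun g L.Λ / toFun g M.Λ

namespace Weight

variable {G : Type*} [Group G] (ρ : Weight P G)

theorem mul_inv (g : G) (Λ : Submodule P.ringA K) : ρ.toFun g Λ * ρ.toFun g⁻¹ Λ = 1 := by
  rw [← ρ.map_mul, mul_inv_cancel, ρ.map_one]

theorem ne_zero (g : G) (Λ : Submodule P.ringA K) : ρ.toFun g Λ ≠ 0 :=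
  left_ne_zero_of_mul_eq_one (ρ.mul_inv g Λ)

section Aut

variable [IsDedekindDomain P.ringA] [IsFractionRing P.ringA K] [Ring.HasFiniteQuotients P.ringA]

/-- The function `(L, L') ↦ ρ_g(Λ) / ρ_g(Λ') f(L, L')`. -/
def twist (g : G) (f : P.ConvAlg) : P.ConvAlg :=
  (ConvAlg.exists_val_eq_mul (fun Λ Λ' => ρ.toFun g Λ / ρ.toFun g Λ') (ρ.smul_div_smul g) f).choose

theorem val_twist (g : G) (f : P.ConvAlg) (L M : P.KLattice) :
    (ρ.twist g f).val L M = ρ.toFun g L.Λ / ρ.toFun g M.Λ * f.val L M :=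
  (ConvAlg.exists_val_eq_mul (fun Λ Λ' => ρ.toFun g Λ / ρ.toFun g Λ')
    (ρ.smul_div_smul g) f).choose_spec L M

theorem twist_mul (g h : G) (f : P.ConvAlg) : ρ.twist (g * h) f = ρ.twist g (ρ.twist h f) :=
  ConvAlg.ext_val fun L M _ => by
    rw [val_twist, val_twist, val_twist, ρ.map_mul, ρ.map_mul, mul_div_mul_comm, mul_assoc]

theorem twist_one (f : P.ConvAlg) : ρ.twist 1 f = f :=
  ConvAlg.ext_val fun L M _ => by rw [val_twist, ρ.map_one, ρ.map_one, div_one, one_mul]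

theorem twist_smul (g : G) (c : P.Cinf) (f : P.ConvAlg) :
    ρ.twist g (c • f) = c • ρ.twist g f :=
  ConvAlg.ext_val fun L M _ => by
    rw [val_twist, ConvAlg.val_smul, ConvAlg.val_smul, val_twist, mul_left_comm]

/-- The automorphisms of the convolution algebra determined by a group of weights. -/
def aut : G →* RingAut P.ConvAlg where
  toFun g :=
    { toFun := ρ.twist g
      invFun := ρ.twist g⁻¹
      left_inv := fun f => by rw [← twist_mul, inv_mul_cancel, twist_one]
      right_inv := fun f => by rw [← twist_mul, mul_inv_cancel, twist_one]
      map_mul' := fun f f' => ConvAlg.ext_val fun L N h => by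
        rw [val_twist, ConvAlg.val_mul _ _ h, ConvAlg.val_mul _ _ h, mul_finsum]
        refine finsum_congr fun M => ?_
        rw [val_twist, val_twist]
        -- The weight of the intermediate ideal cancels between the two factors.
        have hM := ρ.ne_zero g M.Λ
        have hN := ρ.ne_zero g N.Λ
        field_simp
      map_add' := fun f f' => ConvAlg.ext_val fun L N h => by
        rw [val_twist, ConvAlg.val_add, ConvAlg.val_add, val_twist, val_twist, mul_add] }
  map_one' := RingEquiv.ext fun f => ρ.twist_one f
  map_mul' g h := RingEquiv.ext fun f => ρ.twist_mul g h f

end Aut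

section Banach

variable (hρ : ∀ g Λ, ‖ρ.toFun g Λ‖ = 1) (L : P.KLattice)

include hρ in
theorem exists_diag (g : G) : ∃ T : L.VL →L[P.Cinf] L.VL, ∀ ξ (x : L.CommensClass),
    T ξ x = ρ.toFun g x.1.Λ * ξ x := by
  have hn : ∀ (ξ : L.VL) (x : L.CommensClass), ‖ρ.toFun g x.1.Λ * ξ x‖ = ‖ξ x‖ := fun ξ x => by
    rw [norm_mul, hρ, one_mul]
  refine KLattice.VL.exists_continuousLinearMap (fun ξ x => ρ.toFun g x.1.Λ * ξ x)
    (fun ξ η x => mul_add _ _ _) (fun c ξ x => mul_left_comm _ _ _) zero_le_one (fun ξ x => ?_)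
    fun ξ ε hε => ?_
  · rw [hn, one_mul]
    exact ξ.norm_apply_le x
  · simp only [hn]
    exact ξ.finite_setOf_le_norm hε

/-- The isometry of `𝒱_L` which multiplies the value at `(Λ, φ)` by `ρ_g(Λ)`. -/
def diag (g : G) : L.VL →L[P.Cinf] L.VL := (ρ.exists_diag hρ L g).choose

theorem diag_apply (g : G) (ξ : L.VL) (x : L.CommensClass) :
    ρ.diag hρ L g ξ x = ρ.toFun g x.1.Λ * ξ x := (ρ.exists_diag hρ L g).choose_spec ξ x

theorem diag_mul (g h : G) : ρ.diag hρ L (g * h) = ρ.diag hρ L g * ρ.diag hρ L h :=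
  ContinuousLinearMap.ext fun ξ => KLattice.VL.ext fun x => by
    change _ = ρ.diag hρ L g (ρ.diag hρ L h ξ) x
    rw [diag_apply, diag_apply, diag_apply, ρ.map_mul, mul_assoc]

theorem diag_one : ρ.diag hρ L 1 = 1 :=
  ContinuousLinearMap.ext fun ξ => KLattice.VL.ext fun x => by
    change _ = ξ x
    rw [diag_apply, ρ.map_one, one_mul]

theorem norm_diag_le (g : G) (ξ : L.VL) : ‖ρ.diag hρ L g ξ‖ ≤ ‖ξ‖ :=
  KLattice.VL.norm_le (norm_nonneg _) fun x => by
    rw [diag_apply, norm_mul, hρ, one_mul]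
    exact ξ.norm_apply_le x

theorem diag_inv_mul_diag (g : G) : ρ.diag hρ L g⁻¹ * ρ.diag hρ L g = 1 := by
  rw [← diag_mul, inv_mul_cancel, diag_one]

/-- Conjugation by the isometry `diag g`. -/
def conj (g : G) (T : L.VL →L[P.Cinf] L.VL) : L.VL →L[P.Cinf] L.VL :=
  ρ.diag hρ L g * T * ρ.diag hρ L g⁻¹

theorem conj_add (g : G) (T T' : L.VL →L[P.Cinf] L.VL) :
    ρ.conj hρ L g (T + T') = ρ.conj hρ L g T + ρ.conj hρ L g T' := by
  rw [conj, mul_add, add_mul]; rfl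

theorem conj_smul (g : G) (c : P.Cinf) (T : L.VL →L[P.Cinf] L.VL) :
    ρ.conj hρ L g (c • T) = c • ρ.conj hρ L g T := by
  rw [conj, mul_smul_comm, smul_mul_assoc]; rfl

theorem conj_mul (g : G) (T T' : L.VL →L[P.Cinf] L.VL) :
    ρ.conj hρ L g (T * T') = ρ.conj hρ L g T * ρ.conj hρ L g T' := by
  have h := ρ.diag_inv_mul_diag hρ L g
  calc _ = ρ.diag hρ L g * T * 1 * (T' * ρ.diag hρ L g⁻¹) := by
        rw [conj, mul_one]; simp only [mul_assoc]
    _ = _ := by rw [← h]; simp only [conj, mul_assoc]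

theorem conj_mul_apply (g h : G) (T : L.VL →L[P.Cinf] L.VL) :
    ρ.conj hρ L (g * h) T = ρ.conj hρ L g (ρ.conj hρ L h T) := by
  simp only [conj, diag_mul, mul_inv_rev, mul_assoc]

theorem conj_one (T : L.VL →L[P.Cinf] L.VL) : ρ.conj hρ L 1 T = T := by
  rw [conj, inv_one, diag_one, one_mul, mul_one]

theorem continuous_conj (g : G) : Continuous (ρ.conj hρ L g) :=
  (continuous_const.mul continuous_id).mul continuous_const

variable [IsDedekindDomain P.ringA] [IsFractionRing P.ringA K] [Ring.HasFiniteQuotients P.ringA]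

/-- The twist is inner on 𝒱_L, so it makes sense on all bounded operators and extends to the
completion. -/
theorem conj_piL (g : G) (f : P.ConvAlg) :
    ρ.conj hρ L g (L.piL f) = L.piL (ρ.twist g f) :=
  ContinuousLinearMap.ext fun ξ => KLattice.VL.ext fun x => by
    change ρ.diag hρ L g (L.piL f (ρ.diag hρ L g⁻¹ ξ)) x = _
    rw [diag_apply, KLattice.piL_apply, KLattice.piL_apply]
    refine (mul_finsum _ _).trans (finsum_congr fun y => ?_)
    rw [diag_apply, val_twist, div_eq_mul_inv,
      ← eq_inv_of_mul_eq_one_right (ρ.mul_inv g y.1.Λ)]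
    ring

theorem conj_mem (g : G) {T : L.VL →L[P.Cinf] L.VL} (hT : T ∈ L.BanachAlg) :
    ρ.conj hρ L g T ∈ L.BanachAlg := by
  refine map_mem_closure (ρ.continuous_conj hρ L g) hT fun T hT => ?_
  induction hT using NonUnitalAlgebra.adjoin_induction with
  | mem T hT =>
    obtain ⟨f, rfl⟩ := hT
    rw [conj_piL]
    exact NonUnitalAlgebra.subset_adjoin P.Cinf (Set.mem_range_self _)
  | add T T' _ _ h h' => rw [conj_add]; exact add_mem h h'
  | zero =>
    have := ρ.conj_smul hρ L g 0 0
    rw [zero_smul, zero_smul] at this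
    rw [this]
    exact zero_mem _
  | mul T T' _ _ h h' => rw [conj_mul]; exact mul_mem h h'
  | smul c T _ h => rw [conj_smul]; exact SMulMemClass.smul_mem c h

/-- The automorphisms of the Banach algebra determined by a group of weights of absolute
value `1`. -/
def banachAut : G →* RingAut L.BanachAlg where
  toFun g :=
    { toFun := fun a => ⟨ρ.conj hρ L g a, ρ.conj_mem hρ L g a.2⟩
      invFun := fun a => ⟨ρ.conj hρ L g⁻¹ a, ρ.conj_mem hρ L g⁻¹ a.2⟩
      left_inv := fun a => Subtype.ext (by
        change ρ.conj hρ L g⁻¹ (ρ.conj hρ L g a) = a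
        rw [← conj_mul_apply, inv_mul_cancel, conj_one])
      right_inv := fun a => Subtype.ext (by
        change ρ.conj hρ L g (ρ.conj hρ L g⁻¹ a) = a
        rw [← conj_mul_apply, mul_inv_cancel, conj_one])
      map_mul' := fun a b => Subtype.ext (ρ.conj_mul hρ L g a b)
      map_add' := fun a b => Subtype.ext (ρ.conj_add hρ L g a b) }
  map_one' := RingEquiv.ext fun a => Subtype.ext (ρ.conj_one hρ L a)
  map_mul' g h := RingEquiv.ext fun a => Subtype.ext (ρ.conj_mul_apply hρ L g h a)

theorem banachAut_smul (g : G) (c : P.Cinf) (a : L.BanachAlg) :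
    ρ.banachAut hρ L g (c • a) = c • ρ.banachAut hρ L g a :=
  Subtype.ext (ρ.conj_smul hρ L g c a)

theorem continuous_banachAut (g : G) : Continuous (ρ.banachAut hρ L g) :=
  ((ρ.continuous_conj hρ L g).comp continuous_subtype_val).subtype_mk _

theorem banachAut_toBanachAlg (g : G) (f : P.ConvAlg) :
    ρ.banachAut hρ L g (L.toBanachAlg f) = L.toBanachAlg (ρ.aut g f) :=
  Subtype.ext (ρ.conj_piL hρ L g f)

variable [TopologicalSpace G] (hcont : ∀ Λ, Continuous fun g => ρ.toFun g Λ)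

omit [IsDedekindDomain P.ringA] [IsFractionRing P.ringA K] [Ring.HasFiniteQuotients P.ringA] in
include hcont in
-- Outside finitely many coordinates η(g₀) is smaller than ε/4 and the weights have norm 1, so only
-- those coordinates matter. The vector may vary with g because the conjugated operator is applied
-- to `diag g⁻¹ ξ`.
theorem continuous_diag_apply {η : G → L.VL} (hη : Continuous η) :
    Continuous fun g => ρ.diag hρ L g (η g) := by
  refine continuous_iff_continuousAt.2 fun g₀ => Metric.tendsto_nhds.2 fun ε hε => ?_
  have hfin := (η g₀).finite_setOf_le_norm (ε := ε / 4) (by positivity)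
  have h1 : ∀ᶠ g in 𝓝 g₀, ∀ x ∈ hfin.toFinset,
      ‖(ρ.toFun g x.1.Λ - ρ.toFun g₀ x.1.Λ) * η g₀ x‖ < ε / 2 := by
    refine (Finset.eventually_all _).2 fun x _ => ?_
    have h : Continuous fun g => ‖(ρ.toFun g x.1.Λ - ρ.toFun g₀ x.1.Λ) * η g₀ x‖ :=
      (((hcont x.1.Λ).sub continuous_const).mul continuous_const).norm
    refine h.continuousAt.eventually_lt_const ?_
    beta_reduce
    rw [sub_self, zero_mul, norm_zero]
    positivity
  have h2 : ∀ᶠ g in 𝓝 g₀, ‖η g - η g₀‖ < ε / 2 := by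
    have h : Continuous fun g => ‖η g - η g₀‖ := (hη.sub continuous_const).norm
    refine h.continuousAt.eventually_lt_const ?_
    beta_reduce
    rw [sub_self, norm_zero]
    positivity
  filter_upwards [h1, h2] with g h1 h2
  have h3 : ρ.diag hρ L g (η g) - ρ.diag hρ L g₀ (η g₀) =
      ρ.diag hρ L g (η g - η g₀) + (ρ.diag hρ L g (η g₀) - ρ.diag hρ L g₀ (η g₀)) := by
    rw [map_sub, sub_add_sub_cancel]
  have h4 : ‖ρ.diag hρ L g (η g₀) - ρ.diag hρ L g₀ (η g₀)‖ ≤ ε / 2 := by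
    refine KLattice.VL.norm_le (by positivity) fun x => ?_
    rw [KLattice.VL.sub_apply, diag_apply, diag_apply, ← sub_mul]
    by_cases hx : x ∈ hfin.toFinset
    · exact (h1 x hx).le
    · rw [Set.Finite.mem_toFinset, Set.mem_ofPred_eq, not_le] at hx
      rw [norm_mul]
      have := norm_sub_le (ρ.toFun g x.1.Λ) (ρ.toFun g₀ x.1.Λ)
      rw [hρ, hρ] at this
      nlinarith [norm_nonneg (η g₀ x)]
  rw [dist_eq_norm, h3]
  have h5 := ρ.norm_diag_le hρ L g (η g - η g₀)
  have h6 := norm_add_le (ρ.diag hρ L g (η g - η g₀))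
    (ρ.diag hρ L g (η g₀) - ρ.diag hρ L g₀ (η g₀))
  linarith

include hcont in
theorem continuous_banachAut_apply [ContinuousInv G] (a : L.BanachAlg) (ξ : L.VL) :
    Continuous fun g => (ρ.banachAut hρ L g a : L.VL →L[P.Cinf] L.VL) ξ := by
  have h1 : Continuous fun g => ρ.diag hρ L g⁻¹ ξ :=
    (ρ.continuous_diag_apply hρ L hcont continuous_const).comp continuous_inv
  exact ρ.continuous_diag_apply hρ L hcont
    ((a : L.VL →L[P.Cinf] L.VL).continuous.comp h1)

end Banach

end Weight

end Place
end FFQSM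
end

/-! ### The weights ⟨I⟩^y and I^s, and analyticity in s. -/

noncomputable section
namespace FFQSM
variable {K : Type*} [Field K]
namespace Place
variable {P : Place K}

open scoped Pointwise

/-- The default value 1 of `idealUnit` is itself a 1-unit, so no condition on I is needed. -/
theorem norm_idealUnit_sub_one_lt (u : P.Kinf) (I : Submodule P.ringA K) :
    ‖P.idealUnit u I - 1‖ < 1 := by
  rw [idealUnit]
  split_ifs with h
  · exact h.choose_spec.1
  · simp

section IdealWeight

variable {Fq : Type*} [Field Fq] [Finite Fq] [Algebra Fq K] {p : ℕ} [Fact p.Prime]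

/-- By multiplicativity kΛ contributes the factor ⟨(k)⟩^y to numerator and denominator, whether or
not k is positive. -/
theorem unitPow_idealUnit_smul_div_smul [CharP K p] [IsDedekindDomain P.ringA]
    [IsFractionRing P.ringA K] [Finite (ClassGroup P.ringA)] (hK : IsCurveFunctionField Fq K)
    {u : P.Kinf} (hu : P.IsUniformizer u) (y : ℤ_[p]) (k : Kˣ) (L M : P.KLattice) :
    P.unitPow (P.idealUnit u (k • L.Λ)) y / P.unitPow (P.idealUnit u (k • M.Λ)) y =
      P.unitPow (P.idealUnit u L.Λ) y / P.unitPow (P.idealUnit u M.Λ) y := by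
  have hk : Submodule.span P.ringA {(k : K)} ≠ ⊥ := by
    rw [Ne, Submodule.span_singleton_eq_bot]
    exact k.ne_zero
  have h : ∀ L : P.KLattice, P.unitPow (P.idealUnit u (k • L.Λ)) y =
      P.unitPow (P.idealUnit u (Submodule.span P.ringA {(k : K)})) y *
        P.unitPow (P.idealUnit u L.Λ) y := fun L => by
    rw [units_smul_eq_span_mul, idealUnit_mul hK hu (Submodule.fg_span_singleton _) hk L.fg L.ne_bot,
      unitPow_mul _ (norm_idealUnit_sub_one_lt _ _) (norm_idealUnit_sub_one_lt _ _)]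
  rw [h, h, mul_div_mul_left _ _ (P.unitPow_ne_zero (norm_idealUnit_sub_one_lt _ _) y)]

/-- The weights `⟨I⟩ ^ y`. -/
def unitWeight (p : ℕ) [Fact p.Prime] [CharP K p] [IsDedekindDomain P.ringA]
    [IsFractionRing P.ringA K] [Finite (ClassGroup P.ringA)] (hK : IsCurveFunctionField Fq K)
    {u : P.Kinf} (hu : P.IsUniformizer u) : Weight P (Multiplicative ℤ_[p]) where
  toFun y I := P.unitPow (P.idealUnit u I) y.toAdd
  map_one _ := P.unitPow_zero _
  map_mul _ _ _ := P.unitPow_add (norm_idealUnit_sub_one_lt _ _) _ _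
  smul_div_smul y k L M := unitPow_idealUnit_smul_div_smul hK hu y.toAdd k L M

theorem idealPow_div_idealPow (q : ℕ) (u : P.Kinf) (I J : Submodule P.ringA K) (s : P.S p) :
    P.idealPow q u I s / P.idealPow q u J s =
      (s.1 : P.Cinf) ^ (P.idealDeg q I - P.idealDeg q J) *
        (P.unitPow (P.idealUnit u I) s.2.toAdd / P.unitPow (P.idealUnit u J) s.2.toAdd) := by
  rw [idealPow, idealPow, zpow_sub₀ s.1.ne_zero, mul_div_mul_comm]

/-- The weights `I ^ s`. -/
def idealWeight (p : ℕ) [Fact p.Prime] [CharP K p] [IsDedekindDomain P.ringA]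
    [IsFractionRing P.ringA K] [Finite (ClassGroup P.ringA)] [Ring.HasFiniteQuotients P.ringA]
    (hK : IsCurveFunctionField Fq K) {u : P.Kinf} (hu : P.IsUniformizer u) : Weight P (P.S p) where
  toFun s I := P.idealPow (Nat.card Fq) u I s
  map_one I := by
    rw [idealPow]
    simp only [Prod.fst_one, Units.val_one, one_zpow, Prod.snd_one, toAdd_one, one_mul]
    exact P.unitPow_zero _
  map_mul s s' I := by
    simp only [idealPow, Prod.fst_mul, Units.val_mul, mul_zpow, Prod.snd_mul, toAdd_mul]
    rw [P.unitPow_add (norm_idealUnit_sub_one_lt _ _), mul_mul_mul_comm]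
  smul_div_smul s k L M := by
    rw [idealPow_div_idealPow, idealPow_div_idealPow, idealDeg_smul_sub Fq,
      unitPow_idealUnit_smul_div_smul hK hu]

end IdealWeight

section Analytic

open KLattice

theorem Weight.div_out {G : Type*} [Group G] (ρ : Weight P G) (g : G) (L M : P.KLattice) :
    ρ.toFun g (orbitMk L.Λ M.Λ).out.1 / ρ.toFun g (orbitMk L.Λ M.Λ).out.2 =
      ρ.toFun g L.Λ / ρ.toFun g M.Λ := by
  have hout : orbitMk (orbitMk L.Λ M.Λ).out.1 (orbitMk L.Λ M.Λ).out.2 = orbitMk L.Λ M.Λ :=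
    Quotient.out_eq' _
  obtain ⟨k, hk, hk'⟩ := orbitMk_eq_iff.1 hout
  rw [← hk, ← hk', ρ.smul_div_smul]

open Classical in
theorem isAnalyticOnS_sum {p : ℕ} [Fact p.Prime] {E ι : Type*} [NormedAddCommGroup E]
    [NormedSpace P.Cinf E] (S : Finset ι) (d : ι → ℤ) (c : ι → ℤ_[p] → P.Cinf) (b : ι → E)
    (hc : ∀ i, Continuous (c i)) :
    P.IsAnalyticOnS fun s : P.S p => ∑ i ∈ S, ((s.1 : P.Cinf) ^ d i * c i s.2.toAdd) • b i := by
  -- Terms are grouped by the exponent of x; only finitely many coefficients are nonzero, so the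
  -- decay condition holds for every radius.
  refine ⟨fun n y => ∑ i ∈ S with d i = n, c i y • b i, fun n => ?_, fun r hr ε hε => ?_,
    fun x y => ?_⟩
  · exact continuous_finsetSum _ fun i _ => (hc i).smul continuous_const
  · refine (S.image d).finite_toSet.subset fun n hn => ?_
    by_contra h
    refine hn fun y => ?_
    beta_reduce
    rw [Finset.sum_eq_zero, norm_zero, zero_mul]
    · exact hε.le
    · intro i hi
      rw [Finset.mem_filter] at hi
      exact (h (Finset.mem_coe.2 (Finset.mem_image.2 ⟨i, hi⟩))).elim
  · have h1 : ∑ i ∈ S, ((x : P.Cinf) ^ d i * c i y) • b i =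
        ∑ n ∈ S.image d, (x : P.Cinf) ^ n • ∑ i ∈ S with d i = n, c i y • b i := by
      rw [← Finset.sum_fiberwise_of_maps_to (fun i hi => Finset.mem_image_of_mem d hi)]
      refine Finset.sum_congr rfl fun n _ => ?_
      rw [Finset.smul_sum]
      refine Finset.sum_congr rfl fun i hi => ?_
      rw [mul_smul, (Finset.mem_filter.1 hi).2]
    change HasSum _ (∑ i ∈ S, ((x : P.Cinf) ^ d i * c i y) • b i)
    rw [h1]
    refine hasSum_sum_of_ne_finset_zero fun n hn => ?_
    beta_reduce
    rw [Finset.sum_eq_zero, smul_zero]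
    intro i hi
    rw [Finset.mem_filter] at hi
    exact (hn (Finset.mem_image.2 ⟨i, hi⟩)).elim

variable [IsDedekindDomain P.ringA] [IsFractionRing P.ringA K] [Ring.HasFiniteQuotients P.ringA]

open Classical in
theorem ConvAlg.exists_restrict_orbit (f : P.ConvAlg) (o : Orbits P) :
    ∃ g : P.ConvAlg, ∀ L M, g.val L M = if orbitMk L.Λ M.Λ = o then f.val L M else 0 := by
  obtain ⟨g, hg⟩ := f.exists_val_eq_mul (fun Λ Λ' => if orbitMk Λ Λ' = o then 1 else 0)
    fun k L M => by rw [orbitMk_smul]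
  exact ⟨g, fun L M => by rw [hg, ite_mul, one_mul, zero_mul]⟩

/-- The action of a group of weights on a function is a finite sum of multiples, by ratios of
weights, of functions which do not depend on the weights. -/
theorem Weight.exists_twist_eq_sum (f : P.ConvAlg) : ∃ (S : Finset (Orbits P))
    (F : Orbits P → P.ConvAlg), ∀ {G : Type*} [Group G] (ρ : Weight P G) (g : G),
      ρ.twist g f = ∑ o ∈ S, (ρ.toFun g o.out.1 / ρ.toFun g o.out.2) • F o := by
  classical
  obtain ⟨S, hS, hf⟩ := f.exists_finite_orbits
  choose F hF using f.exists_restrict_orbit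
  refine ⟨hS.toFinset, F, fun ρ g => ConvAlg.ext_val fun L M _ => ?_⟩
  rw [val_twist, ConvAlg.val_sum]
  simp only [ConvAlg.val_smul, hF, mul_ite, mul_zero, Finset.sum_ite_eq, Set.Finite.mem_toFinset]
  rw [ρ.div_out]
  split_ifs with h
  · rfl
  · rw [by_contra fun h' => h (hf L M h'), mul_zero]

theorem isAnalyticOnS_toBanachAlg_twist {Fq : Type*} [Field Fq] [Finite Fq] [Algebra Fq K] {p : ℕ}
    [Fact p.Prime] [CharP K p] [Finite (ClassGroup P.ringA)] (hK : IsCurveFunctionField Fq K)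
    {u : P.Kinf} (hu : P.IsUniformizer u) (L : P.KLattice) (f : P.ConvAlg) :
    P.IsAnalyticOnS fun s : P.S p => L.toBanachAlg ((idealWeight p hK hu).twist s f) := by
  -- On each orbit the exponent of x is a constant, the difference of degrees at a representative,
  -- and y enters only through a quotient of continuous powers of 1-units.
  obtain ⟨S, F, hF⟩ := Weight.exists_twist_eq_sum f
  have h := isAnalyticOnS_sum (P := P) (p := p) S
    (fun o => P.idealDeg (Nat.card Fq) o.out.1 - P.idealDeg (Nat.card Fq) o.out.2)
    (fun o y => P.unitPow (P.idealUnit u o.out.1) y / P.unitPow (P.idealUnit u o.out.2) y)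
    (fun o => L.toBanachAlg (F o))
    (fun o => (P.continuous_unitPow (norm_idealUnit_sub_one_lt _ _)).div
      (P.continuous_unitPow (norm_idealUnit_sub_one_lt _ _))
      fun y => P.unitPow_ne_zero (norm_idealUnit_sub_one_lt _ _) y)
  refine Eq.mp (congrArg _ (funext fun s => ?_)) h
  rw [hF (idealWeight p hK hu) s]
  refine Eq.trans ?_ (map_sum L.toBanachAlgHom _ S).symm
  refine Finset.sum_congr rfl fun o _ => ?_
  rw [map_smul, ← idealPow_div_idealPow]
  rfl

end Analytic

end Place
end FFQSM
end

theorem proposition4p3 {Fq K : Type*} [Field Fq] [Finite Fq] [Field K] [Algebra Fq K]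
    (p : ℕ) [Fact p.Prime] [CharP Fq p] (hK : FFQSM.IsCurveFunctionField Fq K)
    (P : FFQSM.Place K) (u : P.Kinf) (hu : P.IsUniformizer u) :
    -- the convolution product and the representations `π_L` are well defined
    (∀ f g : P.ConvAlg, f.IsConvolution g (f * g)) ∧
    (∀ (L : P.KLattice) (f : P.ConvAlg), L.IsPi f (L.piL f)) ∧
    (∀ (L : P.KLattice) (f g : P.ConvAlg), L.piL (f * g) = L.piL f * L.piL g) ∧
    -- the time evolution `σ` on the convolution algebra
    ∃ σ : Multiplicative ℤ_[p] →* RingAut P.ConvAlg,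
      (∀ (y : ℤ_[p]) (f : P.ConvAlg) (L L' : P.KLattice),
        (σ (Multiplicative.ofAdd y) f).val L L' =
          P.unitPow (P.idealUnit u L.Λ) y / P.unitPow (P.idealUnit u L'.Λ) y * f.val L L') ∧
      (∀ (y : ℤ_[p]) (c : P.Cinf) (f : P.ConvAlg),
        σ (Multiplicative.ofAdd y) (c • f) = c • σ (Multiplicative.ofAdd y) f) ∧
      -- it is a continuous time evolution on the Banach algebra, for the norm of each `π_L`
      (∀ L : P.KLattice, ∃ σL : Multiplicative ℤ_[p] →* RingAut L.BanachAlg,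
        (∀ (y : ℤ_[p]) (f : P.ConvAlg),
          σL (Multiplicative.ofAdd y) (L.toBanachAlg f) =
            L.toBanachAlg (σ (Multiplicative.ofAdd y) f)) ∧
        FFQSM.IsContinuousTimeEvolution
          (fun a : L.BanachAlg => (a : L.VL →L[P.Cinf] L.VL)) σL) ∧
      -- the analytic extension to `S_∞`
      ∃ σS : P.S p →* RingAut P.ConvAlg,
        (∀ y : ℤ_[p], σS (1, Multiplicative.ofAdd y) = σ (Multiplicative.ofAdd y)) ∧
        (∀ (s : P.S p) (f : P.ConvAlg) (L L' : P.KLattice),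
          (σS s f).val L L' =
            P.idealPow (Nat.card Fq) u L.Λ s / P.idealPow (Nat.card Fq) u L'.Λ s * f.val L L') ∧
        (∀ (s : P.S p) (c : P.Cinf) (f : P.ConvAlg), σS s (c • f) = c • σS s f) ∧
        (∀ (L : P.KLattice) (f : P.ConvAlg),
          P.IsAnalyticOnS fun s : P.S p => L.toBanachAlg (σS s f)) := by
  have : CharP K p := charP_of_injective_algebraMap (algebraMap Fq K).injective p
  obtain ⟨_, _, _, _⟩ := P.ringA_isDedekindDomain hK
  -- Powers of 1-units have norm 1, which is what allows the twist by ⟨I⟩^y to be extended to the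
  -- completions.
  have hu1 : ∀ y Λ, ‖(FFQSM.Place.unitWeight p hK hu).toFun y Λ‖ = 1 := fun y Λ =>
    P.norm_unitPow (FFQSM.Place.norm_idealUnit_sub_one_lt u Λ) y.toAdd
  have hcont : ∀ Λ, Continuous fun y => (FFQSM.Place.unitWeight p hK hu).toFun y Λ := fun Λ =>
    (P.continuous_unitPow (FFQSM.Place.norm_idealUnit_sub_one_lt u Λ)).comp continuous_toAdd
  refine ⟨FFQSM.Place.ConvAlg.isConvolution_mul, FFQSM.Place.KLattice.isPi_piL,
    FFQSM.Place.KLattice.piL_mul, (FFQSM.Place.unitWeight p hK hu).aut,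
    fun y f L M => (FFQSM.Place.unitWeight p hK hu).val_twist _ f L M,
    fun y c f => (FFQSM.Place.unitWeight p hK hu).twist_smul _ c f, fun L => ?_,
    (FFQSM.Place.idealWeight p hK hu).aut, fun y => RingEquiv.ext fun f => ?_,
    fun s f L M => (FFQSM.Place.idealWeight p hK hu).val_twist s f L M,
    fun s c f => (FFQSM.Place.idealWeight p hK hu).twist_smul s c f,
    FFQSM.Place.isAnalyticOnS_toBanachAlg_twist hK hu⟩
  · refine ⟨(FFQSM.Place.unitWeight p hK hu).banachAut hu1 L, fun y f =>
      (FFQSM.Place.unitWeight p hK hu).banachAut_toBanachAlg hu1 L _ f, fun y c a =>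
      (FFQSM.Place.unitWeight p hK hu).banachAut_smul hu1 L _ c a, fun y =>
      (FFQSM.Place.unitWeight p hK hu).continuous_banachAut hu1 L _, fun a ξ => ?_⟩
    exact ((FFQSM.Place.unitWeight p hK hu).continuous_banachAut_apply hu1 L hcont a ξ).comp
      continuous_ofAdd
  · refine FFQSM.Place.ConvAlg.ext_val fun L M _ => ?_
    refine ((FFQSM.Place.idealWeight p hK hu).val_twist _ f L M).trans
      (Eq.trans ?_ ((FFQSM.Place.unitWeight p hK hu).val_twist _ f L M).symm)
    congr 1
    refine (FFQSM.Place.idealPow_div_idealPow _ u L.Λ M.Λ _).trans ?_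
    rw [Units.val_one, one_zpow, one_mul]
    rfl
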